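/- Let $E=(E^0,E^1,s,r)$ be a finite directed graph with no sinks (every vertex is the source of some edge; there may be vertices that are not the range of an edge). A path of length $k\ge 1$ is $\alpha=e_1\cdots e_k$ with $s(e_j)=r(e_{j+1})$, with $s(\alpha)=s(e_k)$, $r(\alpha)=r(e_1)$; paths of length $0$ are the vertices; $E^k$ is the set of paths of length $k$. Let $X_E^{\otimes k}$ be the Hilbert module over $A=c(E^0)$ with basis $\{\delta_\alpha:\alpha\in E^k\}$, inner product $\langle x,y\rangle(v)=\sum_{s(\alpha)=v}\overline{x(\alpha)}y(\alpha)$ and left action $\varphi_k(a)\delta_\alpha=a(r(\alpha))\delta_\alpha$. Let $\mathcal F=\bigoplus_{k\ge0}X_E^{\otimes k}$ be the Fock correspondence, $\mathcal L(\mathcal F)$ the C*-algebra of adjointable operators on $\mathcal F$, $\mathcal K$ the ideal of generalized compact operators (the closed linear span of the operators $z\mapsto x\langle y,z\rangle$), and $q:\mathcal L(\mathcal F)\to\mathcal L(\mathcal F)/\mathcal K$ the quotient map. Let $P_v\delta_\beta=\delta_\beta$ if $r(\beta)=v$ and $0$ otherwise, $S_e\delta_\beta=\delta_{e\beta}$ if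 $s(e)=r(\beta)$ and $0$ otherwise, $S_\alpha=S_{e_1}\cdots S_{e_k}$ for $\alpha=e_1\cdots e_k$, and $S_v=P_v$ for a vertex $v$. Let $\{Z_k\}_{k\ge0}$ be a weight sequence: $Z_k$ is a positive invertible adjointable operator on $X_E^{\otimes k}$ commuting with $\varphi_k(A)$, $Z_0=I$, $\sup_k\|Z_k\|<\infty$, and there is $\epsilon>0$ with $Z_k\ge\epsilon I$ for all $k\ge1$. Put $Z=\mathrm{diag}(Z_0,Z_1,\dots)$ on $\mathcal F$, let $\mathcal T$ be the C*-algebra generated by $\{ZS_e:e\in E^1\}$, and let $\mathcal D$ be the fixed point algebra in $\mathcal T$ of the gauge action $\gamma_t=\mathrm{Ad}(W_t)$, where $W_t\delta_\alpha=e^{i|\alpha|t}\delta_\alpha$ ($t\in\mathbb R$). Write $u_\alpha=q(S_\alpha)$ and $z=q(Z)$. Let $p\ge1$ and assume Condition A(p): $\lim_{k\to\infty}\|I_p\otimes Z_k-Z_{k+p}\|=0$, where $(I_p\otimes Z_k)\delta_{\beta\gamma}=\delta_\beta\otimes Z_k\delta_\gamma$ for $|\beta|=p$, $|\gamma|=k$.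 For $n\ge0$ let $\mathcal C_n$ be the C*-algebra generated by $\{u_\alpha z^lu_\beta^*: l\ge0,\ np\le|\alpha|=|\beta|<(n+1)p,\ s(\alpha)=s(\beta)\}$. For every $v\in E^0$ fix a path $\xi_v$ of length $p-1$ with $s(\xi_v)=v$, and put $\mathcal C_v=u_{\xi_v}u_{\xi_v}^*\,\mathcal C_0\,u_{\xi_v}u_{\xi_v}^*\subseteq\mathcal C_0$. Let $\Gamma_n=E^{(n+1)p-1}$, let $e_{\gamma_1,\gamma_2}$ be the matrix units of $M_{\Gamma_n}(\mathbb C)$, and let $$\mathcal A_n=\sum_{\gamma_1,\gamma_2\in\Gamma_n,\ s(\gamma_1)=s(\gamma_2)}e_{\gamma_1,\gamma_2}\otimes\mathcal C_{s(\gamma_1)}\subseteq M_{\Gamma_n}(\mathbb C)\otimes\mathcal C_0 .$$ Then the following hold. (1) For every $n\ge0$, the map $$\tau_n(c)=\sum_{\gamma_1,\gamma_2\in\Gamma_n,\ s(\gamma_1)=s(\gamma_2)}e_{\gamma_1,\gamma_2}\otimes u_{\xi_{s(\gamma_1)}}u_{\gamma_1}^*\,c\,u_{\gamma_2}u_{\xi_{s(\gamma_1)}}^*$$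 is a $*$-isomorphism of $\mathcal C_n$ onto $\mathcal A_n$, with inverse given by $\tau_n^{-1}(e_{\gamma_1,\gamma_2}\otimes b)=u_{\gamma_1}u_{\xi_{s(\gamma_1)}}^*\,b\,u_{\xi_{s(\gamma_1)}}u_{\gamma_2}^*$ for $\gamma_1,\gamma_2\in\Gamma_n$ with $s(\gamma_1)=s(\gamma_2)$ and $b\in\mathcal C_{s(\gamma_1)}$. (2) $\mathcal C_n\subseteq\mathcal C_{n+1}\subseteq q(\mathcal D)$ for all $n\ge0$, and $q(\mathcal D)$ is closed, hence a C*-algebra. With $\iota_n:\mathcal C_n\to\mathcal C_{n+1}$ the inclusion and $\psi_n=\tau_{n+1}\circ\iota_n\circ\tau_n^{-1}:\mathcal A_n\to\mathcal A_{n+1}$, the algebra $q(\mathcal D)$, together with the maps $\mathcal A_n\xrightarrow{\ \tau_n^{-1}\ }\mathcal C_n\subseteq q(\mathcal D)$, is the direct limit of the sequence $(\mathcal A_n,\psi_n)$ in the category of C*-algebras and $*$-homomorphisms; in particular $q(\mathcal D)\cong\varinjlim(\mathcal A_n,\psi_n)$. -/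

import Mathlib

universe w

noncomputable section

/-- `I` is a closed self-adjoint two-sided ideal. -/
class IsCStarIdeal {A : Type*} [CStarAlgebra A] (I : Ideal A) : Prop where
  twoSided : I.IsTwoSided
  closed : IsClosed (I : Set A)
  star_mem : ∀ x ∈ I, star x ∈ I

namespace IsCStarIdeal

variable {A : Type*} [CStarAlgebra A] (I : Ideal A) [hI : IsCStarIdeal I]

instance : I.IsTwoSided := hI.twoSided
instance : IsClosed (I : Set A) := hI.closed

instance instStarQuot : Star (A ⧸ I) where
  star := Quotient.map' star (by
    intro a b h
    rw [Submodule.quotientRel_def] at h ⊢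
    rw [← star_sub]
    exact hI.star_mem _ h)

theorem star_mk (a : A) :
    star (Ideal.Quotient.mk I a) = Ideal.Quotient.mk I (star a) := rfl

instance instStarRingQuot : StarRing (A ⧸ I) where
  star_involutive x := by
    obtain ⟨a, rfl⟩ := Ideal.Quotient.mk_surjective x
    simp [star_mk]
  star_mul x y := by
    obtain ⟨a, rfl⟩ := Ideal.Quotient.mk_surjective x
    obtain ⟨b, rfl⟩ := Ideal.Quotient.mk_surjective y
    simp [star_mk, ← map_mul]
  star_add x y := by
    obtain ⟨a, rfl⟩ := Ideal.Quotient.mk_surjective x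
    obtain ⟨b, rfl⟩ := Ideal.Quotient.mk_surjective y
    simp [star_mk, ← map_add]

theorem norm_mk_le (a : A) : ‖Ideal.Quotient.mk I a‖ ≤ ‖a‖ :=
  Submodule.Quotient.norm_mk_le I a

theorem norm_mk_lt (x : A ⧸ I) {ε : ℝ} (hε : 0 < ε) :
    ∃ a : A, Ideal.Quotient.mk I a = x ∧ ‖a‖ < ‖x‖ + ε :=
  Submodule.Quotient.norm_mk_lt x hε

instance instNormedRingQuot : NormedRing (A ⧸ I) where
  __ := Submodule.Quotient.normedAddCommGroup I
  __ := Ideal.Quotient.ring I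
  norm_mul_le x y := by
    refine le_of_forall_pos_le_add fun ε hε => ?_
    have hc : Filter.Tendsto (fun δ : ℝ => (‖x‖ + δ) * (‖y‖ + δ)) (nhdsWithin 0 (Set.Ioi 0))
        (nhds (‖x‖ * ‖y‖)) := by
      have : Continuous (fun δ : ℝ => (‖x‖ + δ) * (‖y‖ + δ)) := by fun_prop
      simpa using (this.tendsto 0).mono_left nhdsWithin_le_nhds
    obtain ⟨δ, h1, h2⟩ := ((hc.eventually (gt_mem_nhds (show ‖x‖ * ‖y‖ < ‖x‖ * ‖y‖ + ε by
      linarith))).and self_mem_nhdsWithin).exists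
    obtain ⟨a, rfl, ha⟩ := norm_mk_lt I x h2
    obtain ⟨b, rfl, hb⟩ := norm_mk_lt I y h2
    refine le_trans ?_ h1.le
    rw [← map_mul]
    exact (norm_mk_le I _).trans ((norm_mul_le a b).trans
      (mul_le_mul ha.le hb.le (norm_nonneg _) ((norm_nonneg _).trans ha.le)))

theorem exists_approx (k : A) (hk : k ∈ I) {δ : ℝ} (hδ : 0 < δ) :
    ∃ e ∈ I, star e = e ∧ ‖1 - e‖ ≤ 1 ∧ ‖k * (1 - e)‖ < δ := by
  let : PartialOrder A := CStarAlgebra.spectralOrder A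
  have : StarOrderedRing A := CStarAlgebra.spectralOrderedRing A
  let J : NonUnitalStarSubalgebra ℂ A :=
    { carrier := I
      add_mem' := I.add_mem
      zero_mem' := I.zero_mem
      mul_mem' := fun {a b} _ hb => I.mul_mem_left a hb
      smul_mem' := fun c x hx => by
        have h := I.mul_mem_left (algebraMap ℂ A c) hx
        rwa [← Algebra.smul_def] at h
      star_mem' := fun {a} ha => hI.star_mem a ha }
  have : IsClosed (J : Set A) := hI.closed
  let : PartialOrder J := CStarAlgebra.spectralOrder J
  have : StarOrderedRing J := CStarAlgebra.spectralOrderedRing J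
  have hl := CStarAlgebra.increasingApproximateUnit J
  have ht := hl.tendsto_mul_left ⟨k, hk⟩
  have ht' := (Metric.tendsto_nhds.1 ht) δ hδ
  obtain ⟨e, ⟨⟨h0, h1⟩, h2⟩⟩ :=
    ((hl.eventually_nonneg.and hl.eventually_norm).and ht').exists
  obtain ⟨s, hs⟩ := CStarAlgebra.nonneg_iff_eq_star_mul_self.1 h0
  have he0 : (0 : A) ≤ (e : A) := by
    rw [show (e : A) = star (s : A) * (s : A) by
      rw [hs]; rfl]
    exact star_mul_self_nonneg _
  have he1 : (e : A) ≤ 1 := (CStarAlgebra.norm_le_one_iff_of_nonneg (e : A)).1 h1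
  refine ⟨e, e.2, (IsSelfAdjoint.of_nonneg he0).star_eq, ?_, ?_⟩
  · rw [CStarAlgebra.norm_le_one_iff_of_nonneg (1 - (e : A)) (sub_nonneg.2 he1)]
    simpa using he0
  · rw [dist_eq_norm] at h2
    rw [mul_sub, mul_one, norm_sub_rev]
    exact h2

/-- The quotient of a C⋆-algebra by a closed two-sided ideal is a C⋆-algebra, with the quotient
norm and the induced involution. -/
def quotCStarAlgebra : CStarAlgebra (A ⧸ I) where
  toStarRing := instStarRingQuot I
  toCompleteSpace := Submodule.Quotient.completeSpace I
  norm_mul_self_le x := by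
    obtain ⟨a, rfl⟩ := Ideal.Quotient.mk_surjective x
    refine le_of_forall_pos_le_add fun ε hε => ?_
    obtain ⟨b, hb, hb'⟩ := norm_mk_lt I (star (Ideal.Quotient.mk I a) * Ideal.Quotient.mk I a)
      (half_pos hε)
    have hk : star a * a - b ∈ I := by
      rw [← Ideal.Quotient.eq, map_mul, hb]; rfl
    obtain ⟨e, heI, hes, he1, hek⟩ := exists_approx I _ hk (half_pos hε)
    have h1 : ‖Ideal.Quotient.mk I a‖ ≤ ‖a * (1 - e)‖ := by
      refine le_trans (le_of_eq ?_) (norm_mk_le I (a * (1 - e)))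
      congr 1
      rw [Ideal.Quotient.eq, mul_sub, mul_one, sub_sub_cancel]
      exact I.mul_mem_left _ heI
    have h2 : ‖a * (1 - e)‖ * ‖a * (1 - e)‖ ≤ ‖star a * a * (1 - e)‖ := by
      rw [← CStarRing.norm_star_mul_self, star_mul, star_sub, star_one, hes]
      calc _ = ‖(1 - e) * (star a * a * (1 - e))‖ := by simp only [mul_assoc]
        _ ≤ ‖1 - e‖ * ‖star a * a * (1 - e)‖ := norm_mul_le _ _
        _ ≤ 1 * ‖star a * a * (1 - e)‖ := by gcongr
        _ = _ := one_mul _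
    have h3 : ‖star a * a * (1 - e)‖ ≤ ‖b‖ + ε / 2 := by
      calc _ = ‖b * (1 - e) + (star a * a - b) * (1 - e)‖ := by
            rw [← add_mul, add_sub_cancel]
        _ ≤ ‖b * (1 - e)‖ + ‖(star a * a - b) * (1 - e)‖ := norm_add_le _ _
        _ ≤ ‖b‖ * 1 + ε / 2 := by
            gcongr
            exact (norm_mul_le _ _).trans (by gcongr)
        _ = _ := by rw [mul_one]
    have h4 := mul_self_le_mul_self (norm_nonneg _) h1
    linarith
  toNormedAlgebra :=
    { __ := Ideal.Quotient.algebra ℂ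
      norm_smul_le := fun c x => norm_smul_le c x }
  star_smul c x := by
    obtain ⟨a, rfl⟩ := Ideal.Quotient.mk_surjective x
    change Ideal.Quotient.mk I (star (c • a)) = star c • Ideal.Quotient.mk I (star a)
    rw [star_smul]; rfl

end IsCStarIdeal

/-! ### Hilbert modules over `c(V)` -/

/-- `ℓ²(I)`. Given a map `σ : I → V` to a finite set, this is the Hilbert module over
`A = c(V)` with basis `(δ_i)`, where `δ_i · a = a (σ i) δ_i`. -/
abbrev Ell2 (I : Type*) : Type _ := lp (fun _ : I => ℂ) 2

namespace Ell2

variable {I J V : Type*}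

theorem sum_sq_le (x : Ell2 I) (t : Finset I) : ∑ i ∈ t, ‖x i‖ ^ 2 ≤ ‖x‖ ^ 2 := by
  have h := lp.sum_rpow_le_norm_rpow (p := 2) (by norm_num) x t
  simpa using h

/-- A linear map into functions which is bounded in the `ℓ²`-sense, as a bounded operator. -/
def mkOp (T : Ell2 I →ₗ[ℂ] (J → ℂ)) (C : ℝ) (hC : 0 ≤ C)
    (h : ∀ x (t : Finset J), ∑ j ∈ t, ‖T x j‖ ^ 2 ≤ (C * ‖x‖) ^ 2) : Ell2 I →L[ℂ] Ell2 J :=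
  LinearMap.mkContinuous
    { toFun := fun x => ⟨T x, memℓp_gen' (C := (C * ‖x‖) ^ 2) (by simpa using h x)⟩
      map_add' := fun x y => by ext j; exact congrFun (map_add T x y) j
      map_smul' := fun c x => by ext j; exact congrFun (map_smul T c x) j } C
    (fun x => lp.norm_le_of_forall_sum_le (by norm_num) (by positivity) (by simpa using h x))

@[simp] theorem mkOp_apply (T : Ell2 I →ₗ[ℂ] (J → ℂ)) (C : ℝ) (hC : 0 ≤ C)
    (h : ∀ x (t : Finset J), ∑ j ∈ t, ‖T x j‖ ^ 2 ≤ (C * ‖x‖) ^ 2) (x : Ell2 I) (j : J) :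
    mkOp T C hC h x j = T x j := rfl

/-- The diagonal operator `δ_i ↦ f i • δ_i` for a bounded function `f`. -/
def diagOp (f : I → ℂ) (hf : ∃ C, ∀ i, ‖f i‖ ≤ C) : Ell2 I →L[ℂ] Ell2 I :=
  mkOp { toFun := fun x i => f i * x i
         map_add' := fun x y => by ext i; simp [mul_add]
         map_smul' := fun c x => by ext i; simp [mul_left_comm] }
    (max hf.choose 0) (le_max_right _ _) (by
      intro x t
      have hf' : ∀ i, ‖f i‖ ≤ max hf.choose 0 := fun i => (hf.choose_spec i).trans (le_max_left _ _)
      calc ∑ i ∈ t, ‖f i * x i‖ ^ 2 ≤ ∑ i ∈ t, (max hf.choose 0) ^ 2 * ‖x i‖ ^ 2 := by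
            refine Finset.sum_le_sum fun i _ => ?_
            rw [norm_mul, mul_pow]
            gcongr
            exact hf' i
        _ = (max hf.choose 0) ^ 2 * ∑ i ∈ t, ‖x i‖ ^ 2 := by rw [Finset.mul_sum]
        _ ≤ _ := by
            rw [mul_pow]
            gcongr
            exact sum_sq_le x t)

@[simp] theorem diagOp_apply (f : I → ℂ) (hf : ∃ C, ∀ i, ‖f i‖ ≤ C) (x : Ell2 I) (i : I) :
    diagOp f hf x i = f i * x i := rfl

theorem exists_bound [Finite V] (a : V → ℂ) (f : I → V) : ∃ C, ∀ i, ‖a (f i)‖ ≤ C := by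
  cases nonempty_fintype V
  exact ⟨∑ v, ‖a v‖, fun i =>
    Finset.single_le_sum (f := fun v => ‖a v‖) (fun _ _ => norm_nonneg _) (Finset.mem_univ (f i))⟩

open Classical in
/-- For a relation `R` that is the graph of an injective partial map `I ⇀ J`, the operator
`δ_i ↦ δ_j` if `R i j`, and `δ_i ↦ 0` if there is no such `j`. -/
def partialOp (R : I → J → Prop) (_h₁ : ∀ i i' j, R i j → R i' j → i = i')
    (h₂ : ∀ i j j', R i j → R i j' → j = j') : Ell2 I →L[ℂ] Ell2 J :=
  mkOp { toFun := fun x j => if h : ∃ i, R i j then x h.choose else 0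
         map_add' := fun x y => by
          ext j
          by_cases h : ∃ i, R i j <;> simp [h]
         map_smul' := fun c x => by
          ext j
          by_cases h : ∃ i, R i j <;> simp [h] }
    1 zero_le_one (by
      intro x t
      simp only [LinearMap.coe_mk, AddHom.coe_mk, one_mul]
      let t' := t.filter (fun j => ∃ i, R i j)
      have e1 : ∑ j ∈ t, ‖(if h : ∃ i, R i j then x h.choose else 0 : ℂ)‖ ^ 2 =
          ∑ j ∈ t'.attach, ‖x (Finset.mem_filter.1 j.2).2.choose‖ ^ 2 := by
        rw [← Finset.sum_filter_of_ne (p := fun j => ∃ i, R i j), ← Finset.sum_attach]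
        · refine Finset.sum_congr rfl fun j _ => ?_
          rw [dif_pos (Finset.mem_filter.1 j.2).2]
        · intro j _ hj
          by_contra h
          simp [h] at hj
      rw [e1, ← Finset.sum_image (s := t'.attach) (f := fun i => ‖x i‖ ^ 2)
        (g := fun j => (Finset.mem_filter.1 j.2).2.choose)]
      · exact sum_sq_le x _
      · intro j _ j' _ hjj
        have a1 := (Finset.mem_filter.1 j.2).2.choose_spec
        have a2 := (Finset.mem_filter.1 j'.2).2.choose_spec
        simp only at hjj
        rw [hjj] at a1
        exact Subtype.ext (h₂ _ _ _ a1 a2))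

theorem partialOp_apply (R : I → J → Prop) (h₁ : ∀ i i' j, R i j → R i' j → i = i')
    (h₂ : ∀ i j j', R i j → R i j' → j = j') (x : Ell2 I) {i : I} {j : J} (h : R i j) :
    partialOp R h₁ h₂ x j = x i := by
  have h' : ∃ i, R i j := ⟨i, h⟩
  have : partialOp R h₁ h₂ x j = x h'.choose := dif_pos h'
  rw [this, h₁ _ _ _ h'.choose_spec h]

theorem partialOp_apply_of_not (R : I → J → Prop) (h₁ : ∀ i i' j, R i j → R i' j → i = i')
    (h₂ : ∀ i j j', R i j → R i j' → j = j') (x : Ell2 I) {j : J} (h : ∀ i, ¬ R i j) :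
    partialOp R h₁ h₂ x j = 0 :=
  dif_neg (by simpa using h)

/-- The `c(V)`-valued inner product `⟨x, y⟩(v) = ∑_{σ i = v} conj (x i) * y i`. -/
def ainner (σ : I → V) (x y : Ell2 I) : V → ℂ :=
  fun v => ∑' i : {i // σ i = v}, (starRingEnd ℂ) (x i.1) * y i.1

/-- The right action `(x · a) i = x i * a (σ i)` of `a ∈ c(V)`. -/
def rightAct [Finite V] (σ : I → V) (a : V → ℂ) : Ell2 I →L[ℂ] Ell2 I :=
  diagOp (fun i => a (σ i)) (exists_bound a σ)

/-- `T` is an adjointable operator on the Hilbert `c(V)`-module `ℓ²(I)`. -/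
def IsAdjointable (σ : I → V) (T : Ell2 I →L[ℂ] Ell2 I) : Prop :=
  ∃ T' : Ell2 I → Ell2 I, ∀ x y, ainner σ (T x) y = ainner σ x (T' y)

open Classical in
/-- The right action of the indicator function of `v`. -/
def fiberProj [Finite V] (σ : I → V) (v : V) : Ell2 I →L[ℂ] Ell2 I :=
  rightAct σ (Pi.single v 1)

section
variable [Finite V] (σ : I → V)

open Classical in
theorem fiberProj_apply (v : V) (x : Ell2 I) (i : I) :
    fiberProj σ v x i = if σ i = v then x i else 0 := by
  simp [fiberProj, rightAct, Pi.single_apply]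

theorem inner_fiberProj (v : V) (x y : Ell2 I) :
    inner ℂ x (fiberProj σ v y) = ainner σ x y v := by
  classical
  rw [lp.inner_eq_tsum, ainner]
  refine Eq.trans ?_ (tsum_subtype ({i | σ i = v} : Set I)
    (fun i => (starRingEnd ℂ) (x i) * y i)).symm
  refine tsum_congr fun i => ?_
  by_cases h : σ i = v <;> simp [fiberProj_apply, Set.indicator, h, mul_comm]

theorem fiberProj_adjoint (v : V) : star (fiberProj σ v) = fiberProj σ v := by
  rw [ContinuousLinearMap.star_eq_adjoint]
  symm
  rw [ContinuousLinearMap.eq_adjoint_iff]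
  intro x y
  classical
  rw [lp.inner_eq_tsum, lp.inner_eq_tsum]
  refine tsum_congr fun i => ?_
  by_cases h : σ i = v <;> simp [fiberProj_apply, h]

theorem sum_fiberProj [Fintype V] (x : Ell2 I) : ∑ v, fiberProj σ v x = x := by
  classical
  ext i
  rw [lp.coeFn_sum, Finset.sum_apply]
  simp [fiberProj_apply]

/-- Adjointable operators are those commuting with the right action. -/
theorem isAdjointable_iff (T : Ell2 I →L[ℂ] Ell2 I) :
    IsAdjointable σ T ↔ ∀ v, fiberProj σ v * T = T * fiberProj σ v := by
  cases nonempty_fintype V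
  constructor
  · rintro ⟨T', h⟩ v
    have hT' : ∀ y, T' y = star T y := by
      intro y
      refine ext_inner_left ℂ fun x => ?_
      rw [ContinuousLinearMap.star_eq_adjoint, ContinuousLinearMap.adjoint_inner_right]
      rw [← sum_fiberProj σ (T' y), inner_sum]
      conv_rhs => rw [← sum_fiberProj σ y, inner_sum]
      refine Finset.sum_congr rfl fun v _ => ?_
      rw [inner_fiberProj, inner_fiberProj, h]
    have h2 : star T * fiberProj σ v = fiberProj σ v * star T := by
      refine ContinuousLinearMap.ext fun y => ext_inner_left ℂ fun x => ?_
      simp only [mul_apply_eq_comp]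
      rw [inner_fiberProj, ← hT' y, ← h, ContinuousLinearMap.star_eq_adjoint,
        ContinuousLinearMap.adjoint_inner_right, inner_fiberProj]
    have h3 := congrArg star h2
    rwa [star_mul, star_mul, star_star, fiberProj_adjoint] at h3
  · intro h
    refine ⟨fun y => (star T : Ell2 I →L[ℂ] Ell2 I) y, fun x y => funext fun v => ?_⟩
    have h2 : star T * fiberProj σ v = fiberProj σ v * star T := by
      have := congrArg star (h v)
      rwa [star_mul, star_mul, fiberProj_adjoint] at this
    rw [← inner_fiberProj, ← inner_fiberProj, ← ContinuousLinearMap.adjoint_inner_right,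
      ← ContinuousLinearMap.star_eq_adjoint]
    exact congrArg (inner ℂ x) (congrArg (fun S => S y) h2)

/-- The C⋆-algebra `ℒ(ℓ²(I))` of adjointable operators. The adjoint of an adjointable operator is
its Hilbert space adjoint and its norm on the Hilbert module is its Hilbert space operator norm. -/
def adjointables : StarSubalgebra ℂ (Ell2 I →L[ℂ] Ell2 I) where
  carrier := {T | IsAdjointable σ T}
  mul_mem' {S T} hS hT := by
    simp only [Set.mem_ofPred_eq, isAdjointable_iff] at *
    intro v
    rw [← mul_assoc, hS, mul_assoc, hT, mul_assoc]
  add_mem' {S T} hS hT := by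
    simp only [Set.mem_ofPred_eq, isAdjointable_iff] at *
    intro v
    rw [mul_add, add_mul, hS, hT]
  algebraMap_mem' c := by
    simp only [Set.mem_ofPred_eq, isAdjointable_iff]
    intro v
    exact (Algebra.commutes c _).symm
  star_mem' {T} hT := by
    simp only [Set.mem_ofPred_eq, isAdjointable_iff] at *
    intro v
    have := congrArg star (hT v)
    rw [star_mul, star_mul, fiberProj_adjoint] at this
    exact this.symm

theorem mem_adjointables (T : Ell2 I →L[ℂ] Ell2 I) :
    T ∈ adjointables σ ↔ IsAdjointable σ T := Iff.rfl

instance : IsClosed (adjointables σ : Set (Ell2 I →L[ℂ] Ell2 I)) := by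
  have : (adjointables σ : Set (Ell2 I →L[ℂ] Ell2 I)) =
      ⋂ v, {T | fiberProj σ v * T = T * fiberProj σ v} := by
    ext T
    simp only [SetLike.mem_coe, mem_adjointables, isAdjointable_iff, Set.mem_iInter,
      Set.mem_ofPred_eq]
  rw [this]
  exact isClosed_iInter fun v => isClosed_eq (by fun_prop) (by fun_prop)

theorem diagOp_mem (f : I → ℂ) (hf : ∃ C, ∀ i, ‖f i‖ ≤ C) : diagOp f hf ∈ adjointables σ := by
  rw [mem_adjointables, isAdjointable_iff]
  intro v
  ext x i
  by_cases h : σ i = v <;> simp [fiberProj_apply, h]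

end

section
variable [Fintype V] (σ : I → V)

/-- The operator `θ_{x,y} z = x · ⟨y, z⟩`, see `theta_apply`. -/
def thetaOp (x y : Ell2 I) : Ell2 I →L[ℂ] Ell2 I :=
  ∑ v, (innerSL ℂ (fiberProj σ v y)).smulRight (fiberProj σ v x)

theorem fiberProj_inner (v : V) (x y : Ell2 I) :
    inner ℂ (fiberProj σ v x) y = ainner σ x y v := by
  rw [← inner_fiberProj, ← ContinuousLinearMap.adjoint_inner_right,
    ← ContinuousLinearMap.star_eq_adjoint, fiberProj_adjoint]

theorem thetaOp_apply (x y z : Ell2 I) : thetaOp σ x y z = rightAct σ (ainner σ y z) x := by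
  classical
  ext i
  simp only [thetaOp, sum_apply, ContinuousLinearMap.smulRight_apply,
    innerSL_apply_apply, fiberProj_inner, rightAct, diagOp_apply]
  rw [lp.coeFn_sum, Finset.sum_apply]
  simp [fiberProj_apply]

theorem mul_thetaOp (T : Ell2 I →L[ℂ] Ell2 I) (hT : T ∈ adjointables σ) (x y : Ell2 I) :
    T * thetaOp σ x y = thetaOp σ (T x) y := by
  rw [mem_adjointables, isAdjointable_iff] at hT
  ext1 z
  simp only [thetaOp, mul_apply_eq_comp, sum_apply,
    ContinuousLinearMap.smulRight_apply, map_sum, map_smul]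
  refine Finset.sum_congr rfl fun v _ => ?_
  congr 1
  exact congrArg (fun S => S x) (hT v).symm

theorem star_thetaOp (x y : Ell2 I) : star (thetaOp σ x y) = thetaOp σ y x := by
  rw [ContinuousLinearMap.star_eq_adjoint]
  symm
  rw [ContinuousLinearMap.eq_adjoint_iff]
  intro a b
  simp only [thetaOp, sum_apply, ContinuousLinearMap.smulRight_apply,
    innerSL_apply_apply, sum_inner, inner_sum, inner_smul_left, inner_smul_right, inner_conj_symm]
  exact Finset.sum_congr rfl fun v _ => mul_comm _ _

theorem thetaOp_mem (x y : Ell2 I) : thetaOp σ x y ∈ adjointables σ := by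
  rw [mem_adjointables]
  refine ⟨thetaOp σ y x, fun a b => funext fun v => ?_⟩
  rw [← inner_fiberProj, ← fiberProj_inner]
  have e1 : ∀ x y z, fiberProj σ v (thetaOp σ x y z) =
      (inner ℂ (fiberProj σ v y) z : ℂ) • fiberProj σ v x := by
    intro x y z
    ext i
    simp only [thetaOp_apply, fiberProj_apply, rightAct, diagOp_apply, lp.coeFn_smul,
      Pi.smul_apply, smul_eq_mul, fiberProj_inner]
    by_cases h : σ i = v <;> simp [h]
  have e2 : inner ℂ (thetaOp σ x y a) (fiberProj σ v b) =
      inner ℂ (fiberProj σ v (thetaOp σ x y a)) b := by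
    rw [fiberProj_inner, inner_fiberProj]
  have e3 : inner ℂ (fiberProj σ v a) (thetaOp σ y x b) =
      inner ℂ a (fiberProj σ v (thetaOp σ y x b)) := by
    rw [fiberProj_inner, inner_fiberProj]
  rw [e2, e3, e1, e1, inner_smul_left, inner_smul_right, inner_conj_symm, mul_comm]

/-- `θ_{x,y}` as an element of `ℒ(ℓ²(I))`. -/
def theta (x y : Ell2 I) : adjointables σ := ⟨thetaOp σ x y, thetaOp_mem σ x y⟩

/-- The closed linear span of the operators `θ_{x,y}`. -/
def compactSpan : Submodule ℂ (adjointables σ) :=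
  (Submodule.span ℂ {T | ∃ x y, T = theta σ x y}).topologicalClosure

theorem mul_mem_compactSpan (S T : adjointables σ) (hT : T ∈ compactSpan σ) :
    S * T ∈ compactSpan σ := by
  have h : Submodule.span ℂ {T | ∃ x y, T = theta σ x y} ≤
      (compactSpan σ).comap (LinearMap.mulLeft ℂ S) := by
    rw [Submodule.span_le]
    rintro _ ⟨x, y, rfl⟩
    refine Submodule.le_topologicalClosure _ (Submodule.subset_span ⟨S.1 x, y, ?_⟩)
    exact Subtype.ext (mul_thetaOp σ S.1 S.2 x y)
  refine (Submodule.topologicalClosure_minimal _ h ?_) hT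
  exact IsClosed.preimage (f := fun T => S * T) (by fun_prop)
    (Submodule.isClosed_topologicalClosure _)

theorem star_mem_compactSpan (T : adjointables σ) (hT : T ∈ compactSpan σ) :
    star T ∈ compactSpan σ := by
  have hs : ∀ T ∈ Submodule.span ℂ {T | ∃ x y, T = theta σ x y}, star T ∈ compactSpan σ := by
    intro T hT
    induction hT using Submodule.span_induction with
    | mem T h =>
      obtain ⟨x, y, rfl⟩ := h
      exact Submodule.le_topologicalClosure _ (Submodule.subset_span
        ⟨y, x, Subtype.ext (star_thetaOp σ x y)⟩)
    | zero => rw [star_zero]; exact Submodule.zero_mem _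
    | add S T _ _ hS hT => rw [star_add]; exact Submodule.add_mem _ hS hT
    | smul c T _ hT => rw [star_smul]; exact Submodule.smul_mem _ _ hT
  have hcl : IsClosed {T : adjointables σ | star T ∈ compactSpan σ} :=
    IsClosed.preimage continuous_star (Submodule.isClosed_topologicalClosure _)
  exact closure_minimal (t := {T : adjointables σ | star T ∈ compactSpan σ}) hs hcl hT

/-- The ideal `𝒦(ℓ²(I))` of generalized compact operators in `ℒ(ℓ²(I))`: the closed linear span of
the operators `θ_{x,y}`. -/
def compacts : Ideal (adjointables σ) where
  carrier := compactSpan σ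
  add_mem' := (compactSpan σ).add_mem
  zero_mem' := (compactSpan σ).zero_mem
  smul_mem' := mul_mem_compactSpan σ

instance : IsCStarIdeal (compacts σ) where
  twoSided := ⟨fun {a} b ha => by
    have h := star_mem_compactSpan σ _
      (mul_mem_compactSpan σ (star b) _ (star_mem_compactSpan σ a ha))
    rwa [star_mul, star_star, star_star] at h⟩
  closed := Submodule.isClosed_topologicalClosure _
  star_mem := star_mem_compactSpan σ

end

end Ell2

/-! ### Directed graphs, paths and the Fock correspondence -/

/-- A directed graph with vertex set `V`, edge set `E`, source map `s` and range map `r`. -/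
structure DirGraph (V E : Type*) where
  s : E → V
  r : E → V

namespace DirGraph

open Ell2

variable {V E : Type*} (G : DirGraph V E)

/-- The range of `e₁ ⋯ e_k`: it is `r e₁` if `k ≥ 1`, and the vertex `v` if `k = 0`. -/
def rangeOf (v : V) : List E → V
  | [] => v
  | e :: _ => G.r e

/-- `e₁ ⋯ e_k` satisfies `s e_j = r e_{j+1}` for `j < k` and `s e_k = v`. -/
def IsPath (v : V) : List E → Prop
  | [] => True
  | e :: l => G.s e = G.rangeOf v l ∧ IsPath v l

/-- A path `e₁ ⋯ e_k` of length `k ≥ 0` together with its source; paths of length `0` are the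
vertices. -/
@[ext]
structure Path where
  edges : List E
  src : V
  isPath : G.IsPath src edges

namespace Path
variable {G}

/-- The length `|α|`. -/
def len (α : G.Path) : ℕ := α.edges.length

/-- The range `r(α)`. -/
def rng (α : G.Path) : V := G.rangeOf α.src α.edges

end Path

/-- The set `E^k` of paths of length `k`. -/
abbrev PathN (k : ℕ) : Type _ := {α : G.Path // α.len = k}

instance [Finite V] [Finite E] (k : ℕ) : Finite (G.PathN k) := by
  cases nonempty_fintype E
  let f : G.PathN k → List.Vector E k × V := fun α => (⟨α.1.edges, α.2⟩, α.1.src)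
  refine Finite.of_injective f ?_
  intro α β h
  have h1 := congrArg Prod.fst h
  have h2 := congrArg Prod.snd h
  exact Subtype.ext (Path.ext (congrArg Subtype.val h1) h2)

instance [Finite V] [Finite E] (k : ℕ) : Fintype (G.PathN k) := Fintype.ofFinite _

instance : DecidableEq G.Path := Classical.decEq _

/-- The source map on `E^k`. -/
def srcN (k : ℕ) (α : G.PathN k) : V := α.1.src

/-- The left action `φ(a) δ_α = a (r α) δ_α` of `a ∈ c(E⁰)` on `X_E^{⊗ k} = ℓ²(E^k)`. -/
def leftN [Finite V] (k : ℕ) (a : V → ℂ) : Ell2 (G.PathN k) →L[ℂ] Ell2 (G.PathN k) :=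
  diagOp (fun α => a α.1.rng) (exists_bound a _)

/-- For `|β| = p`, the map `x ↦ δ_β ⊗ x` from `X_E^{⊗ k}` to `X_E^{⊗ (k + p)}`; it maps `δ_γ` to
`δ_{βγ}` if `r γ = s β`, and to `0` otherwise. -/
def tensorLeft (p k : ℕ) (β : G.PathN p) : Ell2 (G.PathN k) →L[ℂ] Ell2 (G.PathN (k + p)) :=
  partialOp (fun γ α => γ.1.rng = β.1.src ∧ α.1.edges = β.1.edges ++ γ.1.edges ∧
      α.1.src = γ.1.src)
    (fun _ _ _ h h' => Subtype.ext (Path.ext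
      (List.append_cancel_left (h.2.1.symm.trans h'.2.1)) (h.2.2.symm.trans h'.2.2)))
    (fun _ _ _ h h' => Subtype.ext (Path.ext
      (h.2.1.trans h'.2.1.symm) (h.2.2.trans h'.2.2.symm)))

/-- `I_p ⊗ T` on `X_E^{⊗ (k + p)}`, which maps `δ_{βγ}` with `|β| = p` and `|γ| = k` to
`δ_β ⊗ T δ_γ`. -/
def tensorId [Finite V] [Finite E] (p k : ℕ) (T : Ell2 (G.PathN k) →L[ℂ] Ell2 (G.PathN k)) :
    Ell2 (G.PathN (k + p)) →L[ℂ] Ell2 (G.PathN (k + p)) :=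
  ∑ β : G.PathN p, G.tensorLeft p k β ∘L T ∘L ContinuousLinearMap.adjoint (G.tensorLeft p k β)

/-- A weight sequence: uniformly bounded, positive, invertible adjointable operators `Z_k` on
`X_E^{⊗ k}` which commute with the left action, with `Z_0 = I` and `Z_k ≥ ε I` for all `k ≥ 1`, for
some `ε > 0`. -/
structure WeightSeq [Finite V] where
  Z : ∀ k, Ell2 (G.PathN k) →L[ℂ] Ell2 (G.PathN k)
  adjointable : ∀ k, IsAdjointable (G.srcN k) (Z k)
  comm_left : ∀ k a, Z k * G.leftN k a = G.leftN k a * Z k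
  zero_eq : Z 0 = 1
  bounded : ∃ C : ℝ, ∀ k, ‖Z k‖ ≤ C
  pos : ∀ k, (Z k).IsPositive
  isUnit : ∀ k, IsUnit (Z k)
  lower : ∃ ε : ℝ, 0 < ε ∧ ∀ k, 1 ≤ k → (Z k - (ε : ℂ) • 1).IsPositive

/-- The condition `‖I_p ⊗ Z_k - Z_{k+p}‖ → 0`. -/
def ConditionA [Finite V] [Finite E] (Z : G.WeightSeq) (p : ℕ) : Prop :=
  Filter.Tendsto (fun k => ‖G.tensorId p k (Z.Z k) - Z.Z (k + p)‖) Filter.atTop (nhds 0)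

/-! Operators on the Fock correspondence `ℱ(X_E) = ⨁_k X_E^{⊗ k}`, which is `ℓ²` of the set of all
paths, the right action of `c(E⁰)` being `δ_α · a = a (s α) δ_α`. -/

/-- The component of `x ∈ ℱ(X_E)` in `X_E^{⊗ k}`. -/
def component (k : ℕ) : Ell2 G.Path →L[ℂ] Ell2 (G.PathN k) :=
  partialOp (fun α β => β.1 = α) (fun _ _ _ h h' => h.symm.trans h')
    (fun _ _ _ h h' => Subtype.ext (h.trans h'.symm))

theorem component_apply (k : ℕ) (x : Ell2 G.Path) (α : G.PathN k) :
    G.component k x α = x α.1 := partialOp_apply _ _ _ _ rfl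

section Fock
variable [Fintype V]

/-- `ℒ(ℱ(X_E))`. -/
abbrev L : StarSubalgebra ℂ (Ell2 G.Path →L[ℂ] Ell2 G.Path) := adjointables (Path.src (G := G))

/-- The creation operator `S_e δ_β = δ_{eβ}`, where `δ_{eβ} = 0` unless `s e = r β`. -/
def creationOp (e : E) : Ell2 G.Path →L[ℂ] Ell2 G.Path :=
  partialOp (fun β α => α.edges = e :: β.edges ∧ α.src = β.src)
    (fun _ _ _ h h' => Path.ext (List.cons.inj (h.1.symm.trans h'.1)).2 (h.2.symm.trans h'.2))
    (fun _ _ _ h h' => Path.ext (h.1.trans h'.1.symm) (h.2.trans h'.2.symm))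

theorem creationOp_mem (e : E) : G.creationOp e ∈ G.L := by
  rw [mem_adjointables, isAdjointable_iff]
  intro v
  ext x α
  simp only [mul_apply_eq_comp, fiberProj_apply]
  by_cases h : ∃ β : G.Path, α.edges = e :: β.edges ∧ α.src = β.src
  · obtain ⟨β, hβ⟩ := h
    have h1 : ∀ y : Ell2 G.Path, G.creationOp e y α = y β := fun y =>
      partialOp_apply (i := β) (j := α) _ _ _ y hβ
    rw [h1, h1, fiberProj_apply, hβ.2]
  · have h1 : ∀ y : Ell2 G.Path, G.creationOp e y α = 0 := fun y =>
      partialOp_apply_of_not (j := α) _ _ _ y (fun β hβ => h ⟨β, hβ⟩)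
    rw [h1, h1, ite_self]

/-- `S_e` in `ℒ(ℱ(X_E))`. -/
def S (e : E) : G.L := ⟨G.creationOp e, G.creationOp_mem e⟩

/-- The left action `φ_∞(a) δ_β = a (r β) δ_β`. -/
def phi (a : V → ℂ) : G.L :=
  ⟨diagOp (fun α : G.Path => a α.rng) (exists_bound a _), diagOp_mem _ _ _⟩

open Classical in
/-- `P_v = φ_∞(δ_v)`. -/
def P (v : V) : G.L := G.phi (Pi.single v 1)

/-- `S_α = S_{e₁} ⋯ S_{e_k}` for a path `α = e₁ ⋯ e_k`, and `S_v = P_v` for a vertex `v`. (The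
factor `P_{s(α)}` does not change the product if `k ≥ 1`.) -/
def Spath (α : G.Path) : G.L := (α.edges.map G.S).prod * G.P α.src

/-- The unitary `W_t = ∑_n e^{int} Q_n`, where `Q_n` is the projection onto `X_E^{⊗ n}`. -/
def gauge (t : ℝ) : G.L :=
  ⟨diagOp (fun α : G.Path => Complex.exp (Complex.I * α.len * t))
    ⟨1, fun α => by simp [Complex.norm_exp]⟩, diagOp_mem _ _ _⟩

theorem star_gauge_mul (t : ℝ) : star (G.gauge t) * G.gauge t = 1 := by
  have h : star (G.gauge t) = G.gauge (-t) := by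
    refine Subtype.ext ?_
    change star (G.gauge t).1 = (G.gauge (-t)).1
    rw [ContinuousLinearMap.star_eq_adjoint]
    symm
    rw [ContinuousLinearMap.eq_adjoint_iff]
    intro x y
    rw [lp.inner_eq_tsum, lp.inner_eq_tsum]
    refine tsum_congr fun α => ?_
    change inner ℂ (Complex.exp (Complex.I * α.len * ((-t : ℝ) : ℂ)) * x α) (y α) =
      inner ℂ (x α) (Complex.exp (Complex.I * α.len * (t : ℂ)) * y α)
    simp [← Complex.exp_conj]
    ring
  rw [h]
  refine Subtype.ext ?_
  ext x α
  change Complex.exp (Complex.I * α.len * ((-t : ℝ) : ℂ)) *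
    (Complex.exp (Complex.I * α.len * (t : ℂ)) * x α) = x α
  rw [← mul_assoc, ← Complex.exp_add]
  simp

variable [Fintype E]

theorem sum_component_le (x : Ell2 G.Path) (K : Finset ℕ) :
    ∑ k ∈ K, ‖G.component k x‖ ^ 2 ≤ ‖x‖ ^ 2 := by
  have h1 : ∀ k, ‖G.component k x‖ ^ 2 =
      ∑ α ∈ (Finset.univ : Finset (G.PathN k)).map (Function.Embedding.subtype _), ‖x α‖ ^ 2 := by
    intro k
    rw [Finset.sum_map]
    have := lp.norm_rpow_eq_tsum (p := 2) (by norm_num) (G.component k x)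
    simp only [ENNReal.toReal_ofNat, Real.rpow_ofNat, tsum_fintype, component_apply] at this
    exact this
  simp only [h1]
  rw [← Finset.sum_biUnion]
  · exact sum_sq_le x _
  · intro k _ l _ hkl
    refine Finset.disjoint_left.2 fun α h h' => hkl ?_
    obtain ⟨a, -, rfl⟩ := Finset.mem_map.1 h
    obtain ⟨b, -, hb⟩ := Finset.mem_map.1 h'
    rw [← a.2, ← b.2]
    exact congrArg Path.len hb.symm

/-- The diagonal operator `diag(Z_0, Z_1, …)` on `ℱ(X_E)`. -/
def weightOp (Z : G.WeightSeq) : Ell2 G.Path →L[ℂ] Ell2 G.Path :=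
  mkOp { toFun := fun x α => Z.Z α.len (G.component α.len x) ⟨α, rfl⟩
         map_add' := fun x y => by ext α; simp
         map_smul' := fun c x => by ext α; simp }
    (max Z.bounded.choose 0) (le_max_right _ _) (by
      intro x t
      set C := max Z.bounded.choose 0
      have hC : ∀ k, ‖Z.Z k‖ ≤ C := fun k => (Z.bounded.choose_spec k).trans (le_max_left _ _)
      have hC0 : 0 ≤ C := le_max_right _ _
      simp only [LinearMap.coe_mk, AddHom.coe_mk]
      rw [← Finset.sum_fiberwise_of_maps_to (t := t.image Path.len) (g := Path.len)
        (fun α h => Finset.mem_image_of_mem _ h)]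
      calc _ ≤ ∑ k ∈ t.image Path.len, C ^ 2 * ‖G.component k x‖ ^ 2 := by
            refine Finset.sum_le_sum fun k _ => ?_
            have e : ∑ α ∈ t.filter (fun α => α.len = k),
                ‖Z.Z α.len (G.component α.len x) ⟨α, rfl⟩‖ ^ 2 =
                ∑ α ∈ t.subtype (fun α => α.len = k), ‖Z.Z k (G.component k x) α‖ ^ 2 := by
              rw [← Finset.subtype_map, Finset.sum_map]
              refine Finset.sum_congr rfl fun α _ => ?_
              obtain ⟨α, rfl⟩ := α
              rfl
            rw [e, ← mul_pow]
            refine (sum_sq_le _ _).trans ?_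
            gcongr
            exact ContinuousLinearMap.le_of_opNorm_le _ (hC k) _
        _ = C ^ 2 * ∑ k ∈ t.image Path.len, ‖G.component k x‖ ^ 2 := by rw [Finset.mul_sum]
        _ ≤ _ := by
            rw [mul_pow]
            gcongr
            exact G.sum_component_le x _)

theorem weightOp_mem (Z : G.WeightSeq) : G.weightOp Z ∈ G.L := by
  rw [mem_adjointables, isAdjointable_iff]
  intro v
  ext x α
  have h := (isAdjointable_iff _ _).1 (Z.adjointable α.len) v
  have h1 : G.component α.len (fiberProj Path.src v x) =
      fiberProj (G.srcN α.len) v (G.component α.len x) := by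
    ext β
    simp only [component_apply, fiberProj_apply, srcN]
    congr
  have h2 := congrArg (fun T => T (G.component α.len x) ⟨α, rfl⟩) h
  simp only [mul_apply_eq_comp, fiberProj_apply, srcN] at h2
  simp only [mul_apply_eq_comp, fiberProj_apply]
  refine h2.trans ?_
  rw [← h1]
  rfl

/-- The weight operator `Z` in `ℒ(ℱ(X_E))`. -/
def weight (Z : G.WeightSeq) : G.L := ⟨G.weightOp Z, G.weightOp_mem Z⟩

/-- The weighted Toeplitz algebra: the C⋆-algebra generated by the weighted shifts
`W_e = Z S_e`. -/
def toeplitz (Z : G.WeightSeq) : NonUnitalStarSubalgebra ℂ G.L :=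
  (NonUnitalStarAlgebra.adjoin ℂ {T | ∃ e : E, T = G.weight Z * G.S e}).topologicalClosure

/-- The fixed point algebra `𝒟` of the gauge action `γ_t = Ad W_t` on the weighted Toeplitz
algebra. -/
def fixedAlg (Z : G.WeightSeq) : NonUnitalStarSubalgebra ℂ G.L where
  carrier := {T | T ∈ G.toeplitz Z ∧ ∀ t : ℝ, G.gauge t * T * star (G.gauge t) = T}
  add_mem' {a b} ha hb := ⟨add_mem ha.1 hb.1, fun t => by
    rw [mul_add, add_mul, ha.2, hb.2]⟩
  zero_mem' := ⟨zero_mem _, fun t => by simp⟩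
  mul_mem' {a b} ha hb := ⟨mul_mem ha.1 hb.1, fun t => by
    conv_rhs => rw [← ha.2 t, ← hb.2 t]
    have := G.star_gauge_mul t
    calc _ = G.gauge t * a * 1 * b * star (G.gauge t) := by simp only [mul_assoc, one_mul]
      _ = _ := by rw [← this]; simp only [mul_assoc]⟩
  smul_mem' c a ha := ⟨SMulMemClass.smul_mem c ha.1, fun t => by
    rw [mul_smul_comm, smul_mul_assoc, ha.2]⟩
  star_mem' {a} ha := ⟨star_mem ha.1, fun t => by
    conv_rhs => rw [← ha.2 t]
    simp only [star_mul, star_star, mul_assoc]⟩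

/-- The quotient C⋆-algebra `ℒ(ℱ(X_E)) / 𝒦(ℱ(X_E))`. -/
def Calkin : Type _ := G.L ⧸ compacts (Path.src (G := G))

instance : CStarAlgebra G.Calkin :=
  IsCStarIdeal.quotCStarAlgebra (compacts (Path.src (G := G)))

/-- The quotient map `q`. -/
def q : G.L →⋆ₐ[ℂ] G.Calkin where
  toFun T := Ideal.Quotient.mk (compacts (Path.src (G := G))) T
  map_one' := rfl
  map_mul' _ _ := rfl
  map_zero' := rfl
  map_add' _ _ := rfl
  commutes' _ := rfl
  map_star' _ := rfl

/-- `q(𝒟)`. -/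
def qD (Z : G.WeightSeq) : NonUnitalStarSubalgebra ℂ G.Calkin :=
  (G.fixedAlg Z).map G.q.toNonUnitalStarAlgHom

/-- `u_α = q(S_α)`. -/
def u (α : G.Path) : G.Calkin := G.q (G.Spath α)

/-- `z = q(Z)`. -/
def z (Z : G.WeightSeq) : G.Calkin := G.q (G.weight Z)

/-- `𝒞_n`, the C⋆-algebra generated by the elements `u_α z^l u_β^*` with `l ≥ 0`,
`np ≤ |α| = |β| < (n+1)p` and `s α = s β`. -/
def C (Z : G.WeightSeq) (p n : ℕ) : NonUnitalStarSubalgebra ℂ G.Calkin :=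
  (NonUnitalStarAlgebra.adjoin ℂ {x | ∃ (α β : G.Path) (l : ℕ), n * p ≤ α.len ∧ α.len = β.len ∧
    α.len < (n + 1) * p ∧ α.src = β.src ∧
    x = G.u α * G.z Z ^ l * star (G.u β)}).topologicalClosure

/-- A choice, for every vertex `v`, of a path `ξ_v` of length `p - 1` with source `v`
(where `p ≥ 1`). -/
structure PathChoice (G : DirGraph V E) (p : ℕ) where
  ξ : V → G.Path
  len_add_one : ∀ v, (ξ v).len + 1 = p
  src_eq : ∀ v, (ξ v).src = v

variable {G}

/-- `u_{ξ_v} u_{ξ_v}^* ∈ 𝒞_0`. -/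
theorem u_mul_star_mem (Z : G.WeightSeq) {p : ℕ} (ξ : PathChoice G p) (v : V) :
    G.u (ξ.ξ v) * star (G.u (ξ.ξ v)) ∈ G.C Z p 0 := by
  refine NonUnitalStarSubalgebra.le_topologicalClosure _
    (NonUnitalStarAlgebra.subset_adjoin ℂ _ ⟨ξ.ξ v, ξ.ξ v, 0, by simp, rfl, ?_, rfl, by simp⟩)
  have := ξ.len_add_one v
  omega

variable (G)

/-- `𝒞_v = u_{ξ_v} u_{ξ_v}^* 𝒞_0 u_{ξ_v} u_{ξ_v}^*`. -/
def Cv (Z : G.WeightSeq) {p : ℕ} (ξ : PathChoice G p) (v : V) :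
    NonUnitalStarSubalgebra ℂ G.Calkin where
  carrier := {x | ∃ c ∈ G.C Z p 0,
    x = G.u (ξ.ξ v) * star (G.u (ξ.ξ v)) * c * (G.u (ξ.ξ v) * star (G.u (ξ.ξ v)))}
  add_mem' := by
    rintro _ _ ⟨c, hc, rfl⟩ ⟨d, hd, rfl⟩
    exact ⟨c + d, add_mem hc hd, by rw [mul_add, add_mul]⟩
  zero_mem' := ⟨0, zero_mem _, by simp⟩
  mul_mem' := by
    rintro _ _ ⟨c, hc, rfl⟩ ⟨d, hd, rfl⟩
    have he := u_mul_star_mem Z ξ v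
    exact ⟨c * (G.u (ξ.ξ v) * star (G.u (ξ.ξ v))) * (G.u (ξ.ξ v) * star (G.u (ξ.ξ v))) * d,
      mul_mem (mul_mem (mul_mem hc he) he) hd, by simp only [mul_assoc]⟩
  smul_mem' := by
    rintro k _ ⟨c, hc, rfl⟩
    exact ⟨k • c, SMulMemClass.smul_mem k hc, by rw [mul_smul_comm, smul_mul_assoc]⟩
  star_mem' := by
    rintro _ ⟨c, hc, rfl⟩
    exact ⟨star c, star_mem hc, by simp only [star_mul, star_star, mul_assoc]⟩

/-- `Γ_n`, the set of paths of length `(n+1)p - 1`. -/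
abbrev Gam (p n : ℕ) : Type _ := G.PathN (n * p + (p - 1))

/-- `𝒜_n = ∑ e_{γ₁,γ₂} ⊗ 𝒞_{s(γ₁)}`, the sum over all `γ₁, γ₂ ∈ Γ_n` with `s γ₁ = s γ₂`: the
`Γ_n × Γ_n`-matrices whose entry at `(γ₁, γ₂)` lies in `𝒞_{s(γ₁)}` if `s γ₁ = s γ₂`, and is `0`
otherwise. -/
def A (Z : G.WeightSeq) {p : ℕ} (ξ : PathChoice G p) (n : ℕ) :
    NonUnitalStarSubalgebra ℂ (Matrix (G.Gam p n) (G.Gam p n) G.Calkin) where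
  carrier := {M | ∀ γ₁ γ₂ : G.Gam p n,
    (γ₁.1.src = γ₂.1.src → M γ₁ γ₂ ∈ G.Cv Z ξ γ₁.1.src) ∧
    (γ₁.1.src ≠ γ₂.1.src → M γ₁ γ₂ = 0)}
  add_mem' {M N} hM hN γ₁ γ₂ :=
    ⟨fun h => add_mem ((hM γ₁ γ₂).1 h) ((hN γ₁ γ₂).1 h),
      fun h => by rw [Matrix.add_apply, (hM γ₁ γ₂).2 h, (hN γ₁ γ₂).2 h, add_zero]⟩
  zero_mem' _ _ := ⟨fun _ => zero_mem _, fun _ => rfl⟩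
  mul_mem' {M N} hM hN γ₁ γ₂ := by
    rw [Matrix.mul_apply]
    refine ⟨fun h => sum_mem fun γ _ => ?_, fun h => Finset.sum_eq_zero fun γ _ => ?_⟩
    · by_cases h' : γ₁.1.src = γ.1.src
      · refine mul_mem ((hM γ₁ γ).1 h') ?_
        rw [h']
        exact (hN γ γ₂).1 (h'.symm.trans h)
      · rw [(hM γ₁ γ).2 h', zero_mul]
        exact zero_mem _
    · by_cases h' : γ₁.1.src = γ.1.src
      · rw [(hN γ γ₂).2 fun h'' => h (h'.trans h''), mul_zero]
      · rw [(hM γ₁ γ).2 h', zero_mul]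
  smul_mem' c M hM γ₁ γ₂ :=
    ⟨fun h => SMulMemClass.smul_mem c ((hM γ₁ γ₂).1 h),
      fun h => by rw [Matrix.smul_apply, (hM γ₁ γ₂).2 h, smul_zero]⟩
  star_mem' {M} hM γ₁ γ₂ := by
    rw [Matrix.star_apply]
    refine ⟨fun h => ?_, fun h => by rw [(hM γ₂ γ₁).2 (Ne.symm h), star_zero]⟩
    rw [h]
    exact star_mem ((hM γ₂ γ₁).1 h.symm)

/-- The matrix `e_{γ₁,γ₂} ⊗ b`. -/
abbrev unit {p n : ℕ} (γ₁ γ₂ : G.Gam p n) (b : G.Calkin) :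
    Matrix (G.Gam p n) (G.Gam p n) G.Calkin := Matrix.single γ₁ γ₂ b

theorem unit_mem (Z : G.WeightSeq) {p : ℕ} (ξ : PathChoice G p) (n : ℕ) (γ₁ γ₂ : G.Gam p n)
    (h : γ₁.1.src = γ₂.1.src) (b : G.Calkin) (hb : b ∈ G.Cv Z ξ γ₁.1.src) :
    G.unit γ₁ γ₂ b ∈ G.A Z ξ n := by
  intro δ₁ δ₂
  by_cases h' : γ₁ = δ₁ ∧ γ₂ = δ₂
  · obtain ⟨rfl, rfl⟩ := h'
    simp only [Matrix.single_apply_same]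
    exact ⟨fun _ => hb, fun h' => (h' h).elim⟩
  · rw [unit, Matrix.single_apply_of_ne _ _ _ _ _ h']
    exact ⟨fun _ => zero_mem _, fun _ => rfl⟩

open Classical in
/-- The formula for `τ_n`: the sum of `e_{γ₁,γ₂} ⊗ u_{ξ_{s(γ₁)}} u_{γ₁}^* c u_{γ₂} u_{ξ_{s(γ₁)}}^*`
over all `γ₁, γ₂ ∈ Γ_n` with `s γ₁ = s γ₂`. -/
def tauFormula {p : ℕ} (ξ : PathChoice G p) (n : ℕ) (c : G.Calkin) :
    Matrix (G.Gam p n) (G.Gam p n) G.Calkin :=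
  ∑ γ₁ : G.Gam p n, ∑ γ₂ : G.Gam p n,
    if γ₁.1.src = γ₂.1.src then
      G.unit γ₁ γ₂ (G.u (ξ.ξ γ₁.1.src) * star (G.u γ₁.1) * c * G.u γ₂.1 *
        star (G.u (ξ.ξ γ₁.1.src)))
    else 0

end Fock

end DirGraph

/-! ### Direct limits of C⋆-algebras -/

/-- `L` with the `⋆`-homomorphisms `μ n : A n → L` is the direct limit, in the category of
C⋆-algebras and `⋆`-homomorphisms, of the sequence `A 0 → A 1 → ⋯` with connecting maps `ψ n`: it is the universal
compatible family of `⋆`-homomorphisms into a C⋆-algebra. Only the `⋆`-algebra structures of `A n`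
and `L` enter, since `⋆`-homomorphisms of C⋆-algebras are automatically continuous. -/
structure IsCStarDirectLimit {A : ℕ → Type*} [∀ n, NonUnitalRing (A n)]
    [∀ n, StarRing (A n)] [∀ n, Module ℂ (A n)] {L : Type*} [NonUnitalRing L] [StarRing L]
    [Module ℂ L] (ψ : ∀ n, A n →⋆ₙₐ[ℂ] A (n + 1)) (μ : ∀ n, A n →⋆ₙₐ[ℂ] L) : Prop where
  compat : ∀ n a, μ (n + 1) (ψ n a) = μ n a
  universal : ∀ (B : Type w) [NonUnitalCStarAlgebra B] (φ : ∀ n, A n →⋆ₙₐ[ℂ] B),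
    (∀ n a, φ (n + 1) (ψ n a) = φ n a) → ∃! Φ : L →⋆ₙₐ[ℂ] B, ∀ n a, Φ (μ n a) = φ n a

end

/-! Everything takes place in the quotient by the compacts. Since the graph is finite, `1 - ∑ S_e
S_e^*` is the projection onto the finitely many vertices. It is therefore compact, so the `u_e`
satisfy the Cuntz–Krieger relations, and `∑ u_μ u_μ^* = 1` over the paths of any fixed length
(`sum_u_mul_star_u`). Condition A(p) says that the commutators `Z S_β - S_β Z` with `|β| = p` have
components of norm tending to `0`, hence are compact, so `z` commutes with `u_β` for `|β| = p`.

For other lengths `z` does not commute with `u_α`. The map `endo x = ∑ u_e x u_e^*` satisfies `endo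
x * u_e = u_e * x` when `x` commutes with the vertex projections, and `endo^p` fixes `z`. So `endo`
is invertible on the orbit of `z`, with inverse `endo^(p-1)`. The elements `z_m = endo^(-m) z`,
which are `zShift`, satisfy `z_m u_α = u_α z_{m+|α|}` and are periodic in `m` with period `p`. The
algebra they generate (`weightAlg`) can be pushed through any `u_α`.

The paths in `Γ_n` have the maximal length admitted in `𝒞_n`. Hence, for a generator `c`, the
element `u_γ₁^* c u_γ₂` is `0` or lies in `p_v` times the weight algebra, where `v = s(γ₁) = s(γ₂)`.
Conversely `u_η₁ b u_η₂^*` lies in `𝒞_m` for `b` in the weight algebra and `η₁, η₂ ∈ Γ_m` with a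
common source. Thus a corner of `𝒞_n` can be moved to any other level and to any other paths with
the same source (`corner_adjoin`). Both `τ_n` and its inverse are such moves, between level `n` and
the paths `ξ_v` at level `0`. Inserting `1 = ∑ u_γ u_γ^*` turns products into matrix products.

The inclusion `𝒞_n ⊆ 𝒞_{n+1}` comes from inserting `∑ u_ν u_ν^*` over `|ν| = p`. For the union to be
dense in `q(𝒟)`, a gauge-invariant operator is approximated by a polynomial in the weighted shifts
and both are averaged over roots of unity. This keeps only the part of degree `0`, whose image lies
in some `𝒞_n`. For `𝒞_n ⊆ q(𝒟)`, the `u_e` and `z` must be recovered from `z u_e = u_e z_1`. As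
there are no sinks, `z_1²` is a sum of elements `(z u_e)^* (z u_e)`, and `Z ≥ ε` makes `z_1`
invertible, with inverse in the closed algebra generated by `z_1²`. Since ranges of
`⋆`-homomorphisms are closed, so is `q(𝒟)`. The universal property then follows by extending
contractive maps from the dense union (`existsUnique_extension`). -/

noncomputable section

/-! ### Basis vectors, adjoints and finite coordinate projections on `ℓ²(I)` -/

namespace Ell2
variable {I J V : Type*}

open Classical in
theorem inner_delta (i : I) (x : Ell2 I) :
    inner ℂ (lp.single 2 i (1 : ℂ) : Ell2 I) x = x i := by
  rw [lp.inner_single_left]; simp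

open Classical in
theorem adjoint_apply (T : Ell2 I →L[ℂ] Ell2 J) (y : Ell2 J) (i : I) :
    ContinuousLinearMap.adjoint T y i = inner ℂ (T (lp.single 2 i (1 : ℂ))) y := by
  rw [← inner_delta, ContinuousLinearMap.adjoint_inner_right]

open Classical in
theorem partialOp_delta (R : I → J → Prop) (h₁ : ∀ i i' j, R i j → R i' j → i = i')
    (h₂ : ∀ i j j', R i j → R i j' → j = j') {i : I} {j : J} (h : R i j) :
    partialOp R h₁ h₂ (lp.single 2 i (1 : ℂ)) = lp.single 2 j (1 : ℂ) := by
  ext k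
  by_cases hk : ∃ i', R i' k
  · obtain ⟨i', hi'⟩ := hk
    rw [partialOp_apply R h₁ h₂ _ hi', lp.single_apply, lp.single_apply, Pi.single_apply,
      Pi.single_apply]
    by_cases e : i' = i
    · subst e
      rw [if_pos rfl, if_pos (h₂ _ _ _ hi' h)]
    · rw [if_neg e, if_neg]
      rintro rfl
      exact e (h₁ _ _ _ hi' h)
  · rw [partialOp_apply_of_not R h₁ h₂ _ (by simpa using hk), lp.single_apply_ne]
    rintro rfl
    exact hk ⟨i, h⟩

open Classical in
theorem partialOp_delta_of_not (R : I → J → Prop) (h₁ : ∀ i i' j, R i j → R i' j → i = i')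
    (h₂ : ∀ i j j', R i j → R i j' → j = j') {i : I} (h : ∀ j, ¬ R i j) :
    partialOp R h₁ h₂ (lp.single 2 i (1 : ℂ)) = 0 := by
  ext k
  by_cases hk : ∃ i', R i' k
  · obtain ⟨i', hi'⟩ := hk
    rw [partialOp_apply R h₁ h₂ _ hi', lp.single_apply_ne]
    · rfl
    · rintro rfl
      exact h _ hi'
  · rw [partialOp_apply_of_not R h₁ h₂ _ (by simpa using hk)]; rfl

theorem adjoint_partialOp_apply (R : I → J → Prop) (h₁ : ∀ i i' j, R i j → R i' j → i = i')
    (h₂ : ∀ i j j', R i j → R i j' → j = j') (y : Ell2 J) {i : I} {j : J} (h : R i j) :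
    ContinuousLinearMap.adjoint (partialOp R h₁ h₂) y i = y j := by
  classical
  rw [adjoint_apply, partialOp_delta R h₁ h₂ h, inner_delta]

theorem adjoint_partialOp_apply_of_not (R : I → J → Prop)
    (h₁ : ∀ i i' j, R i j → R i' j → i = i')
    (h₂ : ∀ i j j', R i j → R i j' → j = j') (y : Ell2 J) {i : I} (h : ∀ j, ¬ R i j) :
    ContinuousLinearMap.adjoint (partialOp R h₁ h₂) y i = 0 := by
  classical
  rw [adjoint_apply, partialOp_delta_of_not R h₁ h₂ h, inner_zero_left]

theorem star_diagOp (f : I → ℂ) (hf : ∃ C, ∀ i, ‖f i‖ ≤ C) (hg : ∃ C, ∀ i, ‖star (f i)‖ ≤ C) :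
    star (diagOp f hf) = diagOp (fun i => star (f i)) hg := by
  classical
  rw [ContinuousLinearMap.star_eq_adjoint]
  ext y i
  rw [adjoint_apply]
  have : diagOp f hf (lp.single 2 i (1 : ℂ)) = f i • lp.single 2 i (1 : ℂ) := by
    ext j
    simp only [diagOp_apply, lp.coeFn_smul, Pi.smul_apply, lp.single_apply, Pi.single_apply,
      smul_eq_mul]
    by_cases h : j = i <;> simp [h]
  rw [this, inner_smul_left, inner_delta]
  simp

variable [Fintype V] (σ : I → V)

open Classical in
theorem theta_delta_apply (i : I) (x : Ell2 I) :
    (theta σ (lp.single 2 i (1 : ℂ)) (lp.single 2 i (1 : ℂ))).1 x = x i • lp.single 2 i (1 : ℂ) := by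
  ext j
  change thetaOp σ _ _ x j = _
  rw [thetaOp_apply, rightAct, diagOp_apply, lp.coeFn_smul, Pi.smul_apply, smul_eq_mul]
  by_cases h : j = i
  · subst h
    congr 1
    rw [← fiberProj_inner]
    have : fiberProj σ (σ j) (lp.single 2 j (1 : ℂ)) = lp.single 2 j (1 : ℂ) := by
      ext k
      rw [fiberProj_apply]
      by_cases hk : k = j
      · simp [hk]
      · simp [hk]
    rw [this, inner_delta]
  · simp [h]

open Classical in
/-- Coordinate projections onto finite sets are compact. -/
theorem diagOp_finset_mem (t : Finset I) (hf : ∃ C, ∀ i, ‖(if i ∈ t then 1 else 0 : ℂ)‖ ≤ C) :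
    (⟨diagOp (fun i => if i ∈ t then 1 else 0) hf, diagOp_mem σ _ _⟩ : adjointables σ) ∈
      compacts σ := by
  have : (⟨diagOp (fun i => if i ∈ t then 1 else 0) hf, diagOp_mem σ _ _⟩ : adjointables σ) =
      ∑ i ∈ t, theta σ (lp.single 2 i (1 : ℂ)) (lp.single 2 i (1 : ℂ)) := by
    apply Subtype.ext
    rw [AddSubmonoidClass.coe_finsetSum]
    ext x j
    rw [sum_apply]
    simp only [theta_delta_apply]
    rw [lp.coeFn_sum, Finset.sum_apply]
    simp only [diagOp_apply, lp.coeFn_smul, Pi.smul_apply, lp.single_apply, Pi.single_apply,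
      smul_eq_mul, mul_ite, mul_one, mul_zero, Finset.sum_ite_eq, ite_mul, one_mul, zero_mul]
  rw [this]
  refine sum_mem fun i _ => ?_
  exact Submodule.le_topologicalClosure _ (Submodule.subset_span ⟨_, _, rfl⟩)

end Ell2

/-! ### Paths built edge by edge, and relations between `S_e`, `P_v` and `W_t` on the Fock space -/

namespace DirGraph
open Ell2
variable {V E : Type*} (G : DirGraph V E)

namespace Path
variable {G}

/-- The path `eβ`. -/
def cons (e : E) (β : G.Path) (h : G.s e = β.rng) : G.Path := ⟨e :: β.edges, β.src, h, β.isPath⟩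

@[simp] theorem cons_edges (e : E) (β : G.Path) (h : G.s e = β.rng) :
    (cons e β h).edges = e :: β.edges := rfl
@[simp] theorem cons_src (e : E) (β : G.Path) (h : G.s e = β.rng) :
    (cons e β h).src = β.src := rfl
@[simp] theorem cons_rng (e : E) (β : G.Path) (h : G.s e = β.rng) :
    (cons e β h).rng = G.r e := rfl
@[simp] theorem cons_len (e : E) (β : G.Path) (h : G.s e = β.rng) :
    (cons e β h).len = β.len + 1 := rfl

/-- A vertex as a path of length `0`. -/
def vertex (G : DirGraph V E) (v : V) : G.Path := ⟨[], v, trivial⟩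

@[simp] theorem vertex_len (v : V) : (vertex G v).len = 0 := rfl
@[simp] theorem vertex_src (v : V) : (vertex G v).src = v := rfl
@[simp] theorem vertex_rng (v : V) : (vertex G v).rng = v := rfl

theorem eq_vertex {α : G.Path} (h : α.len = 0) : α = vertex G α.src :=
  Path.ext (List.length_eq_zero_iff.1 h) rfl

theorem exists_cons {α : G.Path} (h : α.len ≠ 0) :
    ∃ (e : E) (β : G.Path) (h : G.s e = β.rng), α = cons e β h := by
  obtain ⟨l, v, hl⟩ := α
  cases l with
  | nil => exact absurd rfl h
  | cons e l => exact ⟨e, ⟨l, v, hl.2⟩, hl.1, rfl⟩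

theorem cons_inj {e f : E} {β γ : G.Path} {h : G.s e = β.rng} {h' : G.s f = γ.rng}
    (H : cons e β h = cons f γ h') : e = f ∧ β = γ := by
  have h1 := congrArg edges H
  have h2 := congrArg src H
  simp only [cons_edges, List.cons.injEq, cons_src] at h1 h2
  exact ⟨h1.1, Path.ext h1.2 h2⟩

@[elab_as_elim]
theorem cons_induction {motive : G.Path → Prop} (vertex : ∀ v, motive (vertex G v))
    (cons : ∀ e β h, motive β → motive (cons e β h)) (α : G.Path) : motive α := by
  obtain ⟨l, v, hl⟩ := α
  induction l with
  | nil => exact vertex v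
  | cons e l ih => exact cons e ⟨l, v, hl.2⟩ hl.1 (ih hl.2)

end Path

section
variable [Fintype V]

theorem S_apply_cons (e : E) (β : G.Path) (h : G.s e = β.rng) (x : Ell2 G.Path) :
    (G.S e).1 x (Path.cons e β h) = x β := by
  change G.creationOp e x _ = _
  exact partialOp_apply (i := β) (j := Path.cons e β h) _ _ _ x ⟨rfl, rfl⟩

theorem S_apply_cons_ne {e f : E} (hef : e ≠ f) (β : G.Path) (h : G.s f = β.rng)
    (x : Ell2 G.Path) : (G.S e).1 x (Path.cons f β h) = 0 := by
  change G.creationOp e x _ = _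
  exact partialOp_apply_of_not (j := Path.cons f β h) _ _ _ x (fun γ hγ => hef (List.cons.inj hγ.1).1.symm)

theorem S_apply_vertex (e : E) (v : V) (x : Ell2 G.Path) :
    (G.S e).1 x (Path.vertex G v) = 0 := by
  change G.creationOp e x _ = _
  exact partialOp_apply_of_not (j := Path.vertex G v) _ _ _ x (fun γ hγ => by cases hγ.1)

theorem star_S_apply (e : E) (β : G.Path) (h : G.s e = β.rng) (x : Ell2 G.Path) :
    (star (G.S e)).1 x β = x (Path.cons e β h) := by
  change (star (G.creationOp e)) x β = _
  rw [ContinuousLinearMap.star_eq_adjoint]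
  exact adjoint_partialOp_apply (i := β) (j := Path.cons e β h) _ _ _ _ ⟨rfl, rfl⟩

theorem star_S_apply_of_ne (e : E) (β : G.Path) (h : G.s e ≠ β.rng) (x : Ell2 G.Path) :
    (star (G.S e)).1 x β = 0 := by
  change (star (G.creationOp e)) x β = _
  rw [ContinuousLinearMap.star_eq_adjoint]
  refine adjoint_partialOp_apply_of_not (i := β) _ _ _ _ fun α hα => h ?_
  obtain ⟨l, v, hl⟩ := α
  obtain ⟨h1, h2⟩ := hα
  simp only at h1 h2
  subst h1 h2
  exact hl.1

open Classical in
theorem P_apply (v : V) (x : Ell2 G.Path) (α : G.Path) :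
    (G.P v).1 x α = if α.rng = v then x α else 0 := by
  change diagOp (fun α : G.Path => (Pi.single v 1 : V → ℂ) α.rng) (exists_bound _ _) x α = _
  simp [Pi.single_apply]

theorem ext_L {S T : G.L} (h : ∀ x α, S.1 x α = T.1 x α) : S = T :=
  Subtype.ext (ContinuousLinearMap.ext fun x => lp.ext (funext (h x)))

theorem star_P (v : V) : star (G.P v) = G.P v := by
  classical
  refine Subtype.ext ?_
  refine (star_diagOp _ (exists_bound _ _) ⟨1, fun i => by
    by_cases h : i.rng = v <;> simp [h]⟩).trans ?_
  ext x i
  change _ = (G.P v).1 x i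
  rw [P_apply]
  by_cases h : i.rng = v <;> simp [h, Pi.single_apply]

theorem P_mul_P_self (v : V) : G.P v * G.P v = G.P v := by
  refine G.ext_L fun x α => ?_
  change (G.P v).1 ((G.P v).1 x) α = _
  rw [P_apply, P_apply]; split_ifs <;> rfl

theorem P_mul_P_ne {v w : V} (h : v ≠ w) : G.P v * G.P w = 0 := by
  refine G.ext_L fun x α => ?_
  change (G.P v).1 ((G.P w).1 x) α = 0
  rw [P_apply, P_apply]
  split_ifs with h1 h2
  · exact absurd (h1.symm.trans h2) h
  · rfl
  · rfl

theorem sum_P : ∑ v, G.P v = 1 := by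
  classical
  refine G.ext_L fun x α => ?_
  rw [AddSubmonoidClass.coe_finsetSum, sum_apply, lp.coeFn_sum,
    Finset.sum_apply]
  simp only [P_apply]
  simp

theorem S_mul_P (e : E) : G.S e * G.P (G.s e) = G.S e := by
  refine G.ext_L fun x α => ?_
  change (G.S e).1 ((G.P _).1 x) α = _
  cases α using Path.cons_induction with
  | vertex v => rw [S_apply_vertex, S_apply_vertex]
  | cons f β h _ =>
    by_cases hef : e = f
    · subst hef
      rw [S_apply_cons, S_apply_cons, P_apply, if_pos h.symm]
    · rw [S_apply_cons_ne _ hef, S_apply_cons_ne _ hef]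

theorem P_mul_S (e : E) : G.P (G.r e) * G.S e = G.S e := by
  refine G.ext_L fun x α => ?_
  change (G.P _).1 ((G.S e).1 x) α = _
  rw [P_apply]
  cases α using Path.cons_induction with
  | vertex v => rw [S_apply_vertex, ite_self]
  | cons f β h _ =>
    by_cases hef : e = f
    · subst hef
      rw [if_pos (Path.cons_rng _ _ h)]
    · rw [S_apply_cons_ne _ hef, ite_self]

theorem star_S_mul_S (e : E) : star (G.S e) * G.S e = G.P (G.s e) := by
  refine G.ext_L fun x α => ?_
  change (star (G.S e)).1 ((G.S e).1 x) α = _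
  rw [P_apply]
  by_cases h : G.s e = α.rng
  · rw [star_S_apply _ _ _ h, S_apply_cons, if_pos h.symm]
  · rw [star_S_apply_of_ne _ _ _ h, if_neg (Ne.symm h)]

theorem star_S_mul_S_ne {e f : E} (hef : e ≠ f) : star (G.S e) * G.S f = 0 := by
  refine G.ext_L fun x α => ?_
  change (star (G.S e)).1 ((G.S f).1 x) α = 0
  by_cases h : G.s e = α.rng
  · rw [star_S_apply _ _ _ h, S_apply_cons_ne _ (Ne.symm hef)]
  · rw [star_S_apply_of_ne _ _ _ h]

theorem star_gauge (t : ℝ) : star (G.gauge t) = G.gauge (-t) := by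
  refine Subtype.ext ?_
  refine (star_diagOp _ ⟨1, fun α => by simp [Complex.norm_exp]⟩
    ⟨1, fun i => by simp [Complex.norm_exp]⟩).trans ?_
  ext x i
  change _ = Complex.exp (Complex.I * i.len * (-t : ℝ)) * x i
  simp [← Complex.exp_conj]

theorem gauge_apply (t : ℝ) (x : Ell2 G.Path) (α : G.Path) :
    (G.gauge t).1 x α = Complex.exp (Complex.I * α.len * t) * x α := rfl

theorem gauge_mul_star (t : ℝ) : G.gauge t * star (G.gauge t) = 1 := by
  have := G.star_gauge_mul (-t)
  rwa [← star_gauge, star_star] at this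

theorem gauge_mul_S (t : ℝ) (e : E) :
    G.gauge t * G.S e = Complex.exp (Complex.I * t) • (G.S e * G.gauge t) := by
  refine G.ext_L fun x α => ?_
  change (G.gauge t).1 ((G.S e).1 x) α =
    Complex.exp (Complex.I * t) * ((G.S e).1 ((G.gauge t).1 x) α)
  rw [gauge_apply]
  cases α using Path.cons_induction with
  | vertex v => rw [S_apply_vertex, S_apply_vertex, mul_zero, mul_zero]
  | cons f β h _ =>
    by_cases hef : e = f
    · subst hef
      rw [S_apply_cons, S_apply_cons, gauge_apply, ← mul_assoc, ← Complex.exp_add]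
      congr 2
      simp only [Path.cons_len]; push_cast; ring
    · rw [S_apply_cons_ne _ hef, S_apply_cons_ne _ hef, mul_zero, mul_zero]

end

end DirGraph
end

/-! ### Composition of paths, and operators on the Fock space seen degree by degree -/

noncomputable section

theorem Ell2.norm_partialOp_le {I J : Type*} (R : I → J → Prop)
    (h₁ : ∀ i i' j, R i j → R i' j → i = i') (h₂ : ∀ i j j', R i j → R i j' → j = j') :
    ‖partialOp R h₁ h₂‖ ≤ 1 := by
  unfold partialOp mkOp
  exact LinearMap.mkContinuous_norm_le _ zero_le_one _

namespace DirGraph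
open Ell2
variable {V E : Type*} (G : DirGraph V E)

namespace Path
variable {G}

theorem rangeOf_append (v : V) (l m : List E) :
    G.rangeOf v (l ++ m) = G.rangeOf (G.rangeOf v m) l := by
  cases l <;> rfl

theorem isPath_append {v : V} {l m : List E} :
    G.IsPath v (l ++ m) ↔ G.IsPath (G.rangeOf v m) l ∧ G.IsPath v m := by
  induction l with
  | nil => exact ⟨fun h => ⟨trivial, h⟩, fun h => h.2⟩
  | cons e l ih =>
    simp only [List.cons_append, IsPath, rangeOf_append, ih, and_assoc]

/-- The composition `αβ` of two paths. -/
def comp (α β : G.Path) (h : β.rng = α.src) : G.Path :=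
  ⟨α.edges ++ β.edges, β.src, isPath_append.2 ⟨by
    have := α.isPath
    rwa [← h] at this, β.isPath⟩⟩

@[simp] theorem comp_src (α β : G.Path) (h : β.rng = α.src) : (comp α β h).src = β.src := rfl
@[simp] theorem comp_len (α β : G.Path) (h : β.rng = α.src) :
    (comp α β h).len = α.len + β.len := List.length_append
@[simp] theorem comp_rng (α β : G.Path) (h : β.rng = α.src) : (comp α β h).rng = α.rng := by
  change G.rangeOf β.src (α.edges ++ β.edges) = _
  rw [rangeOf_append]
  exact congrArg (fun v => G.rangeOf v α.edges) h

theorem exists_comp_eq (γ : G.Path) {k : ℕ} (hk : k ≤ γ.len) :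
    ∃ (α β : G.Path) (h : β.rng = α.src), α.len = k ∧ γ = comp α β h := by
  have hγ := γ.isPath
  rw [← List.take_append_drop k γ.edges, isPath_append] at hγ
  refine ⟨⟨γ.edges.take k, _, hγ.1⟩, ⟨γ.edges.drop k, γ.src, hγ.2⟩, rfl, ?_, ?_⟩
  · exact (List.length_take).trans (min_eq_left hk)
  · exact Path.ext (List.take_append_drop k γ.edges).symm rfl

theorem comp_inj {α α' β β' : G.Path} {h : β.rng = α.src} {h' : β'.rng = α'.src}
    (hl : α.len = α'.len) (H : comp α β h = comp α' β' h') : α = α' ∧ β = β' := by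
  have h1 : α.edges ++ β.edges = α'.edges ++ β'.edges := congrArg Path.edges H
  have h2 := congrArg Path.src H
  rw [comp_src, comp_src] at h2
  obtain ⟨h3, h4⟩ := List.append_inj h1 hl
  have h5 : β = β' := Path.ext h4 h2
  exact ⟨Path.ext h3 (by rw [← h, ← h', h5]), h5⟩

end Path

section
variable [Fintype V]

theorem Spath_vertex (v : V) : G.Spath (Path.vertex G v) = G.P v := one_mul _

theorem Spath_cons (e : E) (β : G.Path) (h : G.s e = β.rng) :
    G.Spath (Path.cons e β h) = G.S e * G.Spath β := by
  simp only [Spath, Path.cons_edges, List.map_cons, List.prod_cons, Path.cons_src, mul_assoc]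

theorem Spath_apply (β γ : G.Path) (h : γ.rng = β.src) (x : Ell2 G.Path) :
    (G.Spath β).1 x (β.comp γ h) = x γ := by
  induction β using Path.cons_induction with
  | vertex v =>
    rw [Spath_vertex]
    exact (G.P_apply v x γ).trans (if_pos h)
  | cons e β he ih =>
    rw [Spath_cons]
    exact (G.S_apply_cons e (β.comp γ h) 
      (he.trans (Path.comp_rng β γ h).symm) _).trans (ih h)

theorem Spath_apply_of_not (β α : G.Path) (h : ∀ γ h, α ≠ β.comp γ h) (x : Ell2 G.Path) :
    (G.Spath β).1 x α = 0 := by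
  induction β using Path.cons_induction generalizing α with
  | vertex v =>
    rw [Spath_vertex, P_apply, if_neg]
    exact fun h' => h α h' rfl
  | cons e β he ih =>
    rw [Spath_cons]
    change (G.S e).1 ((G.Spath β).1 x) α = 0
    cases α using Path.cons_induction with
    | vertex v => rw [S_apply_vertex]
    | cons f α' hf _ =>
      by_cases hef : e = f
      · subst hef
        rw [S_apply_cons]
        refine ih α' fun γ hγ hα => h γ hγ ?_
        subst hα
        rfl
      · rw [S_apply_cons_ne _ hef]

end

/-! ### Components -/

/-! ### Creation operators by paths on components -/

theorem tensorLeft_apply {p k : ℕ} (β : G.PathN p) (γ : G.PathN k) (h : γ.1.rng = β.1.src)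
    (hl : (β.1.comp γ.1 h).len = k + p) (x : Ell2 (G.PathN k)) :
    G.tensorLeft p k β x ⟨β.1.comp γ.1 h, hl⟩ = x γ :=
  partialOp_apply (i := γ) _ _ _ x ⟨h, rfl, rfl⟩

theorem tensorLeft_apply_of_not {p k : ℕ} (β : G.PathN p) (α : G.PathN (k + p))
    (h : ∀ γ h, α.1 ≠ β.1.comp γ h) (x : Ell2 (G.PathN k)) :
    G.tensorLeft p k β x α = 0 :=
  partialOp_apply_of_not (j := α) _ _ _ x fun γ hγ => h γ.1 hγ.1 (Path.ext hγ.2.1 hγ.2.2)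

theorem adjoint_tensorLeft_apply {p k : ℕ} (β : G.PathN p) (γ : G.PathN k)
    (h : γ.1.rng = β.1.src) (hl : (β.1.comp γ.1 h).len = k + p) (x : Ell2 (G.PathN (k + p))) :
    ContinuousLinearMap.adjoint (G.tensorLeft p k β) x γ = x ⟨β.1.comp γ.1 h, hl⟩ :=
  adjoint_partialOp_apply (i := γ) (j := ⟨β.1.comp γ.1 h, hl⟩) _ _ _ x ⟨h, rfl, rfl⟩

theorem adjoint_tensorLeft_apply_of_not {p k : ℕ} (β : G.PathN p) (γ : G.PathN k)
    (h : γ.1.rng ≠ β.1.src) (x : Ell2 (G.PathN (k + p))) :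
    ContinuousLinearMap.adjoint (G.tensorLeft p k β) x γ = 0 :=
  adjoint_partialOp_apply_of_not (i := γ) _ _ _ x fun _ hγ => h hγ.1

theorem tensorLeft_norm_le {p k : ℕ} (β : G.PathN p) (y : Ell2 (G.PathN k)) :
    ‖G.tensorLeft p k β y‖ ≤ ‖y‖ := by
  have : ‖G.tensorLeft p k β‖ ≤ 1 := norm_partialOp_le _ _ _
  simpa using ContinuousLinearMap.le_of_opNorm_le _ this y

theorem ext_component {x y : Ell2 G.Path} (h : ∀ k, G.component k x = G.component k y) : x = y := by
  ext α
  have := congrArg (fun z : Ell2 (G.PathN α.len) => z ⟨α, rfl⟩) (h α.len)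
  simpa only [component_apply] using this

theorem hasSum_inner_component (x y : Ell2 G.Path) :
    HasSum (fun k => inner ℂ (G.component k x) (G.component k y)) (inner ℂ x y) := by
  have h := lp.hasSum_inner (𝕜 := ℂ) x y
  rw [← (Equiv.sigmaFiberEquiv (Path.len (G := G))).hasSum_iff] at h
  refine h.sigma fun k => ?_
  have h2 := lp.hasSum_inner (𝕜 := ℂ) (G.component k x) (G.component k y)
  simp only [component_apply] at h2
  exact h2

theorem hasSum_norm_component (x : Ell2 G.Path) :
    HasSum (fun k => ‖G.component k x‖ ^ 2) (‖x‖ ^ 2) := by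
  have h := Complex.hasSum_re (G.hasSum_inner_component x x)
  simp only [inner_self_eq_norm_sq_to_K] at h
  norm_cast at h

/-- By Parseval over the degrees, after discarding the first `d` components of `y`. The shift by `d`
is the degree by which `S_β` with `|β| = d` raises vectors. -/
theorem norm_le_of_component {x y : Ell2 G.Path} {c : ℝ} (hc : 0 ≤ c) (d : ℕ)
    (h0 : ∀ j < d, G.component j y = 0)
    (h : ∀ k, ‖G.component (k + d) y‖ ≤ c * ‖G.component k x‖) : ‖y‖ ≤ c * ‖x‖ := by
  have h1 := G.hasSum_norm_component y
  rw [← hasSum_nat_add_iff' d, Finset.sum_eq_zero, sub_zero] at h1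
  · have h2 := (G.hasSum_norm_component x).mul_left (c ^ 2)
    have h3 := hasSum_le (fun k => ?_) h1 h2
    · rw [← mul_pow] at h3
      exact le_of_sq_le_sq h3 (by positivity)
    · rw [← mul_pow]
      gcongr
      exact h k
  · intro j hj
    rw [h0 j (Finset.mem_range.1 hj)]
    simp

section
variable [Fintype V]

theorem component_P (v : V) (x : Ell2 G.Path) (k : ℕ) [DecidableEq V] :
    G.component k ((G.P v).1 x) = G.leftN k (Pi.single v 1) (G.component k x) := by
  ext α
  rw [component_apply, P_apply, leftN, diagOp_apply, component_apply, Pi.single_apply]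
  by_cases h : α.1.rng = v <;> simp [h]

theorem component_gauge (t : ℝ) (x : Ell2 G.Path) (k : ℕ) :
    G.component k ((G.gauge t).1 x) = Complex.exp (Complex.I * k * t) • G.component k x := by
  ext α
  rw [component_apply, gauge_apply, lp.coeFn_smul, Pi.smul_apply, component_apply, α.2]
  rfl

theorem component_Spath {p : ℕ} (β : G.PathN p) (x : Ell2 G.Path) (k : ℕ) :
    G.component (k + p) ((G.Spath β.1).1 x) = G.tensorLeft p k β (G.component k x) := by
  ext α
  rw [component_apply]
  by_cases h : ∃ γ h, α.1 = β.1.comp γ h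
  · obtain ⟨γ, h, hα⟩ := h
    obtain ⟨α, hl⟩ := α
    simp only at hα
    subst hα
    have hγ : γ.len = k := by
      have := β.2
      rw [Path.comp_len] at hl
      omega
    rw [Spath_apply, G.tensorLeft_apply β ⟨γ, hγ⟩ h hl, component_apply]
  · push Not at h
    rw [Spath_apply_of_not _ _ _ h, tensorLeft_apply_of_not _ _ _ h]

theorem component_Spath_of_lt {p : ℕ} (β : G.PathN p) (x : Ell2 G.Path) (j : ℕ) (hj : j < p) :
    G.component j ((G.Spath β.1).1 x) = 0 := by
  ext α
  rw [component_apply, Spath_apply_of_not]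
  · rfl
  · intro γ h hα
    have := α.2
    have hβ := β.2
    rw [hα, Path.comp_len] at this
    omega

variable [Fintype E]

/-! ### Compactness of operators whose components tend to zero -/

theorem finite_len_lt (N : ℕ) : {α : G.Path | α.len < N}.Finite := by
  have : {α : G.Path | α.len < N} ⊆ ⋃ k ∈ Set.Iio N, Set.range (Subtype.val : G.PathN k → G.Path) :=
    fun α hα => Set.mem_biUnion hα ⟨⟨α, rfl⟩, rfl⟩
  exact ((Set.finite_Iio N).biUnion fun k _ => Set.finite_range _).subset this

open Classical in
/-- The projection onto the span of the paths of length less than `N`. -/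
def lowProj (N : ℕ) : G.L :=
  ⟨diagOp (fun α : G.Path => if α ∈ (G.finite_len_lt N).toFinset then 1 else 0)
    ⟨1, fun α => by split_ifs <;> simp⟩, diagOp_mem _ _ _⟩

theorem lowProj_apply (N : ℕ) (x : Ell2 G.Path) (α : G.Path) :
    (G.lowProj N).1 x α = if α.len < N then x α else 0 := by
  classical
  refine (diagOp_apply _ ⟨1, fun α => by split_ifs <;> simp⟩ x α).trans ?_
  by_cases h : α.len < N <;> simp [h]

theorem lowProj_mem (N : ℕ) : G.lowProj N ∈ compacts (Path.src (G := G)) :=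
  diagOp_finset_mem _ _ _

/-- Cutting off the input below degree `N` gives a compact operator, because a finite graph has only
finitely many paths of bounded length. What remains acts only on degrees `k ≥ N`, where its norm is
controlled by `c k → 0`. -/
theorem mem_compacts_of_component (T : G.L) (d : ℕ) (c : ℕ → ℝ)
    (hc : Filter.Tendsto c Filter.atTop (nhds 0))
    (h0 : ∀ x, ∀ j < d, G.component j (T.1 x) = 0)
    (h : ∀ x k, ‖G.component (k + d) (T.1 x)‖ ≤ c k * ‖G.component k x‖) :
    T ∈ compacts (Path.src (G := G)) := by
  have hcl : IsClosed (compacts (Path.src (G := G)) : Set G.L) :=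
    IsCStarIdeal.closed
  rw [← SetLike.mem_coe, ← hcl.closure_eq, Metric.mem_closure_iff]
  intro ε hε
  obtain ⟨N, hN⟩ := Filter.eventually_atTop.1 (hc.eventually (gt_mem_nhds (half_pos hε)))
  -- The cut-off operator approximates `T` within `ε / 2`; the compacts are closed, so this
  -- suffices.
  refine ⟨T * G.lowProj N, Ideal.mul_mem_left _ _ (G.lowProj_mem N), ?_⟩
  rw [dist_eq_norm]
  refine lt_of_le_of_lt ?_ (half_lt_self hε)
  refine ContinuousLinearMap.opNorm_le_bound _ (half_pos hε).le fun x => ?_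
  have e1 : (T - T * G.lowProj N).1 x = T.1 (x - (G.lowProj N).1 x) := by
    rw [map_sub]; rfl
  change ‖(T - T * G.lowProj N).1 x‖ ≤ _
  rw [e1]
  refine G.norm_le_of_component (half_pos hε).le d (h0 _) fun k => ?_
  refine (h _ k).trans ?_
  by_cases hk : k < N
  · have : G.component k (x - (G.lowProj N).1 x) = 0 := by
      ext α
      rw [component_apply, lp.coeFn_sub, Pi.sub_apply, lowProj_apply, if_pos (by rw [α.2]; exact hk),
        sub_self]
      rfl
    rw [this, norm_zero, mul_zero]
    positivity
  · have : G.component k (x - (G.lowProj N).1 x) = G.component k x := by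
      ext α
      rw [component_apply, component_apply, lp.coeFn_sub, Pi.sub_apply, lowProj_apply,
        if_neg (by rw [α.2]; exact hk), sub_zero]
    rw [this]
    gcongr
    exact (hN k (not_lt.1 hk)).le

/-- A path of positive length has exactly one first edge, so the difference is the projection onto
the paths of length `0`. -/
theorem one_sub_sum_S_mem : 1 - ∑ e, G.S e * star (G.S e) ∈ compacts (Path.src (G := G)) := by
  have : 1 - ∑ e, G.S e * star (G.S e) = G.lowProj 1 := by
    refine G.ext_L fun x α => ?_
    rw [lowProj_apply]
    have e1 : (1 - ∑ e, G.S e * star (G.S e)).1 x α =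
        x α - ∑ e, (G.S e).1 ((star (G.S e)).1 x) α := by
      rw [AddSubgroupClass.coe_sub, AddSubmonoidClass.coe_finsetSum]
      rw [sub_apply, lp.coeFn_sub, Pi.sub_apply, sum_apply, lp.coeFn_sum,
        Finset.sum_apply]
      rfl
    rw [e1]
    cases α using Path.cons_induction with
    | vertex v => simp [S_apply_vertex]
    | cons f β h _ =>
      rw [if_neg (by simp), Finset.sum_eq_single f]
      · rw [S_apply_cons, star_S_apply _ _ _ h, sub_self]
      · intro e _ he
        rw [S_apply_cons_ne _ he]
      · simp
  rw [this]
  exact G.lowProj_mem 1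

/-! ### The weight operator: commutators with `S_β` and the lower bound -/

variable (Z : G.WeightSeq)

theorem component_weight (x : Ell2 G.Path) (k : ℕ) :
    G.component k ((G.weight Z).1 x) = Z.Z k (G.component k x) := by
  ext α
  obtain ⟨α, rfl⟩ := α
  rw [component_apply]
  rfl

theorem weight_mul_P (v : V) : G.weight Z * G.P v = G.P v * G.weight Z := by
  classical
  refine Subtype.ext (ContinuousLinearMap.ext fun x => G.ext_component fun k => ?_)
  change G.component k ((G.weight Z).1 ((G.P v).1 x)) = G.component k ((G.P v).1 ((G.weight Z).1 x))
  rw [component_weight, component_P, component_P, component_weight]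
  exact congrArg (fun T => T (G.component k x)) (Z.comm_left k (Pi.single v 1))

theorem gauge_mul_weight (t : ℝ) : G.gauge t * G.weight Z = G.weight Z * G.gauge t := by
  refine Subtype.ext (ContinuousLinearMap.ext fun x => G.ext_component fun k => ?_)
  change G.component k ((G.gauge t).1 ((G.weight Z).1 x)) =
    G.component k ((G.weight Z).1 ((G.gauge t).1 x))
  rw [component_weight, component_gauge, component_gauge, component_weight, map_smul]

/-- The maps `δ_β ⊗ ·` for different `β` of length `p` have orthogonal ranges, so one summand of
`I_p ⊗ Z_k` survives. In it `T_β^* T_β` is the left action of the indicator of `s(β)`; this commutes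
with `Z_k` and is absorbed by `T_β`. -/
theorem tensorId_tensorLeft {p k : ℕ} (β : G.PathN p) (y : Ell2 (G.PathN k)) :
    G.tensorId p k (Z.Z k) (G.tensorLeft p k β y) = G.tensorLeft p k β (Z.Z k y) := by
  classical
  have hlen : ∀ (β : G.PathN p) (γ : G.PathN k) h, (β.1.comp γ.1 h).len = k + p := by
    intro β γ h
    rw [Path.comp_len, β.2, γ.2, add_comm]
  rw [tensorId, sum_apply, Finset.sum_eq_single β]
  · have h1 : ContinuousLinearMap.adjoint (G.tensorLeft p k β) (G.tensorLeft p k β y) =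
        G.leftN k (Pi.single β.1.src 1) y := by
      ext γ
      rw [leftN, diagOp_apply, Pi.single_apply]
      by_cases h : γ.1.rng = β.1.src
      · rw [G.adjoint_tensorLeft_apply β γ h (hlen _ _ h), tensorLeft_apply, if_pos h, one_mul]
      · rw [adjoint_tensorLeft_apply_of_not _ _ _ h, if_neg h, zero_mul]
    have h2 : ∀ y, G.tensorLeft p k β (G.leftN k (Pi.single β.1.src 1) y) =
        G.tensorLeft p k β y := by
      intro y
      ext α
      by_cases h : ∃ γ h, α.1 = β.1.comp γ h
      · obtain ⟨γ, h, hα⟩ := h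
        obtain ⟨α, hl⟩ := α
        simp only at hα
        subst hα
        have hγ : γ.len = k := by
          have := β.2
          rw [Path.comp_len] at hl
          omega
        rw [G.tensorLeft_apply β ⟨γ, hγ⟩ h hl, G.tensorLeft_apply β ⟨γ, hγ⟩ h hl, leftN,
          diagOp_apply, Pi.single_apply, if_pos h, one_mul]
      · push Not at h
        rw [tensorLeft_apply_of_not _ _ _ h, tensorLeft_apply_of_not _ _ _ h]
    rw [ContinuousLinearMap.comp_apply, ContinuousLinearMap.comp_apply, h1]
    have h3 : Z.Z k (G.leftN k (Pi.single β.1.src 1) y) =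
        G.leftN k (Pi.single β.1.src 1) (Z.Z k y) :=
      congrArg (fun T => T y) (Z.comm_left k (Pi.single β.1.src 1))
    rw [h3, h2]
  · intro β' _ hne
    have h1 : ContinuousLinearMap.adjoint (G.tensorLeft p k β') (G.tensorLeft p k β y) = 0 := by
      ext γ
      by_cases h : γ.1.rng = β'.1.src
      · rw [G.adjoint_tensorLeft_apply β' γ h (hlen _ _ h), tensorLeft_apply_of_not]
        · rfl
        · intro γ' h' H
          exact hne (Subtype.ext (Path.comp_inj (h := h) (β'.2.trans β.2.symm) H).1)
      · rw [adjoint_tensorLeft_apply_of_not _ _ _ h]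
        rfl
    rw [ContinuousLinearMap.comp_apply, ContinuousLinearMap.comp_apply, h1, map_zero, map_zero]
  · simp

/-- Under the asymptotic periodicity condition, `Z` commutes with `S_β` modulo compact operators
for all paths `β` of length `p`. -/
theorem weight_commutator_mem {p : ℕ} (hA : G.ConditionA Z p) (β : G.PathN p) :
    G.weight Z * G.Spath β.1 - G.Spath β.1 * G.weight Z ∈ compacts (Path.src (G := G)) := by
  have e1 : ∀ x, (G.weight Z * G.Spath β.1 - G.Spath β.1 * G.weight Z).1 x =
      (G.weight Z).1 ((G.Spath β.1).1 x) - (G.Spath β.1).1 ((G.weight Z).1 x) := fun _ => rfl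
  -- On degree `k` the commutator is `(Z_{k+p} - I_p ⊗ Z_k)` applied to `δ_β ⊗ x_k`, so the norms in
  -- Condition A(p) serve as the sequence `c`.
  refine G.mem_compacts_of_component _ p _ hA (fun x j hj => ?_) fun x k => ?_
  · rw [e1, map_sub, component_weight, component_Spath_of_lt _ _ _ _ hj,
      component_Spath_of_lt _ _ _ _ hj, map_zero, sub_zero]
  · rw [e1, map_sub, component_weight, component_Spath, component_Spath, component_weight,
      ← tensorId_tensorLeft, ← sub_apply, norm_sub_rev]
    exact (ContinuousLinearMap.le_opNorm _ _).trans
      (mul_le_mul_of_nonneg_left (G.tensorLeft_norm_le β _) (norm_nonneg _))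

open scoped ComplexOrder in
-- The assumed bound starts at `k = 1`, while `Z_0 = 1` is bounded below by `1`; hence the constant
-- `min ε 1`.
theorem exists_weight_sub_isPositive :
    ∃ ε : ℝ, 0 < ε ∧ ((G.weight Z - (ε : ℂ) • 1 : G.L) : Ell2 G.Path →L[ℂ] Ell2 G.Path).IsPositive := by
  obtain ⟨ε, hε, h⟩ := Z.lower
  refine ⟨min ε 1, lt_min hε one_pos, ?_⟩
  set δ := min ε 1
  have hk : ∀ k, (Z.Z k - (δ : ℂ) • 1).IsPositive := by
    intro k
    have aux : ∀ (T : Ell2 (G.PathN k) →L[ℂ] Ell2 (G.PathN k)) (r : ℝ), δ ≤ r →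
        (T - (r : ℂ) • 1).IsPositive → (T - (δ : ℂ) • 1).IsPositive := by
      intro T r hr hT
      have h2 : (((r - δ : ℝ) : ℂ) • (1 : Ell2 (G.PathN k) →L[ℂ] Ell2 (G.PathN k))).IsPositive := by
        refine ContinuousLinearMap.IsPositive.smul_of_nonneg ContinuousLinearMap.isPositive_one ?_
        exact_mod_cast sub_nonneg.2 hr
      have h3 := hT.add h2
      convert h3 using 1
      push_cast
      rw [sub_smul]
      abel
    rcases Nat.eq_zero_or_pos k with rfl | hk
    · refine aux _ 1 (min_le_right _ _) ?_
      rw [Z.zero_eq]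
      simp
    · exact aux _ ε (min_le_left _ _) (h k hk)
  have hc : ∀ x k, G.component k (((G.weight Z - (δ : ℂ) • 1 : G.L) :
      Ell2 G.Path →L[ℂ] Ell2 G.Path) x) = (Z.Z k - (δ : ℂ) • 1) (G.component k x) := by
    intro x k
    change G.component k ((G.weight Z).1 x - (δ : ℂ) • x) = _
    rw [map_sub, component_weight, map_smul]
    rfl
  rw [ContinuousLinearMap.isPositive_iff]
  constructor
  · intro x y
    refine HasSum.unique (G.hasSum_inner_component _ _) ?_
    convert G.hasSum_inner_component x _ using 2 with k
    rw [ContinuousLinearMap.coe_coe, hc, hc]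
    exact (hk k).isSymmetric _ _
  · intro x
    refine (G.hasSum_inner_component _ _).nonneg fun k => ?_
    rw [hc]
    exact (hk k).inner_nonneg_left _

end
end DirGraph
end

noncomputable section
namespace DirGraph
open Ell2
variable {V E : Type*} (G : DirGraph V E)

/-! ### Cuntz–Krieger relations in the quotient -/

section
variable {p : ℕ}

theorem le_len_Gam {n : ℕ} {G : DirGraph V E} (γ : G.Gam p n) : n * p ≤ γ.1.len := by
  rw [γ.2]; omega

theorem len_Gam_lt (hp : 1 ≤ p) {n : ℕ} {G : DirGraph V E} (γ : G.Gam p n) : γ.1.len < (n + 1) * p := by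
  rw [γ.2, add_mul]; omega

variable [Fintype V]

/-- `u_e = q(S_e)`. -/
def uEdge (e : E) : G.Calkin := G.q (G.S e)

/-- `q(P_v)`. -/
def pVert (v : V) : G.Calkin := G.q (G.P v)

theorem q_eq_zero {T : G.L} (h : T ∈ compacts (Path.src (G := G))) : G.q T = 0 :=
  Ideal.Quotient.eq_zero_iff_mem.2 h

theorem star_pVert (v : V) : star (G.pVert v) = G.pVert v := by
  rw [pVert, ← map_star, star_P]

theorem pVert_mul_self (v : V) : G.pVert v * G.pVert v = G.pVert v := by
  rw [pVert, ← map_mul, P_mul_P_self]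

theorem pVert_mul_ne {v w : V} (h : v ≠ w) : G.pVert v * G.pVert w = 0 := by
  rw [pVert, pVert, ← map_mul, P_mul_P_ne _ h, map_zero]

theorem sum_pVert : ∑ v, G.pVert v = 1 := by
  simp only [pVert]
  rw [← map_sum, sum_P, map_one]

theorem uEdge_mul_pVert (e : E) : G.uEdge e * G.pVert (G.s e) = G.uEdge e := by
  rw [uEdge, pVert, ← map_mul, S_mul_P]

theorem pVert_mul_uEdge (e : E) : G.pVert (G.r e) * G.uEdge e = G.uEdge e := by
  rw [uEdge, pVert, ← map_mul, P_mul_S]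

theorem star_uEdge_mul_uEdge (e : E) : star (G.uEdge e) * G.uEdge e = G.pVert (G.s e) := by
  rw [uEdge, pVert, ← map_star, ← map_mul, star_S_mul_S]

theorem star_uEdge_mul_uEdge_ne {e f : E} (h : e ≠ f) : star (G.uEdge e) * G.uEdge f = 0 := by
  rw [uEdge, uEdge, ← map_star, ← map_mul, star_S_mul_S_ne _ h, map_zero]

theorem u_vertex (v : V) : G.u (Path.vertex G v) = G.pVert v := by
  rw [u, Spath_vertex, pVert]

theorem u_cons (e : E) (β : G.Path) (h : G.s e = β.rng) :
    G.u (Path.cons e β h) = G.uEdge e * G.u β := by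
  rw [u, Spath_cons, map_mul, u, uEdge]

theorem u_mul_pVert (α : G.Path) : G.u α * G.pVert α.src = G.u α := by
  rw [u, pVert, ← map_mul, Spath, mul_assoc, P_mul_P_self]

theorem pVert_mul_u (α : G.Path) : G.pVert α.rng * G.u α = G.u α := by
  cases α using Path.cons_induction with
  | vertex v => rw [u_vertex, Path.vertex_rng, pVert_mul_self]
  | cons e β h _ => rw [u_cons, Path.cons_rng, ← mul_assoc, pVert_mul_uEdge]

theorem pVert_mul_u_ne {v : V} {α : G.Path} (h : v ≠ α.rng) : G.pVert v * G.u α = 0 := by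
  rw [← pVert_mul_u, ← mul_assoc, pVert_mul_ne _ h, zero_mul]

theorem pVert_mul_star_u (α : G.Path) : G.pVert α.src * star (G.u α) = star (G.u α) := by
  rw [← star_pVert, ← star_mul, u_mul_pVert]

theorem u_mul_u_ne {α β : G.Path} (h : α.src ≠ β.rng) : G.u α * G.u β = 0 := by
  rw [← u_mul_pVert, mul_assoc, pVert_mul_u_ne _ h, mul_zero]

theorem uEdge_mul_u_ne {e : E} {β : G.Path} (h : G.s e ≠ β.rng) : G.uEdge e * G.u β = 0 := by
  rw [← uEdge_mul_pVert, mul_assoc, pVert_mul_u_ne _ h, mul_zero]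

theorem star_u_mul_u (α : G.Path) : star (G.u α) * G.u α = G.pVert α.src := by
  induction α using Path.cons_induction with
  | vertex v => rw [u_vertex, star_pVert, pVert_mul_self, Path.vertex_src]
  | cons e β h ih =>
    rw [u_cons, star_mul, mul_assoc, ← mul_assoc (star (G.uEdge e)), star_uEdge_mul_uEdge, h,
      pVert_mul_u, ih, Path.cons_src]

/-- Strip equal first edges until the paths differ: different edges have orthogonal ranges, and if
no edge is left, the vertices differ. -/
theorem star_u_mul_u_ne {α β : G.Path} (hl : α.len = β.len) (h : α ≠ β) :
    star (G.u α) * G.u β = 0 := by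
  induction α using Path.cons_induction generalizing β with
  | vertex v =>
    rw [Path.eq_vertex hl.symm] at h ⊢
    rw [u_vertex, u_vertex, star_pVert, pVert_mul_ne]
    rintro rfl
    exact h rfl
  | cons e α he ih =>
    cases β using Path.cons_induction with
    | vertex v => simp at hl
    | cons f β hf _ =>
      rw [u_cons, u_cons, star_mul, mul_assoc, ← mul_assoc (star (G.uEdge e))]
      by_cases hef : e = f
      · subst hef
        rw [star_uEdge_mul_uEdge, hf, pVert_mul_u]
        refine ih (by simpa using hl) ?_
        rintro rfl
        exact h rfl
      · rw [star_uEdge_mul_uEdge_ne _ hef, zero_mul, mul_zero]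

theorem u_comp (α β : G.Path) (h : β.rng = α.src) : G.u (α.comp β h) = G.u α * G.u β := by
  induction α using Path.cons_induction with
  | vertex v =>
    have h' : β.rng = v := h
    subst h'
    rw [u_vertex, pVert_mul_u]
    rfl
  | cons e α he ih =>
    rw [u_cons, mul_assoc, ← ih h]
    exact G.u_cons e (α.comp β h) (he.trans (Path.comp_rng α β h).symm)

theorem star_u_mul_u_comp (α β : G.Path) (h : β.rng = α.src) :
    star (G.u α) * G.u (α.comp β h) = G.u β := by
  rw [u_comp, ← mul_assoc, star_u_mul_u, ← h, pVert_mul_u]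

/-- `x` commutes with all `q(P_v)`. -/
def CommP (x : G.Calkin) : Prop := ∀ v, G.pVert v * x = x * G.pVert v

variable {G}

theorem CommP.one : G.CommP 1 := fun v => by rw [mul_one, one_mul]

theorem CommP.mul {x y : G.Calkin} (hx : G.CommP x) (hy : G.CommP y) : G.CommP (x * y) := fun v => by
  rw [← mul_assoc, hx v, mul_assoc, hy v, mul_assoc]

theorem CommP.add {x y : G.Calkin} (hx : G.CommP x) (hy : G.CommP y) : G.CommP (x + y) := fun v => by
  rw [mul_add, add_mul, hx v, hy v]

theorem CommP.algebraMap (c : ℂ) : G.CommP (algebraMap ℂ G.Calkin c) :=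
  fun v => (Algebra.commutes c (G.pVert v)).symm

variable (G)

theorem pVert_mul_uEdge_ne {v : V} {e : E} (h : v ≠ G.r e) : G.pVert v * G.uEdge e = 0 := by
  rw [← pVert_mul_uEdge, ← mul_assoc, pVert_mul_ne _ h, zero_mul]

/-! ### The shift endomorphism -/

variable [Fintype E]

theorem sum_uEdge : ∑ e, G.uEdge e * star (G.uEdge e) = 1 := by
  have h := G.q_eq_zero G.one_sub_sum_S_mem
  rw [map_sub, map_one, map_sum, sub_eq_zero] at h
  rw [h]
  exact Finset.sum_congr rfl fun e _ => by rw [map_mul, map_star, uEdge]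

/-- The map `x ↦ ∑_e u_e x u_e^*`. -/
def endo (x : G.Calkin) : G.Calkin := ∑ e, G.uEdge e * x * star (G.uEdge e)

theorem commP_endo (x : G.Calkin) : G.CommP (G.endo x) := by
  intro v
  rw [endo, Finset.mul_sum, Finset.sum_mul]
  refine Finset.sum_congr rfl fun e _ => ?_
  have key : star (G.uEdge e) * G.pVert v = star (G.pVert v * G.uEdge e) := by
    rw [star_mul, star_pVert]
  rw [mul_assoc _ _ (G.pVert v), key]
  by_cases h : v = G.r e
  · subst h
    rw [pVert_mul_uEdge, ← mul_assoc, ← mul_assoc, pVert_mul_uEdge]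
  · rw [pVert_mul_uEdge_ne _ h, ← mul_assoc, ← mul_assoc, pVert_mul_uEdge_ne _ h]
    simp

/-- The ranges of the `u_f` are orthogonal, so only the summand `f = e` remains. Commutation with
the vertex projections lets `u_e^* u_e` be absorbed on the left of `x`. -/
theorem endo_mul_uEdge {x : G.Calkin} (hx : G.CommP x) (e : E) :
    G.endo x * G.uEdge e = G.uEdge e * x := by
  rw [endo, Finset.sum_mul, Finset.sum_eq_single e]
  · rw [mul_assoc, star_uEdge_mul_uEdge, mul_assoc, ← hx, ← mul_assoc, uEdge_mul_pVert]
  · intro f _ hf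
    rw [mul_assoc, star_uEdge_mul_uEdge_ne _ hf, mul_zero]
  · simp

theorem star_endo (x : G.Calkin) : star (G.endo x) = G.endo (star x) := by
  rw [endo, endo, star_sum]
  exact Finset.sum_congr rfl fun e _ => by rw [star_mul, star_mul, star_star, mul_assoc]

theorem commP_endo_iterate {x : G.Calkin} (hx : G.CommP x) (k : ℕ) : G.CommP (G.endo^[k] x) := by
  cases k with
  | zero => exact hx
  | succ k =>
    rw [Function.iterate_succ_apply']
    exact G.commP_endo _

theorem star_endo_iterate (x : G.Calkin) (k : ℕ) :
    star (G.endo^[k] x) = G.endo^[k] (star x) := by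
  induction k with
  | zero => rfl
  | succ k ih => rw [Function.iterate_succ_apply', Function.iterate_succ_apply', star_endo, ih]

theorem sum_pathN {x : G.Calkin} (hx : G.CommP x) (k : ℕ) :
    ∑ μ : G.PathN k, G.u μ.1 * x * star (G.u μ.1) = G.endo^[k] x := by
  induction k with
  | zero =>
    have h0 : Function.Bijective (fun v : V => (⟨Path.vertex G v, rfl⟩ : G.PathN 0)) :=
      ⟨fun v w h => congrArg (fun α : G.PathN 0 => α.1.src) h,
        fun α => ⟨α.1.src, Subtype.ext (Path.eq_vertex α.2).symm⟩⟩
    rw [← h0.sum_comp]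
    have h1 : ∀ v, G.pVert v * x * G.pVert v = x * G.pVert v := fun v => by
      rw [hx v, mul_assoc, pVert_mul_self]
    simp only [u_vertex, star_pVert, h1]
    rw [← Finset.mul_sum, sum_pVert, mul_one]
    rfl
  | succ k ih =>
    have hun : ∀ α : G.PathN (k + 1), ∃ (y : E × G.PathN k) (h : G.s y.1 = y.2.1.rng),
        α.1 = Path.cons y.1 y.2.1 h := by
      intro α
      obtain ⟨e, β, h, hα⟩ := Path.exists_cons (α := α.1) (by rw [α.2]; omega)
      refine ⟨(e, ⟨β, ?_⟩), h, hα⟩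
      have := α.2
      rw [hα, Path.cons_len] at this
      omega
    choose f hf hf' using hun
    rw [Function.iterate_succ_apply', ← ih, endo]
    simp only [Finset.mul_sum, Finset.sum_mul]
    rw [← Fintype.sum_prod_type' (f := fun (e : E) (μ : G.PathN k) =>
      G.uEdge e * (G.u μ.1 * x * star (G.u μ.1)) * star (G.uEdge e))]
    -- Paths of length `k + 1` are the composable pairs of an edge and a path of length `k`; pairs
    -- that are not composable contribute `0` because `u_e u_μ = 0`.
    refine Fintype.sum_of_injective f ?_ _ _ ?_ ?_
    · intro α β h
      refine Subtype.ext ?_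
      rw [hf' α, hf' β]
      simp only [h]
    · rintro ⟨e, μ⟩ h
      have hne : G.s e ≠ μ.1.rng := by
        intro he
        refine h ⟨⟨Path.cons e μ.1 he, by rw [Path.cons_len, μ.2]⟩, ?_⟩
        have := Path.cons_inj (h := he) (hf' ⟨Path.cons e μ.1 he, by rw [Path.cons_len, μ.2]⟩)
        exact Prod.ext this.1.symm (Subtype.ext this.2.symm)
      simp only [← mul_assoc, uEdge_mul_u_ne _ hne, zero_mul]
    · intro α
      conv_lhs => rw [hf' α]
      simp only [u_cons, star_mul, mul_assoc]

theorem endo_one : G.endo 1 = 1 := by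
  simp only [endo, mul_one, sum_uEdge]

theorem sum_u_mul_star_u (k : ℕ) : ∑ μ : G.PathN k, G.u μ.1 * star (G.u μ.1) = 1 := by
  have h := G.sum_pathN CommP.one k
  simp only [mul_one] at h
  rw [h]
  exact Function.iterate_fixed G.endo_one k

/-! ### The weight in the quotient -/

variable (Z : G.WeightSeq)

theorem commP_z : G.CommP (G.z Z) := fun v => by
  rw [z, pVert, ← map_mul, ← map_mul, weight_mul_P]

theorem z_mul_u_of_len (hA : G.ConditionA Z p) (β : G.PathN p) :
    G.z Z * G.u β.1 = G.u β.1 * G.z Z := by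
  have h := G.q_eq_zero (G.weight_commutator_mem Z hA β)
  rwa [map_sub, map_mul, map_mul, sub_eq_zero] at h

/-- `endo^p` conjugates by the paths of length `p`, with which `z` commutes, and their range
projections sum to `1`. -/
theorem endo_iterate_z (hA : G.ConditionA Z p) : G.endo^[p] (G.z Z) = G.z Z := by
  rw [← G.sum_pathN (G.commP_z Z)]
  simp only [← G.z_mul_u_of_len Z hA]
  simp only [mul_assoc]
  rw [← Finset.mul_sum, sum_u_mul_star_u, mul_one]

/-- The weights with `z u_α = u_α z_m` for `|α| = m`. -/
def zShift (p m : ℕ) : G.Calkin := G.endo^[(p - 1) * m] (G.z Z)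

theorem zShift_zero : G.zShift Z p 0 = G.z Z := rfl

theorem commP_zShift (m : ℕ) : G.CommP (G.zShift Z p m) :=
  G.commP_endo_iterate (G.commP_z Z) _

theorem endo_iterate_zShift (hA : G.ConditionA Z p) (m : ℕ) :
    G.endo^[p] (G.zShift Z p m) = G.zShift Z p m := by
  rw [zShift, ← Function.iterate_add_apply, add_comm, Function.iterate_add_apply,
    G.endo_iterate_z Z hA]

theorem endo_iterate_zShift_eq (m : ℕ) :
    G.endo^[p - 1] (G.zShift Z p m) = G.zShift Z p (m + 1) := by
  rw [zShift, zShift, ← Function.iterate_add_apply, mul_add, mul_one, add_comm]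

/-- Passing from `z_m` to `z_{m+1}` applies `endo^(p-1)`, which inverts `endo` on the orbit of `z`
since `endo^p` fixes it. So `z_m` behaves as `endo^(-m) z`. -/
theorem endo_zShift (hp : 1 ≤ p) (hA : G.ConditionA Z p) (m : ℕ) :
    G.endo (G.zShift Z p (m + 1)) = G.zShift Z p m := by
  rw [← endo_iterate_zShift_eq, ← Function.iterate_succ_apply' G.endo, Nat.succ_eq_add_one,
    Nat.sub_add_cancel hp, G.endo_iterate_zShift Z hA]

theorem zShift_mul_uEdge (hp : 1 ≤ p) (hA : G.ConditionA Z p) (m : ℕ) (e : E) :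
    G.zShift Z p m * G.uEdge e = G.uEdge e * G.zShift Z p (m + 1) := by
  rw [← G.endo_zShift Z hp hA, endo_mul_uEdge _ (G.commP_zShift Z _)]

theorem zShift_mul_u (hp : 1 ≤ p) (hA : G.ConditionA Z p) (m : ℕ) (α : G.Path) :
    G.zShift Z p m * G.u α = G.u α * G.zShift Z p (m + α.len) := by
  induction α using Path.cons_induction generalizing m with
  | vertex v => rw [u_vertex, ← G.commP_zShift Z m v]; rfl
  | cons e β h ih =>
    rw [u_cons, ← mul_assoc, G.zShift_mul_uEdge Z hp hA, mul_assoc, ih, ← mul_assoc, Path.cons_len]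
    congr 2
    omega

/-- Raising the index by `p` applies `endo^((p-1)p)`, that is, `p - 1` times `endo^p`. -/
theorem zShift_add_period (hA : G.ConditionA Z p) (m : ℕ) :
    G.zShift Z p (m + p) = G.zShift Z p m := by
  have : ∀ j, G.endo^[j * p] (G.zShift Z p m) = G.zShift Z p m := by
    intro j
    induction j with
    | zero => rw [zero_mul]; rfl
    | succ j ih => rw [add_mul, one_mul, Function.iterate_add_apply, G.endo_iterate_zShift Z hA, ih]
  rw [zShift, mul_add, add_comm, Function.iterate_add_apply]
  exact this (p - 1)

theorem star_z : star (G.z Z) = G.z Z := by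
  obtain ⟨ε, -, h⟩ := G.exists_weight_sub_isPositive Z
  have h1 : star (G.weight Z - (ε : ℂ) • 1 : G.L) = G.weight Z - (ε : ℂ) • 1 :=
    Subtype.ext h.isSelfAdjoint
  have h2 := congrArg G.q h1
  rw [star_sub, star_smul, star_one, map_sub, map_sub] at h2
  have h3 : star (ε : ℂ) = ε := Complex.conj_ofReal ε
  rw [h3, sub_left_inj, map_star] at h2
  exact h2

theorem star_zShift (m : ℕ) : star (G.zShift Z p m) = G.zShift Z p m := by
  rw [zShift, star_endo_iterate, star_z]

/-- The algebra generated by the weights `z_m`. -/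
def weightAlg (p : ℕ) : Subalgebra ℂ G.Calkin :=
  Algebra.adjoin ℂ (Set.range (G.zShift Z p))

variable {G Z}

theorem commP_of_mem_weightAlg {b : G.Calkin} (hb : b ∈ G.weightAlg Z p) : G.CommP b := by
  induction hb using Algebra.adjoin_induction with
  | mem x hx => obtain ⟨m, rfl⟩ := hx; exact G.commP_zShift Z m
  | algebraMap c => exact CommP.algebraMap c
  | add x y _ _ hx hy => exact hx.add hy
  | mul x y _ _ hx hy => exact hx.mul hy

theorem star_mem_weightAlg {b : G.Calkin} (hb : b ∈ G.weightAlg Z p) :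
    star b ∈ G.weightAlg Z p := by
  induction hb using Algebra.adjoin_induction with
  | mem x hx =>
    obtain ⟨m, rfl⟩ := hx
    rw [star_zShift]
    exact Algebra.subset_adjoin ⟨m, rfl⟩
  | algebraMap c =>
    rw [← algebraMap_star_comm]
    exact Subalgebra.algebraMap_mem _ _
  | add x y _ _ hx hy => rw [star_add]; exact add_mem hx hy
  | mul x y _ _ hx hy => rw [star_mul]; exact mul_mem hy hx

/-- On generators this is `z_m u_α = u_α z_{m+k}`, which extends to sums and products. The element
`b'` depends only on the length `k`, so it is common to all terms of a sum over `E^k`. -/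
theorem exists_mul_u_eq (hp : 1 ≤ p) (hA : G.ConditionA Z p) {b : G.Calkin}
    (hb : b ∈ G.weightAlg Z p) (k : ℕ) :
    ∃ b' ∈ G.weightAlg Z p, ∀ α : G.Path, α.len = k → b * G.u α = G.u α * b' := by
  induction hb using Algebra.adjoin_induction with
  | mem x hx =>
    obtain ⟨m, rfl⟩ := hx
    refine ⟨_, Algebra.subset_adjoin ⟨m + k, rfl⟩, ?_⟩
    rintro α rfl
    exact G.zShift_mul_u Z hp hA m α
  | algebraMap c => exact ⟨_, Subalgebra.algebraMap_mem _ c, fun α _ => Algebra.commutes c _⟩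
  | add x y _ _ hx hy =>
    obtain ⟨x', hx', hx⟩ := hx
    obtain ⟨y', hy', hy⟩ := hy
    exact ⟨x' + y', add_mem hx' hy', fun α hα => by rw [add_mul, mul_add, hx α hα, hy α hα]⟩
  | mul x y _ _ hx hy =>
    obtain ⟨x', hx', hx⟩ := hx
    obtain ⟨y', hy', hy⟩ := hy
    exact ⟨x' * y', mul_mem hx' hy', fun α hα => by
      rw [mul_assoc, hy α hα, ← mul_assoc, hx α hα, mul_assoc]⟩

theorem exists_star_u_mul_eq (hp : 1 ≤ p) (hA : G.ConditionA Z p) {b : G.Calkin}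
    (hb : b ∈ G.weightAlg Z p) (k : ℕ) :
    ∃ b' ∈ G.weightAlg Z p, ∀ α : G.Path, α.len = k → star (G.u α) * b = b' * star (G.u α) := by
  obtain ⟨b', hb', h⟩ := exists_mul_u_eq hp hA (star_mem_weightAlg hb) k
  refine ⟨star b', star_mem_weightAlg hb', fun α hα => ?_⟩
  have := congrArg star (h α hα)
  rwa [star_mul, star_star, star_mul] at this

variable (Z)

/-! ### The algebras `𝒞_n` -/

theorem gen_mem_C {n : ℕ} {α β : G.Path} (h₁ : n * p ≤ α.len) (h₂ : α.len = β.len)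
    (h₃ : α.len < (n + 1) * p) (h₄ : α.src = β.src) (l : ℕ) :
    G.u α * G.z Z ^ l * star (G.u β) ∈ G.C Z p n :=
  NonUnitalStarSubalgebra.le_topologicalClosure _
    (NonUnitalStarAlgebra.subset_adjoin ℂ _ ⟨α, β, l, h₁, h₂, h₃, h₄, rfl⟩)

theorem u_mul_star_u_mem_C {n : ℕ} {α β : G.Path} (h₁ : n * p ≤ α.len) (h₂ : α.len = β.len)
    (h₃ : α.len < (n + 1) * p) (h₄ : α.src = β.src) :
    G.u α * star (G.u β) ∈ G.C Z p n := by
  simpa using gen_mem_C Z h₁ h₂ h₃ h₄ 0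

theorem isClosed_C (n : ℕ) : IsClosed (G.C Z p n : Set G.Calkin) :=
  NonUnitalStarSubalgebra.isClosed_topologicalClosure _

variable {Z}

/-- For `m < p` write `γ₁ = αμ` with `|μ| = m`. Then `|α|` is still in the range admitted for `𝒞_n`,
and `u_γ₁ z_m = u_α z u_μ` exhibits the element as a product of two generators. Larger `m` reduce to
this case by periodicity. -/
theorem u_zShift_star_u_mem_C (hp : 1 ≤ p) (hA : G.ConditionA Z p) {n : ℕ} (γ₁ γ₂ : G.Gam p n)
    (hs : γ₁.1.src = γ₂.1.src) (m : ℕ) :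
    G.u γ₁.1 * G.zShift Z p m * star (G.u γ₂.1) ∈ G.C Z p n := by
  induction m using Nat.strong_induction_on with
  | _ m ih =>
    by_cases hm : m < p
    · obtain ⟨α, μ, h, hα, hγ⟩ := γ₁.1.exists_comp_eq (k := n * p + (p - 1) - m)
        (by rw [γ₁.2]; omega)
      have hμ : μ.len = m := by
        have := γ₁.2
        rw [hγ, Path.comp_len] at this
        omega
      have e : G.u γ₁.1 * G.zShift Z p m * star (G.u γ₂.1) =
          (G.u α * G.z Z ^ 1 * star (G.u α)) * (G.u γ₁.1 * star (G.u γ₂.1)) := by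
        have h1 : G.z Z * G.u μ = G.u μ * G.zShift Z p m := by
          have := G.zShift_mul_u Z hp hA 0 μ
          rwa [zShift_zero, zero_add, hμ] at this
        rw [hγ, pow_one]
        calc _ = G.u α * (G.u μ * G.zShift Z p m) * star (G.u γ₂.1) := by
              rw [u_comp]; simp only [mul_assoc]
          _ = G.u α * G.z Z * (star (G.u α) * G.u (α.comp μ h)) * star (G.u γ₂.1) := by
              rw [← h1, star_u_mul_u_comp]; simp only [mul_assoc]
          _ = _ := by simp only [mul_assoc]
      rw [e]
      refine mul_mem (gen_mem_C Z ?_ rfl ?_ rfl 1)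
        (u_mul_star_u_mem_C Z (le_len_Gam γ₁) (γ₁.2.trans γ₂.2.symm) (len_Gam_lt hp γ₁) hs)
      · rw [hα]; omega
      · rw [hα, add_mul]; omega
    · have := ih (m - p) (by omega)
      rwa [← G.zShift_add_period Z hA, Nat.sub_add_cancel (not_lt.1 hm)] at this

theorem u_mul_star_u_mem_C_of_mem_weightAlg (hp : 1 ≤ p) (hA : G.ConditionA Z p) {n : ℕ}
    {b : G.Calkin} (hb : b ∈ G.weightAlg Z p) (γ₁ γ₂ : G.Gam p n)
    (hs : γ₁.1.src = γ₂.1.src) :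
    G.u γ₁.1 * b * star (G.u γ₂.1) ∈ G.C Z p n := by
  induction hb using Algebra.adjoin_induction generalizing γ₁ γ₂ with
  | mem x hx =>
    obtain ⟨m, rfl⟩ := hx
    exact u_zShift_star_u_mem_C hp hA γ₁ γ₂ hs m
  | algebraMap c =>
    rw [← Algebra.commutes, mul_assoc, ← Algebra.smul_def]
    exact SMulMemClass.smul_mem c
      (u_mul_star_u_mem_C Z (le_len_Gam γ₁) (γ₁.2.trans γ₂.2.symm) (len_Gam_lt hp γ₁) hs)
  | add x y _ _ hx hy =>
    rw [mul_add, add_mul]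
    exact add_mem (hx γ₁ γ₂ hs) (hy γ₁ γ₂ hs)
  | mul x y hx' hy' hx hy =>
    -- The middle factor `u_γ₁^* u_γ₁` is a vertex projection; it commutes with `x` and is absorbed
    -- by `u_γ₁`.
    have e : G.u γ₁.1 * (x * y) * star (G.u γ₂.1) =
        (G.u γ₁.1 * x * star (G.u γ₁.1)) * (G.u γ₁.1 * y * star (G.u γ₂.1)) := by
      have h1 : (G.u γ₁.1 * x * star (G.u γ₁.1)) * (G.u γ₁.1 * y * star (G.u γ₂.1)) =
          G.u γ₁.1 * x * (star (G.u γ₁.1) * G.u γ₁.1) * y * star (G.u γ₂.1) := by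
        simp only [mul_assoc]
      rw [h1, star_u_mul_u, mul_assoc _ x (G.pVert _), ← commP_of_mem_weightAlg hx',
        ← mul_assoc (G.u γ₁.1) (G.pVert _), u_mul_pVert]
      simp only [mul_assoc]
    rw [e]
    exact mul_mem (hx γ₁ γ₁ rfl) (hy γ₁ γ₂ hs)

end
end DirGraph
end

noncomputable section
namespace DirGraph
open Ell2
variable {V E : Type*} {G : DirGraph V E} [Fintype V] {p : ℕ}

/-! ### The isomorphisms `τ_n` -/

/-- The initial segment of `γ` of length `|α|` either is `α` or has range orthogonal to that of
`u_α`. -/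
theorem star_u_mul_u_cases {γ α : G.Path} (h : α.len ≤ γ.len) :
    (∃ (μ : G.Path) (hμ : μ.rng = α.src), γ = α.comp μ hμ) ∨ star (G.u γ) * G.u α = 0 := by
  obtain ⟨α', μ, hμ, hα, hγ⟩ := γ.exists_comp_eq h
  by_cases e : α' = α
  · subst e
    exact Or.inl ⟨μ, hμ, hγ⟩
  · right
    rw [hγ, u_comp, star_mul, mul_assoc, star_u_mul_u_ne _ hα e, mul_zero]

/-- The path `ξ_v` as an element of `Γ_0`. -/
def PathChoice.gam (ξ : PathChoice G p) (v : V) : G.Gam p 0 :=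
  ⟨ξ.ξ v, by have := ξ.len_add_one v; omega⟩

section
variable (ξ : PathChoice G p)

theorem star_u_xi_mul (v : V) : star (G.u (ξ.ξ v)) * G.u (ξ.ξ v) = G.pVert v := by
  rw [star_u_mul_u, ξ.src_eq]

theorem u_xi_mul_pVert (v : V) : G.u (ξ.ξ v) * G.pVert v = G.u (ξ.ξ v) := by
  have := G.u_mul_pVert (ξ.ξ v)
  rwa [ξ.src_eq] at this

theorem u_xi_mul_star_mul (v : V) :
    G.u (ξ.ξ v) * star (G.u (ξ.ξ v)) * G.u (ξ.ξ v) = G.u (ξ.ξ v) := by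
  rw [mul_assoc, star_u_xi_mul, u_xi_mul_pVert]

theorem star_u_xi_mul_mul_star (v : V) :
    star (G.u (ξ.ξ v)) * (G.u (ξ.ξ v) * star (G.u (ξ.ξ v))) = star (G.u (ξ.ξ v)) := by
  have := congrArg star (u_xi_mul_star_mul ξ v)
  simpa only [star_mul, star_star] using this

end

variable [Fintype E] {Z : G.WeightSeq}

theorem z_mem_weightAlg : G.z Z ∈ G.weightAlg Z p := by
  rw [← G.zShift_zero Z (p := p)]
  exact Algebra.subset_adjoin ⟨0, rfl⟩

/-- If `α` and `β` are initial segments of `γ₁` and `γ₂`, stripping them leaves `u_μ₁^* b u_μ₂` with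
`|μ₁| = |μ₂|`. Pushing `b` to the right gives `u_μ₁^* u_μ₂ b'`, which vanishes unless `μ₁ = μ₂`, and
then the sources agree. -/
theorem star_u_mul_gen_mul_u (hp : 1 ≤ p) (hA : G.ConditionA Z p) {γ₁ γ₂ α β : G.Path}
    (h₁ : α.len ≤ γ₁.len) (h₂ : α.len = β.len) (hγ : γ₁.len = γ₂.len) {b : G.Calkin}
    (hb : b ∈ G.weightAlg Z p) :
    star (G.u γ₁) * (G.u α * b * star (G.u β)) * G.u γ₂ = 0 ∨ γ₁.src = γ₂.src ∧
      ∃ b' ∈ G.weightAlg Z p,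
        star (G.u γ₁) * (G.u α * b * star (G.u β)) * G.u γ₂ = G.pVert γ₁.src * b' := by
  have e : star (G.u γ₁) * (G.u α * b * star (G.u β)) * G.u γ₂ =
      (star (G.u γ₁) * G.u α) * b * (star (G.u β) * G.u γ₂) := by simp only [mul_assoc]
  rw [e]
  rcases star_u_mul_u_cases h₁ with ⟨μ₁, hμ₁, rfl⟩ | h
  · rcases star_u_mul_u_cases (G := G) (γ := γ₂) (α := β) (by omega) with ⟨μ₂, hμ₂, rfl⟩ | h'
    · have e1 := congrArg star (G.star_u_mul_u_comp α μ₁ hμ₁)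
      rw [star_mul, star_star] at e1
      rw [e1, star_u_mul_u_comp, mul_assoc]
      obtain ⟨b', hb', hbb⟩ := exists_mul_u_eq hp hA hb μ₂.len
      rw [hbb μ₂ rfl, ← mul_assoc]
      rw [Path.comp_len, Path.comp_len] at hγ
      by_cases hμ : μ₁ = μ₂
      · subst hμ
        exact Or.inr ⟨rfl, b', hb', by rw [star_u_mul_u]; rfl⟩
      · left
        rw [star_u_mul_u_ne _ (by omega) hμ, zero_mul]
    · left
      have := congrArg star h'
      rw [star_mul, star_star, star_zero] at this
      rw [this, mul_zero]
  · left
    rw [h, zero_mul, zero_mul]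

/-- The two claims are proved together because the product step of the second needs the first: after
inserting `1 = ∑ u_γ u_γ^*`, the terms with `s(γ) ≠ s(γ₁)` must vanish. The target level `m` and the
paths `η₁, η₂` are left free so that the lemma serves both `τ_n` (`m = 0`) and its inverse (from
level `0` to level `n`). -/
theorem corner_adjoin (hp : 1 ≤ p) (hA : G.ConditionA Z p) {n : ℕ} {c : G.Calkin}
    (hc : c ∈ NonUnitalStarAlgebra.adjoin ℂ {x | ∃ (α β : G.Path) (l : ℕ), n * p ≤ α.len ∧
      α.len = β.len ∧ α.len < (n + 1) * p ∧ α.src = β.src ∧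
      x = G.u α * G.z Z ^ l * star (G.u β)}) (γ₁ γ₂ : G.Gam p n) :
    (γ₁.1.src ≠ γ₂.1.src → star (G.u γ₁.1) * c * G.u γ₂.1 = 0) ∧
    (γ₁.1.src = γ₂.1.src → ∀ {m : ℕ} (η₁ η₂ : G.Gam p m), η₁.1.src = γ₁.1.src →
      η₂.1.src = γ₁.1.src →
      G.u η₁.1 * (star (G.u γ₁.1) * c * G.u γ₂.1) * star (G.u η₂.1) ∈ G.C Z p m) := by
  induction hc using NonUnitalStarAlgebra.adjoin_induction generalizing γ₁ γ₂ with
  | mem x hx =>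
    obtain ⟨α, β, l, -, h₂, h₃, -, rfl⟩ := hx
    have hlen : α.len ≤ γ₁.1.len := by
      rw [γ₁.2]
      rw [add_mul] at h₃
      omega
    rcases star_u_mul_gen_mul_u hp hA hlen h₂ (γ₁.2.trans γ₂.2.symm)
      (pow_mem (z_mem_weightAlg (Z := Z) (p := p)) l) with h | ⟨hs, b, hb, h⟩
    · refine ⟨fun _ => h, fun _ m η₁ η₂ _ _ => ?_⟩
      rw [h, mul_zero, zero_mul]
      exact zero_mem _
    · refine ⟨fun h' => absurd hs h', fun _ m η₁ η₂ h1 h2 => ?_⟩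
      rw [h, ← mul_assoc, ← h1, u_mul_pVert]
      exact u_mul_star_u_mem_C_of_mem_weightAlg hp hA hb η₁ η₂ (h1.trans h2.symm)
  | add x y _ _ hx hy =>
    refine ⟨fun h => ?_, fun h m η₁ η₂ h1 h2 => ?_⟩
    · rw [mul_add, add_mul, (hx γ₁ γ₂).1 h, (hy γ₁ γ₂).1 h, add_zero]
    · rw [mul_add, add_mul, mul_add, add_mul]
      exact add_mem ((hx γ₁ γ₂).2 h η₁ η₂ h1 h2) ((hy γ₁ γ₂).2 h η₁ η₂ h1 h2)
  | zero => simp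
  | mul x y _ _ hx hy =>
    have e : star (G.u γ₁.1) * (x * y) * G.u γ₂.1 = ∑ γ : G.Gam p n,
        (star (G.u γ₁.1) * x * G.u γ.1) * (star (G.u γ.1) * y * G.u γ₂.1) := by
      calc _ = star (G.u γ₁.1) * x * 1 * y * G.u γ₂.1 := by simp only [mul_assoc, one_mul]
        _ = _ := by
          rw [← G.sum_u_mul_star_u (n * p + (p - 1)), Finset.mul_sum, Finset.sum_mul,
            Finset.sum_mul]
          exact Finset.sum_congr rfl fun γ _ => by simp only [mul_assoc]
    rw [e]
    refine ⟨fun h => Finset.sum_eq_zero fun γ _ => ?_, fun h m η₁ η₂ h1 h2 => ?_⟩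
    · by_cases h' : γ₁.1.src = γ.1.src
      · rw [(hy γ γ₂).1 fun h'' => h (h'.trans h''), mul_zero]
      · rw [(hx γ₁ γ).1 h', zero_mul]
    · rw [Finset.mul_sum, Finset.sum_mul]
      refine sum_mem fun γ _ => ?_
      by_cases h' : γ₁.1.src = γ.1.src
      · have e2 : G.u η₁.1 * (star (G.u γ₁.1) * x * G.u γ.1 * (star (G.u γ.1) * y * G.u γ₂.1)) *
            star (G.u η₂.1) =
            (G.u η₁.1 * (star (G.u γ₁.1) * x * G.u γ.1) * star (G.u η₂.1)) *
              (G.u η₂.1 * (star (G.u γ.1) * y * G.u γ₂.1) * star (G.u η₂.1)) := by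
          -- `η₂` has the same source as `γ`, so its source projection can be inserted after `u_γ`;
          -- this splits the term into two elements of `𝒞_m`.
          have e3 : G.u γ.1 * (star (G.u η₂.1) * G.u η₂.1) = G.u γ.1 := by
            rw [star_u_mul_u, h2, h', u_mul_pVert]
          nth_rewrite 1 [← e3]
          simp only [mul_assoc]
        rw [e2]
        exact mul_mem ((hx γ₁ γ).2 h' η₁ η₂ h1 h2)
          ((hy γ γ₂).2 (h'.symm.trans h) η₂ η₂ (h2.trans h') (h2.trans h'))
      · rw [(hx γ₁ γ).1 h', zero_mul, mul_zero, zero_mul]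
        exact zero_mem _
  | smul r x _ hx =>
    refine ⟨fun h => ?_, fun h m η₁ η₂ h1 h2 => ?_⟩
    · rw [mul_smul_comm, smul_mul_assoc, (hx γ₁ γ₂).1 h, smul_zero]
    · rw [mul_smul_comm, smul_mul_assoc, mul_smul_comm, smul_mul_assoc]
      exact SMulMemClass.smul_mem r ((hx γ₁ γ₂).2 h η₁ η₂ h1 h2)
  | star x _ hx =>
    have e : star (G.u γ₁.1) * star x * G.u γ₂.1 = star (star (G.u γ₂.1) * x * G.u γ₁.1) := by
      simp only [star_mul, star_star, mul_assoc]
    rw [e]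
    refine ⟨fun h => ?_, fun h m η₁ η₂ h1 h2 => ?_⟩
    · rw [(hx γ₂ γ₁).1 (Ne.symm h), star_zero]
    · have := star_mem ((hx γ₂ γ₁).2 h.symm η₂ η₁ (h2.trans h) (h1.trans h))
      simpa only [star_mul, star_star, mul_assoc] using this

theorem star_u_mul_mul_u_eq_zero (hp : 1 ≤ p) (hA : G.ConditionA Z p) {n : ℕ} {c : G.Calkin}
    (hc : c ∈ G.C Z p n) {γ₁ γ₂ : G.Gam p n} (h : γ₁.1.src ≠ γ₂.1.src) :
    star (G.u γ₁.1) * c * G.u γ₂.1 = 0 :=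
  closure_minimal (t := {c | star (G.u γ₁.1) * c * G.u γ₂.1 = 0})
    (fun _ hx => (corner_adjoin hp hA hx γ₁ γ₂).1 h)
    (isClosed_eq (by fun_prop) continuous_const) hc

theorem corner_mem_C (hp : 1 ≤ p) (hA : G.ConditionA Z p) {n : ℕ} {c : G.Calkin}
    (hc : c ∈ G.C Z p n) {γ₁ γ₂ : G.Gam p n} (h : γ₁.1.src = γ₂.1.src) {m : ℕ}
    {η₁ η₂ : G.Gam p m} (h₁ : η₁.1.src = γ₁.1.src) (h₂ : η₂.1.src = γ₁.1.src) :
    G.u η₁.1 * (star (G.u γ₁.1) * c * G.u γ₂.1) * star (G.u η₂.1) ∈ G.C Z p m :=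
  closure_minimal
    (t := (fun c => G.u η₁.1 * (star (G.u γ₁.1) * c * G.u γ₂.1) * star (G.u η₂.1)) ⁻¹'
      (G.C Z p m : Set G.Calkin))
    (fun _ hx => (corner_adjoin hp hA hx γ₁ γ₂).2 h η₁ η₂ h₁ h₂)
    ((isClosed_C Z m).preimage (by fun_prop)) hc

variable (ξ : PathChoice G p)

variable {ξ} in
theorem proj_mul_mul_proj_of_mem_Cv {v : V} {b : G.Calkin} (hb : b ∈ G.Cv Z ξ v) :
    G.u (ξ.ξ v) * star (G.u (ξ.ξ v)) * b * (G.u (ξ.ξ v) * star (G.u (ξ.ξ v))) = b := by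
  obtain ⟨c, -, rfl⟩ := hb
  have h1 : G.u (ξ.ξ v) * star (G.u (ξ.ξ v)) * (G.u (ξ.ξ v) * star (G.u (ξ.ξ v))) =
      G.u (ξ.ξ v) * star (G.u (ξ.ξ v)) := by rw [← mul_assoc, u_xi_mul_star_mul]
  generalize G.u (ξ.ξ v) * star (G.u (ξ.ξ v)) = P at h1 ⊢
  calc _ = (P * P) * c * (P * P) := by simp only [mul_assoc]
    _ = _ := by rw [h1]

variable {ξ} in
theorem mem_C_of_mem_Cv {v : V} {b : G.Calkin} (hb : b ∈ G.Cv Z ξ v) : b ∈ G.C Z p 0 := by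
  obtain ⟨c, hc, rfl⟩ := hb
  exact mul_mem (mul_mem (u_mul_star_mem Z ξ v) hc) (u_mul_star_mem Z ξ v)

theorem tauFormula_apply (n : ℕ) (c : G.Calkin) (γ₁ γ₂ : G.Gam p n) [Decidable (γ₁.1.src = γ₂.1.src)] :
    G.tauFormula ξ n c γ₁ γ₂ = if γ₁.1.src = γ₂.1.src then
      G.u (ξ.ξ γ₁.1.src) * (star (G.u γ₁.1) * c * G.u γ₂.1) * star (G.u (ξ.ξ γ₁.1.src)) else 0 := by
  classical
  rw [tauFormula, Matrix.sum_apply, Finset.sum_eq_single γ₁, Matrix.sum_apply,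
    Finset.sum_eq_single γ₂]
  · by_cases h : γ₁.1.src = γ₂.1.src
    · rw [if_pos h, if_pos h, unit, Matrix.single_apply_same]
      simp only [mul_assoc]
    · rw [if_neg h, if_neg h, Matrix.zero_apply]
  · intro γ _ hγ
    split_ifs
    · exact Matrix.single_apply_of_ne _ _ _ _ _ fun h => hγ h.2
    · rfl
  · simp
  · intro γ _ hγ
    rw [Matrix.sum_apply]
    refine Finset.sum_eq_zero fun γ' _ => ?_
    split_ifs
    · exact Matrix.single_apply_of_ne _ _ _ _ _ fun h => hγ h.1
    · rfl
  · simp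

theorem tauFormula_mem (hp : 1 ≤ p) (hA : G.ConditionA Z p) {n : ℕ} {c : G.Calkin}
    (hc : c ∈ G.C Z p n) : G.tauFormula ξ n c ∈ G.A Z ξ n := by
  classical
  intro γ₁ γ₂
  rw [tauFormula_apply]
  refine ⟨fun h => ?_, fun h => if_neg h⟩
  rw [if_pos h]
  refine ⟨_, corner_mem_C hp hA hc h (η₁ := ξ.gam γ₁.1.src) (η₂ := ξ.gam γ₁.1.src)
    (ξ.src_eq _) (ξ.src_eq _), ?_⟩
  change _ = _ * (G.u (ξ.ξ γ₁.1.src) * _ * star (G.u (ξ.ξ γ₁.1.src))) * _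
  have h1 := u_xi_mul_star_mul ξ γ₁.1.src
  have h2 := star_u_xi_mul_mul_star ξ γ₁.1.src
  set U := G.u (ξ.ξ γ₁.1.src)
  calc U * (star (G.u γ₁.1) * c * G.u γ₂.1) * star U =
      (U * star U * U) * (star (G.u γ₁.1) * c * G.u γ₂.1) * (star U * (U * star U)) := by
        rw [h1, h2]
    _ = _ := by simp only [mul_assoc]

/-- Insert `1 = ∑ u_γ u_γ^*` between `c` and `d`. The terms with `s(γ) ≠ s(γ₁)`, which the matrix
product lacks, vanish since `c ∈ 𝒞_n`; in the others `u_ξ^* u_ξ` is the source projection of `γ`. -/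
theorem tauFormula_mul (hp : 1 ≤ p) (hA : G.ConditionA Z p) {n : ℕ} {c d : G.Calkin}
    (hc : c ∈ G.C Z p n) :
    G.tauFormula ξ n (c * d) = G.tauFormula ξ n c * G.tauFormula ξ n d := by
  classical
  ext γ₁ γ₂
  rw [Matrix.mul_apply, tauFormula_apply]
  simp only [tauFormula_apply]
  by_cases h : γ₁.1.src = γ₂.1.src
  · rw [if_pos h]
    have e : star (G.u γ₁.1) * (c * d) * G.u γ₂.1 = ∑ γ : G.Gam p n,
        (star (G.u γ₁.1) * c * G.u γ.1) * (star (G.u γ.1) * d * G.u γ₂.1) := by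
      calc _ = star (G.u γ₁.1) * c * 1 * d * G.u γ₂.1 := by simp only [mul_assoc, one_mul]
        _ = _ := by
          rw [← G.sum_u_mul_star_u (n * p + (p - 1)), Finset.mul_sum, Finset.sum_mul,
            Finset.sum_mul]
          exact Finset.sum_congr rfl fun γ _ => by simp only [mul_assoc]
    rw [e, Finset.mul_sum, Finset.sum_mul]
    refine Finset.sum_congr rfl fun γ _ => ?_
    by_cases h' : γ₁.1.src = γ.1.src
    · rw [if_pos h', if_pos (h'.symm.trans h), ← h']
      have e3 : G.u γ.1 * (star (G.u (ξ.ξ γ₁.1.src)) * G.u (ξ.ξ γ₁.1.src)) = G.u γ.1 := by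
        rw [star_u_xi_mul, h', u_mul_pVert]
      nth_rewrite 1 [← e3]
      simp only [mul_assoc]
    · rw [if_neg h', star_u_mul_mul_u_eq_zero hp hA hc h', zero_mul, zero_mul, mul_zero, zero_mul]
  · rw [if_neg h]
    symm
    refine Finset.sum_eq_zero fun γ _ => ?_
    by_cases h' : γ₁.1.src = γ.1.src
    · rw [if_neg (fun h'' => h (h'.trans h'')), mul_zero]
    · rw [if_neg h', zero_mul]

/-- `τ_n` as a `⋆`-homomorphism. -/
def tauHom (hp : 1 ≤ p) (hA : G.ConditionA Z p) (n : ℕ) : G.C Z p n →⋆ₙₐ[ℂ] G.A Z ξ n where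
  toFun c := ⟨G.tauFormula ξ n c.1, tauFormula_mem ξ hp hA c.2⟩
  map_smul' r c := by
    classical
    refine Subtype.ext (Matrix.ext fun γ₁ γ₂ => ?_)
    change G.tauFormula ξ n (r • c.1) γ₁ γ₂ = r • G.tauFormula ξ n c.1 γ₁ γ₂
    rw [tauFormula_apply, tauFormula_apply]
    split_ifs
    · rw [mul_smul_comm, smul_mul_assoc, mul_smul_comm, smul_mul_assoc]
    · rw [smul_zero]
  map_zero' := by
    classical
    refine Subtype.ext (Matrix.ext fun γ₁ γ₂ => ?_)
    change G.tauFormula ξ n 0 γ₁ γ₂ = 0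
    rw [tauFormula_apply]
    simp
  map_add' c d := by
    classical
    refine Subtype.ext (Matrix.ext fun γ₁ γ₂ => ?_)
    change G.tauFormula ξ n (c.1 + d.1) γ₁ γ₂ = G.tauFormula ξ n c.1 γ₁ γ₂ +
      G.tauFormula ξ n d.1 γ₁ γ₂
    rw [tauFormula_apply, tauFormula_apply, tauFormula_apply]
    split_ifs
    · rw [mul_add, add_mul, mul_add, add_mul]
    · rw [add_zero]
  map_mul' c d := Subtype.ext (tauFormula_mul ξ hp hA c.2)
  map_star' c := by
    classical
    refine Subtype.ext (Matrix.ext fun γ₁ γ₂ => ?_)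
    change G.tauFormula ξ n (star c.1) γ₁ γ₂ = star (G.tauFormula ξ n c.1 γ₂ γ₁)
    rw [tauFormula_apply, tauFormula_apply]
    by_cases h : γ₁.1.src = γ₂.1.src
    · rw [if_pos h, if_pos h.symm, h]
      simp only [star_mul, star_star, mul_assoc]
    · rw [if_neg h, if_neg (Ne.symm h), star_zero]

/-- Conjugating a matrix entry by `u_ξ` recovers `u_γ₁^* c u_γ₂`, and these corners determine `c`
because the projections `u_γ u_γ^*` sum to `1`. -/
theorem tauHom_injective (hp : 1 ≤ p) (hA : G.ConditionA Z p) (n : ℕ) :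
    Function.Injective (tauHom ξ hp hA n) := by
  classical
  rw [injective_iff_map_eq_zero]
  intro c hc
  have h0 : ∀ γ₁ γ₂ : G.Gam p n, star (G.u γ₁.1) * c.1 * G.u γ₂.1 = 0 := by
    intro γ₁ γ₂
    by_cases h : γ₁.1.src = γ₂.1.src
    · have h1 : G.tauFormula ξ n c.1 γ₁ γ₂ = 0 := congrFun (congrFun (congrArg Subtype.val hc) γ₁) γ₂
      rw [tauFormula_apply, if_pos h] at h1
      have h2 := congrArg (fun x => star (G.u (ξ.ξ γ₁.1.src)) * x * G.u (ξ.ξ γ₁.1.src)) h1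
      simp only [mul_zero, zero_mul] at h2
      have e1 : G.pVert γ₁.1.src * star (G.u γ₁.1) = star (G.u γ₁.1) := G.pVert_mul_star_u _
      have e2 : G.u γ₂.1 * G.pVert γ₁.1.src = G.u γ₂.1 := by rw [h, u_mul_pVert]
      rw [← e1, ← e2, ← star_u_xi_mul ξ, ← h2]
      simp only [mul_assoc]
    · exact star_u_mul_mul_u_eq_zero hp hA c.2 h
  refine Subtype.ext ?_
  calc c.1 = 1 * c.1 * 1 := by rw [one_mul, mul_one]
    _ = ∑ γ₁ : G.Gam p n, ∑ γ₂ : G.Gam p n,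
        G.u γ₁.1 * (star (G.u γ₁.1) * c.1 * G.u γ₂.1) * star (G.u γ₂.1) := by
      rw [← G.sum_u_mul_star_u (n * p + (p - 1)), Finset.sum_mul, Finset.sum_mul]
      refine Finset.sum_congr rfl fun γ₁ _ => ?_
      rw [Finset.mul_sum]
      exact Finset.sum_congr rfl fun γ₂ _ => by simp only [mul_assoc]
    _ = 0 := by simp only [h0, mul_zero, zero_mul, Finset.sum_const_zero]

/-- The corner of `b ∈ 𝒞_0` at `ξ_v` is moved to the paths `γ₁, γ₂` at level `n`. -/
theorem untau_mem (hp : 1 ≤ p) (hA : G.ConditionA Z p) {n : ℕ} (γ₁ γ₂ : G.Gam p n)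
    (hs : γ₁.1.src = γ₂.1.src) {b : G.Calkin} (hb : b ∈ G.Cv Z ξ γ₁.1.src) :
    G.u γ₁.1 * star (G.u (ξ.ξ γ₁.1.src)) * b * G.u (ξ.ξ γ₁.1.src) * star (G.u γ₂.1) ∈
      G.C Z p n := by
  have := corner_mem_C hp hA (mem_C_of_mem_Cv hb) (γ₁ := ξ.gam γ₁.1.src) (γ₂ := ξ.gam γ₁.1.src) rfl
    (η₁ := γ₁) (η₂ := γ₂) (ξ.src_eq _).symm (hs.symm.trans (ξ.src_eq _).symm)
  change G.u γ₁.1 * (star (G.u (ξ.ξ γ₁.1.src)) * b * G.u (ξ.ξ γ₁.1.src)) * star (G.u γ₂.1) ∈ _ at this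
  simpa only [mul_assoc] using this

theorem tauFormula_untau {n : ℕ} (γ₁ γ₂ : G.Gam p n) (hs : γ₁.1.src = γ₂.1.src) {b : G.Calkin}
    (hb : b ∈ G.Cv Z ξ γ₁.1.src) :
    G.tauFormula ξ n (G.u γ₁.1 * star (G.u (ξ.ξ γ₁.1.src)) * b * G.u (ξ.ξ γ₁.1.src) *
      star (G.u γ₂.1)) = G.unit γ₁ γ₂ b := by
  classical
  ext δ₁ δ₂
  rw [tauFormula_apply]
  have e : star (G.u δ₁.1) * (G.u γ₁.1 * star (G.u (ξ.ξ γ₁.1.src)) * b * G.u (ξ.ξ γ₁.1.src) *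
      star (G.u γ₂.1)) * G.u δ₂.1 = (star (G.u δ₁.1) * G.u γ₁.1) * star (G.u (ξ.ξ γ₁.1.src)) * b *
        G.u (ξ.ξ γ₁.1.src) * (star (G.u γ₂.1) * G.u δ₂.1) := by simp only [mul_assoc]
  rw [e, unit]
  by_cases h1 : δ₁ = γ₁
  · by_cases h2 : γ₂ = δ₂
    · subst h1 h2
      rw [if_pos hs, Matrix.single_apply_same, star_u_mul_u, star_u_mul_u, ← hs]
      have e1 := u_xi_mul_pVert ξ δ₁.1.src
      have e2 := congrArg star e1
      rw [star_mul, star_pVert] at e2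
      rw [e2, mul_assoc _ (G.u _) (G.pVert _), e1]
      -- What is left on the diagonal is `b` compressed by `u_ξ u_ξ^*`, which is `b` itself as `b`
      -- lies in that corner.
      conv_rhs => rw [← proj_mul_mul_proj_of_mem_Cv hb]
      simp only [mul_assoc]
    · rw [star_u_mul_u_ne _ (γ₂.2.trans δ₂.2.symm) (fun h => h2 (Subtype.ext h)),
        Matrix.single_apply_of_ne _ _ _ _ _ (fun h => h2 h.2)]
      simp
  · rw [star_u_mul_u_ne _ (δ₁.2.trans γ₁.2.symm) (fun h => h1 (Subtype.ext h)),
        Matrix.single_apply_of_ne _ _ _ _ _ (fun h => h1 h.1.symm)]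
    simp

theorem tauHom_surjective (hp : 1 ≤ p) (hA : G.ConditionA Z p) (n : ℕ) :
    Function.Surjective (tauHom ξ hp hA n) := by
  classical
  intro M
  have key : ∀ γ₁ γ₂ : G.Gam p n, ∃ c : G.C Z p n,
      (tauHom ξ hp hA n c).1 = Matrix.single γ₁ γ₂ (M.1 γ₁ γ₂) := by
    intro γ₁ γ₂
    by_cases h : γ₁.1.src = γ₂.1.src
    · exact ⟨⟨_, untau_mem ξ hp hA γ₁ γ₂ h ((M.2 γ₁ γ₂).1 h)⟩,
        tauFormula_untau ξ γ₁ γ₂ h ((M.2 γ₁ γ₂).1 h)⟩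
    · refine ⟨0, ?_⟩
      rw [(M.2 γ₁ γ₂).2 h, Matrix.single_zero, map_zero]
      rfl
  choose c hc using key
  refine ⟨∑ γ₁, ∑ γ₂, c γ₁ γ₂, Subtype.ext ?_⟩
  rw [map_sum, AddSubmonoidClass.coe_finsetSum]
  simp only [map_sum, AddSubmonoidClass.coe_finsetSum, hc]
  exact (Matrix.matrix_eq_sum_single M.1).symm

/-- `τ_n` as a `⋆`-isomorphism. -/
def tauEquiv (hp : 1 ≤ p) (hA : G.ConditionA Z p) (n : ℕ) : G.C Z p n ≃⋆ₐ[ℂ] G.A Z ξ n :=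
  StarAlgEquiv.ofBijective (tauHom ξ hp hA n)
    ⟨tauHom_injective ξ hp hA n, tauHom_surjective ξ hp hA n⟩

/-! ### The inclusions `𝒞_n ⊆ 𝒞_{n+1}` -/

theorem C_le_C_succ (hA : G.ConditionA Z p) (n : ℕ) : G.C Z p n ≤ G.C Z p (n + 1) := by
  refine NonUnitalStarSubalgebra.topologicalClosure_minimal _
    (NonUnitalStarAlgebra.adjoin_le ?_) (isClosed_C Z _)
  rintro _ ⟨α, β, l, h₁, h₂, h₃, h₄, rfl⟩
  have hz : ∀ ν : G.PathN p, G.z Z ^ l * G.u ν.1 = G.u ν.1 * G.z Z ^ l := fun ν =>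
    (Commute.pow_left (G.z_mul_u_of_len Z hA ν) l).eq
  -- Both paths are extended by all `ν` of length `p`; `z` passes through `u_ν`, so the summands are
  -- again generators, one level up.
  have e : G.u α * G.z Z ^ l * star (G.u β) =
      ∑ ν : G.PathN p, (G.u α * G.u ν.1) * G.z Z ^ l * star (G.u β * G.u ν.1) := by
    calc _ = G.u α * G.z Z ^ l * 1 * star (G.u β) := by rw [mul_one]
      _ = _ := by
        rw [← G.sum_u_mul_star_u p, Finset.mul_sum, Finset.sum_mul]
        refine Finset.sum_congr rfl fun ν _ => ?_
        rw [star_mul, mul_assoc (G.u α) (G.u ν.1), ← hz]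
        simp only [mul_assoc]
  rw [SetLike.mem_coe, e]
  refine sum_mem fun ν _ => ?_
  by_cases h : ν.1.rng = α.src
  · rw [← u_comp _ _ _ h, ← u_comp _ _ _ (h.trans h₄)]
    refine gen_mem_C (n := n + 1) Z ?_ ?_ ?_ ?_ l
    · rw [Path.comp_len, ν.2, add_mul, one_mul]
      exact Nat.add_le_add_right h₁ p
    · rw [Path.comp_len, Path.comp_len, h₂]
    · rw [Path.comp_len, ν.2, add_mul _ 1, one_mul]
      exact Nat.add_lt_add_right h₃ p
    · rw [Path.comp_src, Path.comp_src]
  · rw [u_mul_u_ne _ (Ne.symm h), zero_mul, zero_mul]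
    exact zero_mem _

end DirGraph
end

/-! ### Averages over roots of unity -/

noncomputable section

/-- The average of `g_j x g_j^*` over `j < N`. -/
def conjAvg {A : Type*} [Ring A] [StarRing A] [Algebra ℂ A] (g : ℕ → A) (N : ℕ) : A →ₗ[ℂ] A :=
  (N : ℂ)⁻¹ • ∑ j ∈ Finset.range N, LinearMap.mulLeftRight ℂ (g j, star (g j))

theorem conjAvg_apply {A : Type*} [Ring A] [StarRing A] [Algebra ℂ A] (g : ℕ → A) (N : ℕ) (x : A) :
    conjAvg g N x = (N : ℂ)⁻¹ • ∑ j ∈ Finset.range N, g j * x * star (g j) := by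
  simp [conjAvg, LinearMap.sum_apply]

theorem conjAvg_eq_self {A : Type*} [Ring A] [StarRing A] [Algebra ℂ A] {g : ℕ → A} {N : ℕ}
    (hN : 0 < N) {x : A} (h : ∀ j, g j * x * star (g j) = x) : conjAvg g N x = x := by
  have hN' : (N : ℂ) ≠ 0 := by exact_mod_cast hN.ne'
  rw [conjAvg_apply, Finset.sum_congr rfl fun j _ => h j, Finset.sum_const, Finset.card_range,
    ← Nat.cast_smul_eq_nsmul ℂ, smul_smul, inv_mul_cancel₀ hN', one_smul]

theorem norm_conjAvg_le {A : Type*} [CStarAlgebra A] {g : ℕ → A} (hg : ∀ j, ‖g j‖ ≤ 1) (N : ℕ)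
    (x : A) : ‖conjAvg g N x‖ ≤ ‖x‖ := by
  have h1 : ‖∑ j ∈ Finset.range N, g j * x * star (g j)‖ ≤ N * ‖x‖ := by
    have := norm_sum_le_of_le (Finset.range N) (f := fun j => g j * x * star (g j))
      (n := fun _ => ‖x‖) fun j _ => ?_
    · simpa using this
    · calc ‖g j * x * star (g j)‖ ≤ ‖g j‖ * ‖x‖ * ‖star (g j)‖ :=
            (norm_mul_le _ _).trans (by gcongr; exact norm_mul_le _ _)
        _ ≤ 1 * ‖x‖ * 1 := by
            rw [norm_star]
            gcongr <;> exact hg j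
        _ = ‖x‖ := by ring
  rw [conjAvg_apply, norm_smul, norm_inv, Complex.norm_natCast]
  rcases Nat.eq_zero_or_pos N with rfl | hN
  · simp
  · rw [inv_mul_le_iff₀ (by exact_mod_cast hN)]
    exact h1

/-- A geometric sum with ratio `ω = exp(2πid/N)`: `ω^N = 1`, while `ω ≠ 1` because `0 < |d| < N`. -/
theorem sum_exp_eq_zero {N : ℕ} {d : ℤ} (hd : d ≠ 0) (hN : d.natAbs < N) :
    ∑ j ∈ Finset.range N, Complex.exp (Complex.I * d * (2 * Real.pi * j / N : ℝ)) = 0 := by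
  have hN0 : (N : ℂ) ≠ 0 := by
    have : N ≠ 0 := by omega
    exact_mod_cast this
  set ω := Complex.exp (2 * Real.pi * Complex.I * (d / N))
  have h1 : ∀ j : ℕ, Complex.exp (Complex.I * d * (2 * Real.pi * j / N : ℝ)) = ω ^ j := by
    intro j
    rw [← Complex.exp_nat_mul]
    congr 1
    push_cast
    ring
  have h2 : ω ^ N = 1 := by
    rw [← Complex.exp_nat_mul, Complex.exp_eq_one_iff]
    exact ⟨d, by field_simp⟩
  have h3 : ω ≠ 1 := by
    intro h
    rw [Complex.exp_eq_one_iff] at h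
    obtain ⟨n, hn⟩ := h
    have hpi : (2 * Real.pi * Complex.I : ℂ) ≠ 0 := Complex.two_pi_I_ne_zero
    rw [mul_comm (n : ℂ)] at hn
    have h4 := mul_left_cancel₀ hpi hn
    rw [div_eq_iff hN0] at h4
    have h5 : d = n * N := by exact_mod_cast h4
    rw [h5, Int.natAbs_mul, Int.natAbs_natCast] at hN
    have h6 : n.natAbs ≠ 0 := by
      intro h
      rw [Int.natAbs_eq_zero] at h
      exact hd (by rw [h5, h, zero_mul])
    have := Nat.le_mul_of_pos_left N (Nat.pos_of_ne_zero h6)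
    omega
  simp only [h1]
  rw [geom_sum_eq h3, h2, sub_self, zero_div]

namespace DirGraph
open Ell2
variable {V E : Type*} {G : DirGraph V E} [Fintype V]

theorem norm_gauge_le (t : ℝ) : ‖G.gauge t‖ ≤ 1 := by
  have h1 : ‖G.gauge t‖ * ‖G.gauge t‖ = ‖(1 : G.L)‖ := by
    rw [← CStarRing.norm_star_mul_self, star_gauge_mul]
  have h2 : ‖(1 : G.L)‖ ≤ 1 := ContinuousLinearMap.norm_id_le
  nlinarith [norm_nonneg (G.gauge t)]

theorem norm_q_le (T : G.L) : ‖G.q T‖ ≤ ‖T‖ := NonUnitalStarAlgHom.norm_apply_le G.q T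

theorem q_conjAvg (g : ℕ → G.L) (N : ℕ) (T : G.L) :
    G.q (conjAvg g N T) = conjAvg (fun j => G.q (g j)) N (G.q T) := by
  rw [conjAvg_apply, conjAvg_apply, map_smul, map_sum]
  simp only [map_mul, map_star]

/-! ### Homogeneous polynomials in the quotient -/

variable [Fintype E] {p : ℕ}

variable (G) in
/-- The gauge unitaries at the multiples of `2π/N`. -/
def gaugeRoot (N j : ℕ) : G.L := G.gauge (2 * Real.pi * j / N)

variable (Z : G.WeightSeq)

variable (G p) in
/-- The span of the elements `u_α b u_β^*` with `|α| - |β| = d` and `b` in the weight algebra. -/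
def degreePart (d : ℤ) : Submodule ℂ G.Calkin :=
  Submodule.span ℂ {x | ∃ (α β : G.Path) (b : G.Calkin), b ∈ G.weightAlg Z p ∧
    (α.len : ℤ) = β.len + d ∧ x = G.u α * b * star (G.u β)}

variable {Z}

/-- In `u_β^* u_α'` the shorter path is an initial segment of the longer one, or the product is `0`.
The remainder `u_μ` or `u_μ^*` is pushed through the adjacent weight and joined to the outer path.
-/
theorem mul_mem_degreePart (hp : 1 ≤ p) (hA : G.ConditionA Z p) {d e : ℤ} {x y : G.Calkin}
    (hx : x ∈ G.degreePart p Z d) (hy : y ∈ G.degreePart p Z e) :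
    x * y ∈ G.degreePart p Z (d + e) := by
  have key : G.degreePart p Z d * G.degreePart p Z e ≤ G.degreePart p Z (d + e) := by
    rw [degreePart, degreePart, Submodule.span_mul_span, Submodule.span_le]
    rintro _ ⟨_, ⟨α, β, b, hb, hl, rfl⟩, _, ⟨α', β', b', hb', hl', rfl⟩, rfl⟩
    simp only [SetLike.mem_coe]
    have e1 : G.u α * b * star (G.u β) * (G.u α' * b' * star (G.u β')) =
        G.u α * b * (star (G.u β) * G.u α') * b' * star (G.u β') := by simp only [mul_assoc]
    rw [e1]
    rcases le_total α'.len β.len with h | h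
    · rcases star_u_mul_u_cases h with ⟨μ, hμ, rfl⟩ | h0
      · have e2 := congrArg star (G.star_u_mul_u_comp α' μ hμ)
        rw [star_mul, star_star] at e2
        obtain ⟨b'', hb'', h2⟩ := exists_star_u_mul_eq hp hA hb' μ.len
        have e3 : G.u α * b * star (G.u μ) * b' * star (G.u β') =
            G.u α * (b * b'') * star (G.u β' * G.u μ) := by
          rw [mul_assoc _ _ b', h2 μ rfl, star_mul]
          simp only [mul_assoc]
        rw [e2, e3]
        by_cases hμ' : μ.rng = β'.src
        · rw [← u_comp _ _ _ hμ']
          refine Submodule.subset_span ⟨_, _, _, mul_mem hb hb'', ?_, rfl⟩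
          rw [Path.comp_len] at hl ⊢
          push_cast at hl ⊢
          omega
        · rw [u_mul_u_ne _ (Ne.symm hμ'), star_zero, mul_zero]
          exact zero_mem _
      · rw [h0, mul_zero, zero_mul, zero_mul]
        exact zero_mem _
    · rcases star_u_mul_u_cases h with ⟨μ, hμ, rfl⟩ | h0
      · rw [star_u_mul_u_comp]
        obtain ⟨b'', hb'', h2⟩ := exists_mul_u_eq hp hA hb μ.len
        have e3 : G.u α * b * G.u μ * b' * star (G.u β') =
            (G.u α * G.u μ) * (b'' * b') * star (G.u β') := by
          rw [mul_assoc (G.u α) b, h2 μ rfl]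
          simp only [mul_assoc]
        rw [e3]
        by_cases hμ' : μ.rng = α.src
        · rw [← u_comp _ _ _ hμ']
          refine Submodule.subset_span ⟨_, _, _, mul_mem hb'' hb', ?_, rfl⟩
          rw [Path.comp_len] at hl' ⊢
          push_cast at hl' ⊢
          omega
        · rw [u_mul_u_ne _ (Ne.symm hμ'), zero_mul, zero_mul]
          exact zero_mem _
      · have h1 := congrArg star h0
        rw [star_mul, star_star, star_zero] at h1
        rw [h1, mul_zero, zero_mul, zero_mul]
        exact zero_mem _
  exact key (Submodule.mul_mem_mul hx hy)

theorem star_mem_degreePart {d : ℤ} {x : G.Calkin} (hx : x ∈ G.degreePart p Z d) :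
    star x ∈ G.degreePart p Z (-d) := by
  induction hx using Submodule.span_induction with
  | mem x h =>
    obtain ⟨α, β, b, hb, hl, rfl⟩ := h
    refine Submodule.subset_span ⟨β, α, star b, star_mem_weightAlg hb, by omega, ?_⟩
    simp only [star_mul, star_star, mul_assoc]
  | zero => rw [star_zero]; exact zero_mem _
  | add x y _ _ hx hy => rw [star_add]; exact add_mem hx hy
  | smul c x _ hx => rw [star_smul]; exact Submodule.smul_mem _ _ hx

/-- Two paths of equal length and equal source are extended by common paths `ν` until both lie in
`Γ_n`; there every weight, and not only powers of `z`, is admitted. -/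
theorem exists_mem_C_of_mem_degreePart (hp : 1 ≤ p) (hA : G.ConditionA Z p) {x : G.Calkin}
    (hx : x ∈ G.degreePart p Z 0) : ∃ n, x ∈ G.C Z p n := by
  have hmono : Monotone (G.C Z p) := monotone_nat_of_le_succ (C_le_C_succ hA)
  induction hx using Submodule.span_induction with
  | mem x h =>
    obtain ⟨α, β, b, hb, hl, rfl⟩ := h
    have hl' : α.len = β.len := by omega
    -- Any level with `|α| ≤ np + (p-1)` would do; `n = |α|` works because `p ≥ 1`.
    refine ⟨α.len, ?_⟩
    by_cases hs : α.src = β.src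
    · obtain ⟨b', hb', h⟩ := exists_mul_u_eq hp hA hb (α.len * p + (p - 1) - α.len)
      have hle : α.len ≤ α.len * p := Nat.le_mul_of_pos_right _ hp
      have e : G.u α * b * star (G.u β) = ∑ ν : G.PathN (α.len * p + (p - 1) - α.len),
          (G.u α * G.u ν.1) * b' * star (G.u β * G.u ν.1) := by
        calc _ = G.u α * b * 1 * star (G.u β) := by rw [mul_one]
          _ = _ := by
            rw [← G.sum_u_mul_star_u (α.len * p + (p - 1) - α.len), Finset.mul_sum,
              Finset.sum_mul]
            refine Finset.sum_congr rfl fun ν _ => ?_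
            rw [star_mul, mul_assoc (G.u α) (G.u ν.1), ← h ν.1 ν.2]
            simp only [mul_assoc]
      rw [e]
      refine sum_mem fun ν _ => ?_
      by_cases hν : ν.1.rng = α.src
      · rw [← u_comp _ _ _ hν, ← u_comp _ _ _ (hν.trans hs)]
        refine u_mul_star_u_mem_C_of_mem_weightAlg hp hA hb'
          ⟨α.comp ν.1 hν, ?_⟩ ⟨β.comp ν.1 (hν.trans hs), ?_⟩ ?_
        · rw [Path.comp_len, ν.2]; omega
        · rw [Path.comp_len, ν.2]; omega
        · rw [Path.comp_src, Path.comp_src]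
      · rw [u_mul_u_ne _ (Ne.symm hν), zero_mul, zero_mul]
        exact zero_mem _
    · have : G.u α * b * star (G.u β) = 0 := by
        rw [← u_mul_pVert, mul_assoc (G.u α), commP_of_mem_weightAlg hb, ← mul_assoc, mul_assoc,
          ← pVert_mul_star_u, ← mul_assoc (G.pVert _), pVert_mul_ne _ hs, zero_mul, mul_zero]
      rw [this]
      exact zero_mem _
  | zero => exact ⟨0, zero_mem _⟩
  | add x y _ _ hx hy =>
    obtain ⟨n, hn⟩ := hx
    obtain ⟨m, hm⟩ := hy
    exact ⟨max n m, add_mem (hmono (le_max_left _ _) hn) (hmono (le_max_right _ _) hm)⟩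
  | smul c x _ hx =>
    obtain ⟨n, hn⟩ := hx
    exact ⟨n, SMulMemClass.smul_mem c hn⟩

/-! ### Homogeneous elements of the Toeplitz algebra -/

variable (G p Z) in
/-- Elements of degree `d` in the Toeplitz algebra whose image in the quotient is a polynomial. -/
def homPart (d : ℤ) : Submodule ℂ G.L where
  carrier := {T | T ∈ G.toeplitz Z ∧
    (∀ t : ℝ, G.gauge t * T * star (G.gauge t) = Complex.exp (Complex.I * d * t) • T) ∧
    G.q T ∈ G.degreePart p Z d}
  zero_mem' := ⟨zero_mem _, fun t => by simp, by rw [map_zero]; exact zero_mem _⟩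
  add_mem' {S T} hS hT := ⟨add_mem hS.1 hT.1, fun t => by
    rw [mul_add, add_mul, hS.2.1, hT.2.1, smul_add], by
    rw [map_add]; exact add_mem hS.2.2 hT.2.2⟩
  smul_mem' c T hT := ⟨SMulMemClass.smul_mem c hT.1, fun t => by
    rw [mul_smul_comm, smul_mul_assoc, hT.2.1, smul_comm], by
    rw [map_smul]; exact Submodule.smul_mem _ _ hT.2.2⟩

theorem mul_mem_homPart (hp : 1 ≤ p) (hA : G.ConditionA Z p) {d e : ℤ} {S T : G.L}
    (hS : S ∈ G.homPart p Z d) (hT : T ∈ G.homPart p Z e) : S * T ∈ G.homPart p Z (d + e) := by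
  refine ⟨mul_mem hS.1 hT.1, fun t => ?_, ?_⟩
  · calc _ = (G.gauge t * S * 1 * T * star (G.gauge t)) := by simp only [mul_assoc, one_mul]
      _ = (G.gauge t * S * star (G.gauge t)) * (G.gauge t * T * star (G.gauge t)) := by
        rw [← G.star_gauge_mul t]; simp only [mul_assoc]
      _ = _ := by
        rw [hS.2.1, hT.2.1, smul_mul_smul_comm, ← Complex.exp_add]
        congr 2
        push_cast
        ring
  · rw [map_mul]
    exact mul_mem_degreePart hp hA hS.2.2 hT.2.2

theorem star_mem_homPart {d : ℤ} {T : G.L} (hT : T ∈ G.homPart p Z d) :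
    star T ∈ G.homPart p Z (-d) := by
  refine ⟨star_mem hT.1, fun t => ?_, ?_⟩
  · have := congrArg star (hT.2.1 t)
    simp only [star_mul, star_star, star_smul] at this
    rw [mul_assoc, this]
    congr 1
    simp [← Complex.exp_conj]
  · rw [map_star]
    exact star_mem_degreePart hT.2.2

theorem weight_mul_S_mem_homPart (hp : 1 ≤ p) (hA : G.ConditionA Z p) (e : E) :
    G.weight Z * G.S e ∈ G.homPart p Z 1 := by
  refine ⟨NonUnitalStarSubalgebra.le_topologicalClosure _
    (NonUnitalStarAlgebra.subset_adjoin ℂ _ ⟨e, rfl⟩), fun t => ?_, ?_⟩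
  · rw [← mul_assoc, gauge_mul_weight, mul_assoc (G.weight Z), gauge_mul_S, mul_smul_comm,
      smul_mul_assoc, mul_assoc, mul_assoc, gauge_mul_star, mul_one]
    congr 2
    push_cast
    ring
  · have h1 := G.zShift_mul_uEdge Z hp hA 0 e
    rw [zShift_zero] at h1
    have h2 : G.q (G.weight Z * G.S e) = G.z Z * G.uEdge e := by rw [map_mul]; rfl
    rw [h2, h1]
    -- `q(Z S_e) = u_e z_1`, written with the edge path on the left and the vertex `s(e)` as the
    -- path of length `0` on the right.
    refine Submodule.subset_span ⟨Path.cons e (Path.vertex G (G.s e)) (Path.vertex_rng _).symm,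
      Path.vertex G (G.s e), G.zShift Z p (0 + 1), Algebra.subset_adjoin ⟨_, rfl⟩, ?_, ?_⟩
    · simp
    · rw [u_cons, u_vertex, star_pVert, mul_assoc, ← G.commP_zShift Z, uEdge_mul_pVert,
        ← mul_assoc, uEdge_mul_pVert]

/-- The generators have degree `1`, degrees add under products and change sign under adjoints, so
polynomials split into homogeneous parts. -/
theorem adjoin_le_iSup_homPart (hp : 1 ≤ p) (hA : G.ConditionA Z p) {T : G.L}
    (hT : T ∈ NonUnitalStarAlgebra.adjoin ℂ {T | ∃ e : E, T = G.weight Z * G.S e}) :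
    T ∈ ⨆ d, G.homPart p Z d := by
  induction hT using NonUnitalStarAlgebra.adjoin_induction with
  | mem x h =>
    obtain ⟨e, rfl⟩ := h
    exact Submodule.mem_iSup_of_mem 1 (weight_mul_S_mem_homPart hp hA e)
  | add x y _ _ hx hy => exact add_mem hx hy
  | zero => exact zero_mem _
  | mul x y _ _ hx hy =>
    have h := Submodule.mul_mem_mul hx hy
    rw [Submodule.iSup_mul] at h
    refine (iSup_le fun d => ?_ : _ ≤ ⨆ d, G.homPart p Z d) h
    rw [Submodule.mul_iSup]
    refine iSup_le fun e => Submodule.mul_le.2 fun S hS T hT => ?_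
    exact Submodule.mem_iSup_of_mem _ (mul_mem_homPart hp hA hS hT)
  | smul r x _ hx => exact Submodule.smul_mem _ r hx
  | star x hx' hx =>
    clear hx'
    induction hx using Submodule.iSup_induction' with
    | mem d x hx => exact Submodule.mem_iSup_of_mem _ (star_mem_homPart hx)
    | zero => rw [star_zero]; exact zero_mem _
    | add x y _ _ hx hy => rw [star_add]; exact add_mem hx hy

theorem conjAvg_of_mem_homPart {d : ℤ} {N : ℕ} (hd : d ≠ 0) (hN : d.natAbs < N) {T : G.L}
    (hT : T ∈ G.homPart p Z d) : conjAvg (G.gaugeRoot N) N T = 0 := by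
  rw [conjAvg_apply]
  have : ∀ j, G.gaugeRoot N j * T * star (G.gaugeRoot N j) =
      Complex.exp (Complex.I * d * (2 * Real.pi * j / N : ℝ)) • T := fun j => hT.2.1 _
  simp only [this]
  rw [← Finset.sum_smul, sum_exp_eq_zero hd hN, zero_smul, smul_zero]

theorem mem_fixedAlg_of_mem_homPart {T : G.L} (hT : T ∈ G.homPart p Z 0) : T ∈ G.fixedAlg Z :=
  ⟨hT.1, fun t => by simpa using hT.2.1 t⟩

/-! ### Approximation of gauge-invariant elements by elements of degree zero -/

theorem exists_conjAvg_sub_lt (hp : 1 ≤ p) (hA : G.ConditionA Z p) {T : G.L}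
    (hT : T ∈ G.toeplitz Z) {ε : ℝ} (hε : 0 < ε) :
    ∃ T₀ ∈ G.homPart p Z 0, ∃ N > 0, ‖conjAvg (G.gaugeRoot N) N T - T₀‖ < ε := by
  obtain ⟨T', hT', hd⟩ := Metric.mem_closure_iff.1 hT ε hε
  obtain ⟨f, hf, hsum⟩ := (Submodule.mem_iSup_iff_exists_finsupp _ _).1
    (adjoin_le_iSup_homPart hp hA hT')
  -- `N` exceeds every `|d|` occurring in the approximating polynomial, so averaging over the `N`-th
  -- roots of unity leaves exactly its part of degree `0`.
  refine ⟨f 0, hf 0, (∑ d ∈ f.support, d.natAbs) + 1, Nat.succ_pos _, ?_⟩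
  set N := (∑ d ∈ f.support, d.natAbs) + 1
  have h1 : conjAvg (G.gaugeRoot N) N T' = f 0 := by
    rw [← hsum, Finsupp.sum, map_sum, Finset.sum_eq_single 0]
    · exact conjAvg_eq_self (Nat.succ_pos _)
        fun j => (mem_fixedAlg_of_mem_homPart (hf 0)).2 _
    · intro d hd hd0
      refine conjAvg_of_mem_homPart hd0 ?_ (hf d)
      exact Nat.lt_succ_of_le (Finset.single_le_sum (f := Int.natAbs) (fun _ _ => Nat.zero_le _) hd)
    · intro h
      rw [Finsupp.notMem_support_iff.1 h, map_zero]
  rw [← h1, ← map_sub]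
  refine (norm_conjAvg_le (fun j => norm_gauge_le _) N _).trans_lt ?_
  rwa [← dist_eq_norm]

/-- Averaging fixes a gauge-invariant `T`, so `T` itself is close to the degree-zero part of a
polynomial, whose image lies in some `𝒞_n`. -/
theorem qD_subset_closure (hp : 1 ≤ p) (hA : G.ConditionA Z p) :
    (G.qD Z : Set G.Calkin) ⊆ closure (⋃ n, (G.C Z p n : Set G.Calkin)) := by
  rintro _ ⟨T, hT, rfl⟩
  refine Metric.mem_closure_iff.2 fun ε hε => ?_
  obtain ⟨T₀, hT₀, N, hN, h⟩ := exists_conjAvg_sub_lt hp hA hT.1 hε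
  rw [conjAvg_eq_self (g := G.gaugeRoot N) hN fun j => hT.2 _] at h
  refine ⟨G.q T₀, Set.mem_iUnion.2 (exists_mem_C_of_mem_degreePart hp hA hT₀.2.2), ?_⟩
  rw [dist_eq_norm]
  change ‖G.q T - G.q T₀‖ < ε
  rw [← map_sub]
  exact (norm_q_le _).trans_lt h

/-- Gauge invariant elements of the closure of the image of the Toeplitz algebra are in the
closure of the image of the fixed point algebra. -/
theorem mem_closure_qD (hp : 1 ≤ p) (hA : G.ConditionA Z p) {x : G.Calkin}
    (hx : x ∈ closure (G.q '' (G.toeplitz Z : Set G.L)))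
    (hg : ∀ t, G.q (G.gauge t) * x * star (G.q (G.gauge t)) = x) :
    x ∈ closure (G.qD Z : Set G.Calkin) := by
  refine Metric.mem_closure_iff.2 fun ε hε => ?_
  obtain ⟨_, ⟨T, hT, rfl⟩, hd⟩ := Metric.mem_closure_iff.1 hx (ε / 2) (half_pos hε)
  obtain ⟨T₀, hT₀, N, hN, h⟩ := exists_conjAvg_sub_lt hp hA hT (half_pos hε)
  refine ⟨G.q T₀, ⟨T₀, mem_fixedAlg_of_mem_homPart hT₀, rfl⟩, ?_⟩
  -- The average taken in the quotient fixes `x` and is contractive, so the average of `T` is as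
  -- close to `x` as `T` is.
  have h1 : ‖x - G.q (conjAvg (G.gaugeRoot N) N T)‖ < ε / 2 := by
    rw [q_conjAvg, ← conjAvg_eq_self (g := fun j => G.q (G.gaugeRoot N j)) hN fun j => hg _,
      ← map_sub]
    refine (norm_conjAvg_le (fun j => (norm_q_le _).trans (norm_gauge_le _)) N _).trans_lt ?_
    rwa [← dist_eq_norm]
  have h2 : ‖G.q (conjAvg (G.gaugeRoot N) N T) - G.q T₀‖ < ε / 2 := by
    rw [← map_sub]
    exact (norm_q_le _).trans_lt h
  calc dist x (G.q T₀) ≤ ‖x - G.q (conjAvg (G.gaugeRoot N) N T)‖ +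
        ‖G.q (conjAvg (G.gaugeRoot N) N T) - G.q T₀‖ := by
        rw [dist_eq_norm]; exact norm_sub_le_norm_sub_add_norm_sub _ _ _
    _ < ε := by linarith

end DirGraph
end

noncomputable section

/-! ### Ranges of `⋆`-homomorphisms -/

section
variable {A B : Type*} [NonUnitalCStarAlgebra A] [NonUnitalCStarAlgebra B]

/-- Truncate `a` at `±‖φ a‖` by functional calculus. This commutes with `φ`, and it does not change
`φ a`, whose spectrum is already within these bounds. -/
theorem NonUnitalStarAlgHom.exists_lift_selfAdjoint (φ : A →⋆ₙₐ[ℂ] B) {a : A}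
    (ha : IsSelfAdjoint a) : ∃ b, φ b = φ a ∧ ‖b‖ ≤ ‖φ a‖ := by
  set r := ‖φ a‖
  have hr : 0 ≤ r := norm_nonneg _
  let f : ℝ → ℝ := fun t => max (-r) (min t r)
  have hf : Continuous f := by fun_prop
  have hf0 : f 0 = 0 := by simp [f, hr]
  have hφa : IsSelfAdjoint (φ a) := ha.map φ
  have hφ : Continuous φ := (AddMonoidHomClass.lipschitz_of_bound φ 1 fun x => by
    simpa using NonUnitalStarAlgHom.norm_apply_le φ x).continuous
  refine ⟨cfcₙ f a, ?_, ?_⟩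
  · rw [NonUnitalStarAlgHom.map_cfcₙ φ f a hf.continuousOn hf0 hφ ha hφa]
    conv_rhs => rw [← cfcₙ_id ℝ (φ a) hφa]
    refine cfcₙ_congr fun x hx => ?_
    have h1 : ‖x‖ ≤ r := by
      simpa only [cfcₙ_id ℝ (φ a)] using! norm_apply_le_norm_cfcₙ (id : ℝ → ℝ) (φ a) hx
    rw [Real.norm_eq_abs, abs_le] at h1
    simp only [f, id]
    rw [min_eq_left h1.2, max_eq_right h1.1]
  · refine norm_cfcₙ_le fun x _ => ?_
    rw [Real.norm_eq_abs, abs_le]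
    exact ⟨le_max_left _ _, max_le (by linarith) (min_le_right _ _)⟩

theorem NonUnitalStarAlgHom.exists_lift (φ : A →⋆ₙₐ[ℂ] B) (a : A) :
    ∃ b, φ b = φ a ∧ ‖b‖ ≤ 2 * ‖φ a‖ := by
  obtain ⟨b₁, h₁, h₁'⟩ := φ.exists_lift_selfAdjoint (realPart a).2
  obtain ⟨b₂, h₂, h₂'⟩ := φ.exists_lift_selfAdjoint (imaginaryPart a).2
  have hsm : ∀ x : A, φ ((2⁻¹ : ℝ) • x) = (2⁻¹ : ℝ) • φ x := fun x => by
    rw [← Complex.coe_smul, map_smul, Complex.coe_smul]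
  have e1 : φ (realPart a : A) = (realPart (φ a) : B) := by
    rw [realPart_apply_coe, realPart_apply_coe, hsm, map_add, map_star]
  have e2 : φ (imaginaryPart a : A) = (imaginaryPart (φ a) : B) := by
    rw [imaginaryPart_apply_coe, imaginaryPart_apply_coe, map_smul, hsm, map_sub, map_star]
  refine ⟨b₁ + Complex.I • b₂, ?_, ?_⟩
  · rw [map_add, map_smul, h₁, h₂, ← map_smul, ← map_add, realPart_add_I_smul_imaginaryPart]
  · rw [e1] at h₁'
    rw [e2] at h₂'
    have := norm_add_le b₁ (Complex.I • b₂)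
    rw [norm_smul, Complex.norm_I, one_mul] at this
    have h3 : ‖(realPart (φ a) : B)‖ ≤ ‖φ a‖ := realPart.norm_le (φ a)
    have h4 : ‖(imaginaryPart (φ a) : B)‖ ≤ ‖φ a‖ := imaginaryPart.norm_le (φ a)
    linarith

/-- Every element of the range has a lift of at most twice its norm, so by completeness of `A`
limits of elements of the range lift as well. -/
theorem NonUnitalStarAlgHom.isClosed_range (φ : A →⋆ₙₐ[ℂ] B) : IsClosed (Set.range φ) := by
  let f : NormedAddGroupHom A B := AddMonoidHom.mkNormedAddGroupHom (φ : A →+ B) 1 fun x => by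
    simpa using NonUnitalStarAlgHom.norm_apply_le φ x
  have hf : f.SurjectiveOnWith f.range 2 := by
    rintro _ ⟨a, rfl⟩
    exact φ.exists_lift a
  have h := controlled_closure_of_complete two_pos one_pos hf
  refine isClosed_of_closure_subset fun x hx => ?_
  obtain ⟨a, ha, -⟩ := h x hx
  exact ⟨a, ha⟩

end

/-! ### Inverses of positive elements -/

/-- The inverse of `y` is the function `t ↦ 1/√t` of `y * y`. As `S` need not contain the unit, this
function is replaced by a continuous one that vanishes at `0` and agrees with it on the spectrum of
`y * y`, which lies above `ε²`. -/
theorem exists_inverse_mem {A : Type*} [CStarAlgebra A] [PartialOrder A] [StarOrderedRing A]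
    (S : NonUnitalStarSubalgebra ℂ A) (hS : IsClosed (S : Set A)) {y : A} {ε : ℝ} (hε : 0 < ε)
    (hy : algebraMap ℝ A ε ≤ y) (hyS : y * y ∈ S) : ∃ w ∈ S, y * w = 1 := by
  have hsa : IsSelfAdjoint y := by
    have h1 : IsSelfAdjoint (y - algebraMap ℝ A ε) := IsSelfAdjoint.of_nonneg (sub_nonneg.2 hy)
    have h2 : IsSelfAdjoint (algebraMap ℝ A ε) := IsSelfAdjoint.algebraMap A (.all ε)
    simpa using h1.add h2
  have hspec : ∀ x ∈ spectrum ℝ y, ε ≤ x := (algebraMap_le_iff_le_spectrum hsa).1 hy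
  let δ := ε ^ 2
  have hδ : 0 < δ := by positivity
  -- For `t ≥ δ` this is `1/√t`. The numerator `t` gives `g 0 = 0`, and the maxima keep the
  -- denominator positive everywhere.
  let g : ℝ → ℝ := fun t => t / (max t δ * Real.sqrt (max t δ))
  have hpos : ∀ t, 0 < max t δ := fun t => lt_max_of_lt_right hδ
  have hg : Continuous g := by
    refine continuous_id.div (by fun_prop) fun t => ?_
    have := hpos t
    positivity
  have : IsClosed (S : Set A) := hS
  refine ⟨cfcₙ g (y * y), cfcₙ_mem (𝕜' := ℂ) g hyS, ?_⟩
  have e1 : y * y = cfc (fun t : ℝ => t * t) y := by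
    rw [cfc_mul (fun t : ℝ => t) (fun t : ℝ => t) y, cfc_id' ℝ y]
  rw [cfcₙ_eq_cfc (hf := hg.continuousOn) (hf0 := by simp [g]), e1,
    ← cfc_comp' g (fun t : ℝ => t * t) y (hg := hg.continuousOn)]
  nth_rewrite 1 [← cfc_id' ℝ y]
  rw [← cfc_mul (fun t : ℝ => t) (fun t : ℝ => g (t * t)) y (by fun_prop)
    (hg.comp (by fun_prop)).continuousOn]
  rw [← cfc_one ℝ y]
  refine cfc_congr fun t ht => ?_
  have h1 := hspec t ht
  have h2 : δ ≤ t * t := by simp only [δ]; nlinarith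
  have ht0 : 0 < t := lt_of_lt_of_le hε h1
  simp only [g, Pi.one_apply]
  rw [max_eq_left h2, Real.sqrt_mul_self ht0.le]
  field_simp

/-! ### Direct limits -/

/-- A compatible family of `⋆`-homomorphisms on an increasing sequence of C⋆-subalgebras extends
uniquely to the closure of the union. -/
theorem existsUnique_extension {Q : Type*} [NonUnitalCStarAlgebra Q]
    (C : ℕ → NonUnitalStarSubalgebra ℂ Q) (D : NonUnitalStarSubalgebra ℂ Q)
    (hC : ∀ n, IsClosed (C n : Set Q)) (hD : IsClosed (D : Set Q))
    (hle : ∀ n, C n ≤ C (n + 1)) (hCD : ∀ n, C n ≤ D)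
    (hdense : (D : Set Q) ⊆ closure (⋃ n, (C n : Set Q)))
    (B : Type w) [NonUnitalCStarAlgebra B] (φ : ∀ n, C n →⋆ₙₐ[ℂ] B)
    (hφ : ∀ n c, φ (n + 1) (NonUnitalStarSubalgebra.inclusion (hle n) c) = φ n c) :
    ∃! Φ : D →⋆ₙₐ[ℂ] B, ∀ n c, Φ (NonUnitalStarSubalgebra.inclusion (hCD n) c) = φ n c := by
  have := hD
  have := hC
  have hmono : Monotone C := monotone_nat_of_le_succ hle
  have hnm : ∀ {n m : ℕ}, n ≤ m → ∀ (x : Q) (hn : x ∈ C n) (hm : x ∈ C m),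
      φ m ⟨x, hm⟩ = φ n ⟨x, hn⟩ := by
    intro n m h
    induction h with
    | refl => intro x _ _; rfl
    | step h ih =>
      intro x hn hm
      rw [← ih x hn (hmono h hn)]
      exact hφ _ ⟨x, hmono h hn⟩
  -- The union of the `C n`, on which the maps `φ n` glue together since any two levels can be
  -- compared at their maximum.
  let M : Submodule ℂ D :=
    { carrier := {d | ∃ n, d.1 ∈ C n}
      add_mem' := by
        rintro a b ⟨n, hn⟩ ⟨m, hm⟩
        exact ⟨max n m, add_mem (hmono (le_max_left _ _) hn) (hmono (le_max_right _ _) hm)⟩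
      zero_mem' := ⟨0, zero_mem _⟩
      smul_mem' := by
        rintro c a ⟨n, hn⟩
        exact ⟨n, SMulMemClass.smul_mem c hn⟩ }
  have hM : ∀ d : M, ∃ n, d.1.1 ∈ C n := fun d => d.2
  choose N hN using hM
  have hval : ∀ (d : M) (n : ℕ) (hn : d.1.1 ∈ C n), φ (N d) ⟨d.1.1, hN d⟩ = φ n ⟨d.1.1, hn⟩ := by
    intro d n hn
    rw [← hnm (le_max_left (N d) n) _ _ (hmono (le_max_left _ _) (hN d)),
      ← hnm (le_max_right (N d) n) _ hn (hmono (le_max_left _ _) (hN d))]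
  let f : M →ₗ[ℂ] B :=
    { toFun := fun d => φ (N d) ⟨d.1.1, hN d⟩
      map_add' := by
        intro a b
        have ha := hmono (le_max_left (N a) (N b)) (hN a)
        have hb := hmono (le_max_right (N a) (N b)) (hN b)
        rw [hval a _ ha, hval b _ hb, hval (a + b) _ (add_mem ha hb), ← map_add]
        rfl
      map_smul' := by
        intro c a
        rw [hval (c • a) (N a) (SMulMemClass.smul_mem c (hN a)), RingHom.id_apply, ← map_smul]
        rfl }
  have hf : ∀ (d : M) (n : ℕ) (hn : d.1.1 ∈ C n), f d = φ n ⟨d.1.1, hn⟩ := hval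
  have hdr : DenseRange M.subtype := by
    intro d
    rw [Submodule.coe_subtype, Subtype.range_coe, Topology.IsInducing.subtypeVal.closure_eq_preimage_closure_image]
    refine closure_mono ?_ (hdense d.2)
    intro x hx
    obtain ⟨n, hn⟩ := Set.mem_iUnion.1 hx
    exact ⟨⟨x, hCD n hn⟩, ⟨n, hn⟩, rfl⟩
  have hbound : ∀ d : M, ‖f d‖ ≤ 1 * ‖M.subtype d‖ := by
    intro d
    rw [one_mul]
    exact NonUnitalStarAlgHom.norm_apply_le (φ (N d)) ⟨d.1.1, hN d⟩
  -- `⋆`-homomorphisms between C⋆-algebras are contractive, so the glued map is bounded and extends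
  -- by continuity; multiplicativity and compatibility with the involution then pass to the closure.
  let F : D →L[ℂ] B := f.extendOfNorm M.subtype
  have hF : ∀ d : M, F d.1 = f d := LinearMap.extendOfNorm_eq hdr ⟨1, hbound⟩
  refine ⟨{ toFun := F
            map_smul' := fun c x => map_smul F c x
            map_zero' := map_zero F
            map_add' := map_add F
            map_mul' := ?_
            map_star' := ?_ }, ?_, ?_⟩
  · refine hdr.induction_on₂ (p := fun a b : D => F (a * b) = F a * F b)
      (isClosed_eq (by fun_prop) (by fun_prop)) fun a b => ?_
    have ha := hmono (le_max_left (N a) (N b)) (hN a)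
    have hb := hmono (le_max_right (N a) (N b)) (hN b)
    have hab : a.1 * b.1 ∈ M := ⟨_, mul_mem ha hb⟩
    change F (a.1 * b.1) = F a.1 * F b.1
    rw [hF a, hF b, hF ⟨a.1 * b.1, hab⟩, hf a _ ha, hf b _ hb, hf ⟨a.1 * b.1, hab⟩ _ (mul_mem ha hb),
      ← map_mul]
    rfl
  · refine fun d => hdr.induction_on (p := fun a : D => F (star a) = star (F a)) d
      (isClosed_eq (by fun_prop) (by fun_prop)) fun a => ?_
    have ha : star a.1 ∈ M := ⟨_, star_mem (hN a)⟩
    change F (star a.1) = star (F a.1)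
    rw [hF a, hF ⟨star a.1, ha⟩, hf a _ (hN a), hf ⟨star a.1, ha⟩ _ (star_mem (hN a)), ← map_star]
    rfl
  · intro n c
    have hc : NonUnitalStarSubalgebra.inclusion (hCD n) c ∈ M := ⟨n, c.2⟩
    exact (hF ⟨_, hc⟩).trans (hf ⟨_, hc⟩ n c.2)
  · intro Φ hΦ
    have hcont : Continuous Φ := (AddMonoidHomClass.lipschitz_of_bound Φ 1 fun x => by
      simpa using NonUnitalStarAlgHom.norm_apply_le Φ x).continuous
    refine NonUnitalStarAlgHom.ext fun d => ?_
    refine hdr.induction_on (p := fun a : D => Φ a = F a) d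
      (isClosed_eq hcont (by fun_prop)) fun a => ?_
    change Φ a.1 = F a.1
    rw [hF a, hf a _ (hN a)]
    exact hΦ (N a) ⟨a.1.1, hN a⟩

end

/-! ### Square roots, the direct limit property and the gauge action in the quotient -/

noncomputable section
/-- A positive operator in a closed star subalgebra is `star r * r` for some `r` in it. -/
theorem ContinuousLinearMap.IsPositive.exists_star_mul_self_mem {H : Type*} [NormedAddCommGroup H]
    [InnerProductSpace ℂ H] [CompleteSpace H] (S : StarSubalgebra ℂ (H →L[ℂ] H))
    (hS : IsClosed (S : Set (H →L[ℂ] H))) {a : H →L[ℂ] H} (h : a.IsPositive) (ha : a ∈ S) :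
    ∃ r ∈ S, star r * r = a := by
  have h0 : 0 ≤ a := (ContinuousLinearMap.nonneg_iff_isPositive _).2 h
  have hsa : IsSelfAdjoint a := IsSelfAdjoint.of_nonneg h0
  refine ⟨cfc Real.sqrt a, cfc_mem (𝕜' := ℂ) Real.sqrt ha, ?_⟩
  have h1 : IsSelfAdjoint (cfc Real.sqrt a) := cfc_predicate _ _
  rw [h1.star_eq, ← cfc_mul Real.sqrt Real.sqrt a]
  conv_rhs => rw [← cfc_id' ℝ a]
  exact cfc_congr fun x hx => Real.mul_self_sqrt (spectrum_nonneg_of_nonneg h0 hx)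

/-- A closed algebra in which the union of an increasing sequence of closed subalgebras is dense is
the direct limit of any sequence of algebras isomorphic to these subalgebras. -/
theorem IsCStarDirectLimit.of_dense {Q : Type*} [NonUnitalCStarAlgebra Q]
    (C : ℕ → NonUnitalStarSubalgebra ℂ Q) (D : NonUnitalStarSubalgebra ℂ Q)
    (hC : ∀ n, IsClosed (C n : Set Q)) (hD : IsClosed (D : Set Q))
    (hle : ∀ n, C n ≤ C (n + 1)) (hCD : ∀ n, C n ≤ D)
    (hdense : (D : Set Q) ⊆ closure (⋃ n, (C n : Set Q)))
    {A : ℕ → Type*} [∀ n, NonUnitalRing (A n)] [∀ n, StarRing (A n)] [∀ n, Module ℂ (A n)]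
    (τ : ∀ n, C n ≃⋆ₐ[ℂ] A n) :
    IsCStarDirectLimit.{w}
      (fun n => (τ (n + 1) : C (n + 1) →⋆ₙₐ[ℂ] A (n + 1)).comp
        ((NonUnitalStarSubalgebra.inclusion (hle n)).comp ((τ n).symm : A n →⋆ₙₐ[ℂ] C n)))
      (fun n => (NonUnitalStarSubalgebra.inclusion (hCD n)).comp
        ((τ n).symm : A n →⋆ₙₐ[ℂ] C n)) := by
  refine ⟨fun n a => ?_, fun B _ φ hφ => ?_⟩
  · refine Subtype.ext ?_
    change ((τ (n + 1)).symm (τ (n + 1) _)).1 = _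
    rw [StarAlgEquiv.symm_apply_apply]
    rfl
  · obtain ⟨Φ, hΦ, huniq⟩ := existsUnique_extension C D hC hD hle hCD hdense B
      (fun n => (φ n).comp (τ n : C n →⋆ₙₐ[ℂ] A n)) (fun n c => by
        refine Eq.trans ?_ (hφ n (τ n c))
        change φ (n + 1) (τ (n + 1) _) = φ (n + 1) (τ (n + 1)
          (NonUnitalStarSubalgebra.inclusion (hle n) ((τ n).symm (τ n c))))
        rw [StarAlgEquiv.symm_apply_apply])
    refine ⟨Φ, fun n a => ?_, fun Ψ hΨ => huniq Ψ fun n c => ?_⟩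
    · refine (hΦ n ((τ n).symm a)).trans ?_
      change φ n (τ n ((τ n).symm a)) = _
      rw [StarAlgEquiv.apply_symm_apply]
    · refine Eq.trans ?_ (hΨ n (τ n c))
      change Ψ _ = Ψ (NonUnitalStarSubalgebra.inclusion (hCD n) ((τ n).symm (τ n c)))
      rw [StarAlgEquiv.symm_apply_apply]

namespace DirGraph
open Ell2
variable {V E : Type*} {G : DirGraph V E} [Fintype V]

theorem q_gauge_mul_u (t : ℝ) (α : G.Path) : G.q (G.gauge t) * G.u α =
    Complex.exp (Complex.I * α.len * t) • (G.u α * G.q (G.gauge t)) := by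
  induction α using Path.cons_induction with
  | vertex v =>
    have h : G.gauge t * G.P v = G.P v * G.gauge t := by
      refine G.ext_L fun x α => ?_
      change (G.gauge t).1 ((G.P v).1 x) α = (G.P v).1 ((G.gauge t).1 x) α
      rw [gauge_apply, P_apply, P_apply, gauge_apply]
      split_ifs <;> simp
    rw [u_vertex, pVert, ← map_mul, h, map_mul, Path.vertex_len]
    simp
  | cons e β he ih =>
    have h := congrArg G.q (G.gauge_mul_S t e)
    rw [map_mul, map_smul, map_mul] at h
    change G.q (G.gauge t) * G.uEdge e = _ • (G.uEdge e * _) at h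
    rw [u_cons, ← mul_assoc, h, smul_mul_assoc, mul_assoc, ih, mul_smul_comm, smul_smul,
      ← Complex.exp_add, Path.cons_len, mul_assoc (G.uEdge e)]
    congr 2
    push_cast
    ring

theorem q_gauge_mul_star (t : ℝ) : G.q (G.gauge t) * star (G.q (G.gauge t)) = 1 := by
  rw [← map_star, ← map_mul, gauge_mul_star, map_one]

variable [Fintype E] {Z : G.WeightSeq} {p : ℕ}

/-! ### The image of the fixed point algebra -/

theorem isClosed_fixedAlg : IsClosed (G.fixedAlg Z : Set G.L) := by
  have : (G.fixedAlg Z : Set G.L) = (G.toeplitz Z : Set G.L) ∩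
      ⋂ t : ℝ, {T | G.gauge t * T * star (G.gauge t) = T} := by
    ext T
    simp only [Set.mem_inter_iff, Set.mem_iInter]
    rfl
  rw [this]
  refine (NonUnitalStarSubalgebra.isClosed_topologicalClosure _).inter
    (isClosed_iInter fun t => isClosed_eq ?_ continuous_id)
  exact (continuous_const.mul continuous_id).mul continuous_const

/-- `q(𝒟)` is the range of a `⋆`-homomorphism on the C⋆-algebra `𝒟`. -/
theorem isClosed_qD : IsClosed (G.qD Z : Set G.Calkin) := by
  have := isClosed_fixedAlg (Z := Z)
  have h := NonUnitalStarAlgHom.isClosed_range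
    (G.q.toNonUnitalStarAlgHom.comp (NonUnitalStarSubalgebraClass.subtype (G.fixedAlg Z)))
  convert h using 1
  ext x
  constructor
  · rintro ⟨T, hT, rfl⟩
    exact ⟨⟨T, hT⟩, rfl⟩
  · rintro ⟨T, rfl⟩
    exact ⟨T.1, T.2, rfl⟩

/-- Positivity is recorded as `star s * s` because this form passes through `q`. For that the square
root of `Z - ε` must be adjointable, not merely bounded on the Hilbert space. -/
theorem exists_z_sub_eq (Z : G.WeightSeq) :
    ∃ ε : ℝ, 0 < ε ∧ ∃ s : G.Calkin, G.z Z - algebraMap ℝ G.Calkin ε = star s * s := by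
  obtain ⟨ε, hε, h⟩ := G.exists_weight_sub_isPositive Z
  refine ⟨ε, hε, ?_⟩
  set T : G.L := G.weight Z - (ε : ℂ) • 1
  obtain ⟨r, hr, hrT⟩ := h.exists_star_mul_self_mem G.L inferInstance T.2
  let R : G.L := ⟨r, hr⟩
  have hR : star R * R = T := Subtype.ext hrT
  refine ⟨G.q R, ?_⟩
  rw [← map_star, ← map_mul, hR, map_sub, map_smul, map_one]
  congr 1

/-- `endo` is positive and unital, so it preserves scalar lower bounds. -/
theorem algebraMap_le_zShift [PartialOrder G.Calkin] [StarOrderedRing G.Calkin] {ε : ℝ}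
    (h : algebraMap ℝ G.Calkin ε ≤ G.z Z) (m : ℕ) :
    algebraMap ℝ G.Calkin ε ≤ G.zShift Z p m := by
  rw [zShift]
  generalize (p - 1) * m = k
  induction k with
  | zero => exact h
  | succ k ih =>
    rw [Function.iterate_succ_apply', ← sub_nonneg]
    have e : G.endo (G.endo^[k] (G.z Z)) - algebraMap ℝ G.Calkin ε =
        G.endo (G.endo^[k] (G.z Z) - algebraMap ℝ G.Calkin ε) := by
      have h1 : algebraMap ℝ G.Calkin ε = G.endo (algebraMap ℝ G.Calkin ε) := by
        conv_lhs => rw [← mul_one (algebraMap ℝ G.Calkin ε), ← G.sum_uEdge, Finset.mul_sum]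
        rw [endo]
        refine Finset.sum_congr rfl fun e _ => ?_
        rw [← mul_assoc, Algebra.commutes]
      conv_lhs => rw [h1]
      rw [endo, endo, endo, ← Finset.sum_sub_distrib]
      exact Finset.sum_congr rfl fun e _ => by rw [mul_sub, sub_mul]
    rw [e, endo]
    exact Finset.sum_nonneg fun e _ => star_right_conjugate_nonneg (sub_nonneg.2 ih) _

variable (G Z) in
/-- The closure of the image of the Toeplitz algebra. -/
def qToeplitz : NonUnitalStarSubalgebra ℂ G.Calkin :=
  ((G.toeplitz Z).map G.q.toNonUnitalStarAlgHom).topologicalClosure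

theorem isClosed_qToeplitz : IsClosed (G.qToeplitz Z : Set G.Calkin) :=
  NonUnitalStarSubalgebra.isClosed_topologicalClosure _

theorem z_mul_uEdge_mem (e : E) : G.z Z * G.uEdge e ∈ G.qToeplitz Z := by
  refine NonUnitalStarSubalgebra.le_topologicalClosure _ ⟨G.weight Z * G.S e, ?_, ?_⟩
  · exact NonUnitalStarSubalgebra.le_topologicalClosure _
      (NonUnitalStarAlgebra.subset_adjoin ℂ _ ⟨e, rfl⟩)
  · exact map_mul G.q _ _

/-- The available elements are `z u_e = u_e z_1`, and `(z u_e)^* (z u_e) = z_1 p_{s(e)} z_1`.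
Choosing one edge out of every vertex, which is where the absence of sinks enters, these sum to
`z_1²`; the lower bound on `z_1` then gives its inverse. -/
theorem exists_inverse_mem_qToeplitz (no_sinks : ∀ v, ∃ e, G.s e = v) (hp : 1 ≤ p)
    (hA : G.ConditionA Z p) :
    G.zShift Z p 1 * G.zShift Z p 1 ∈ G.qToeplitz Z ∧
    ∃ w ∈ G.qToeplitz Z, G.zShift Z p 1 * w = 1 := by
  choose e he using no_sinks
  set y := G.zShift Z p 1
  have h1 : ∀ f, G.z Z * G.uEdge f = G.uEdge f * y := fun f => by
    have := G.zShift_mul_uEdge Z hp hA 0 f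
    rwa [zShift_zero] at this
  have hy2 : y * y ∈ G.qToeplitz Z := by
    have h2 : y * y = ∑ v, star (G.z Z * G.uEdge (e v)) * (G.z Z * G.uEdge (e v)) := by
      have h3 : ∀ v, star (G.z Z * G.uEdge (e v)) * (G.z Z * G.uEdge (e v)) =
          y * G.pVert v * y := by
        intro v
        rw [h1, star_mul, star_zShift, mul_assoc, ← mul_assoc (star _), star_uEdge_mul_uEdge, he,
          mul_assoc]
      simp only [h3]
      rw [← Finset.sum_mul, ← Finset.mul_sum, sum_pVert, mul_one]
    rw [h2]
    exact sum_mem fun v _ => mul_mem (star_mem (z_mul_uEdge_mem _)) (z_mul_uEdge_mem _)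
  refine ⟨hy2, ?_⟩
  let : PartialOrder G.Calkin := CStarAlgebra.spectralOrder G.Calkin
  have : StarOrderedRing G.Calkin := CStarAlgebra.spectralOrderedRing G.Calkin
  obtain ⟨ε, hε, s, hs⟩ := exists_z_sub_eq Z
  have hz : algebraMap ℝ G.Calkin ε ≤ G.z Z := by
    rw [← sub_nonneg, hs]
    exact star_mul_self_nonneg s
  exact exists_inverse_mem _ isClosed_qToeplitz hε (algebraMap_le_zShift hz 1) hy2

/-- The closure of the image of the Toeplitz algebra contains the unit, `z` and all `u_α`. -/
theorem generators_mem_qToeplitz (no_sinks : ∀ v, ∃ e, G.s e = v) (hp : 1 ≤ p)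
    (hA : G.ConditionA Z p) :
    1 ∈ G.qToeplitz Z ∧ G.z Z ∈ G.qToeplitz Z ∧ ∀ α, G.u α ∈ G.qToeplitz Z := by
  obtain ⟨hy2, w, hw, hyw⟩ := exists_inverse_mem_qToeplitz no_sinks hp hA
  set y := G.zShift Z p 1
  have hy : y ∈ G.qToeplitz Z := by
    have : y * y * w = y := by rw [mul_assoc, hyw, mul_one]
    rw [← this]
    exact mul_mem hy2 hw
  have hu : ∀ e, G.uEdge e ∈ G.qToeplitz Z := by
    intro e
    have h1 := G.zShift_mul_uEdge Z hp hA 0 e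
    -- Since `z u_e = u_e z_1`, multiplying by the inverse of `z_1` on the right isolates `u_e`.
    have h2 : G.uEdge e = G.z Z * G.uEdge e * w := by
      rw [← G.zShift_zero Z (p := p), h1, mul_assoc]
      exact (mul_one _).symm.trans (congrArg _ hyw.symm)
    rw [h2]
    exact mul_mem (z_mul_uEdge_mem e) hw
  refine ⟨?_, ?_, fun α => ?_⟩
  · rw [← hyw]
    exact mul_mem hy hw
  -- `z = endo z_1 = ∑ u_e z_1 u_e^*`, with all factors already in the algebra.
  · rw [← G.zShift_zero Z (p := p), ← G.endo_zShift Z hp hA, endo]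
    exact sum_mem fun e _ => mul_mem (mul_mem (hu e) hy) (star_mem (hu e))
  · induction α using Path.cons_induction with
    | vertex v =>
      obtain ⟨e, rfl⟩ := no_sinks v
      rw [u_vertex, ← star_uEdge_mul_uEdge]
      exact mul_mem (star_mem (hu e)) (hu e)
    | cons e β h ih =>
      rw [u_cons]
      exact mul_mem (hu e) ih

/-- `W_t` commutes with `Z`, and the phases picked up from `u_α` and `u_β^*` cancel because the
lengths agree. -/
theorem gauge_conj_gen {α β : G.Path} (h : α.len = β.len) (l : ℕ) (t : ℝ) :
    G.q (G.gauge t) * (G.u α * G.z Z ^ l * star (G.u β)) * star (G.q (G.gauge t)) =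
      G.u α * G.z Z ^ l * star (G.u β) := by
  set g := G.q (G.gauge t)
  have hz : g * G.z Z ^ l = G.z Z ^ l * g := by
    have h1 : Commute g (G.z Z) := by
      have := congrArg G.q (G.gauge_mul_weight Z t)
      rwa [map_mul, map_mul] at this
    exact (h1.pow_right l).eq
  have h2 : star (G.u β) * star g =
      star (Complex.exp (Complex.I * β.len * t)) • (star g * star (G.u β)) := by
    have := congrArg star (q_gauge_mul_u t β)
    rwa [star_mul, star_smul, star_mul] at this
  have h3 : Complex.exp (Complex.I * β.len * t) * star (Complex.exp (Complex.I * β.len * t)) = 1 := by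
    have : star (Complex.exp (Complex.I * β.len * t)) = Complex.exp (-(Complex.I * β.len * t)) := by
      simp [← Complex.exp_conj]
    rw [this, ← Complex.exp_add, add_neg_cancel, Complex.exp_zero]
  calc _ = (g * G.u α) * G.z Z ^ l * (star (G.u β) * star g) := by simp only [mul_assoc]
    _ = (Complex.exp (Complex.I * β.len * t) * star (Complex.exp (Complex.I * β.len * t))) •
        (G.u α * (g * G.z Z ^ l) * (star g * star (G.u β))) := by
      rw [q_gauge_mul_u, h2, h, smul_mul_assoc, smul_mul_smul_comm]
      simp only [mul_assoc]
      rfl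
    _ = G.u α * G.z Z ^ l * (g * star g) * star (G.u β) := by
      rw [h3, one_smul, hz]
      simp only [mul_assoc]
    _ = _ := by rw [q_gauge_mul_star, mul_one]

/-- The generators of `𝒞_n` are gauge-invariant elements of the closure of `q(𝒯)`, hence limits of
elements of `q(𝒟)`, which is closed. -/
theorem C_le_qD (no_sinks : ∀ v, ∃ e, G.s e = v) (hp : 1 ≤ p) (hA : G.ConditionA Z p) (n : ℕ) :
    G.C Z p n ≤ G.qD Z := by
  refine NonUnitalStarSubalgebra.topologicalClosure_minimal _
    (NonUnitalStarAlgebra.adjoin_le ?_) isClosed_qD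
  rintro _ ⟨α, β, l, -, h, -, -, rfl⟩
  obtain ⟨h1, hz, hu⟩ := generators_mem_qToeplitz no_sinks hp hA
  have hzl : G.z Z ^ l ∈ G.qToeplitz Z := by
    induction l with
    | zero => rwa [pow_zero]
    | succ l ih => rw [pow_succ]; exact mul_mem ih hz
  have hx : G.u α * G.z Z ^ l * star (G.u β) ∈ G.qToeplitz Z :=
    mul_mem (mul_mem (hu α) hzl) (star_mem (hu β))
  have := mem_closure_qD hp hA hx (gauge_conj_gen h l)
  rwa [isClosed_qD.closure_eq] at this

end DirGraph
end

/-! ### The theorem -/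

theorem mainTheorem6 {V E : Type*} [Fintype V] [Fintype E]
    (G : DirGraph V E) (no_sinks : ∀ v, ∃ e, G.s e = v)
    (Z : G.WeightSeq) (p : ℕ) (hp : 1 ≤ p) (hA : G.ConditionA Z p)
    (ξ : DirGraph.PathChoice G p) :
    ∃ (hle : ∀ n, G.C Z p n ≤ G.C Z p (n + 1)) (hD : ∀ n, G.C Z p n ≤ G.qD Z)
      (τ : ∀ n, G.C Z p n ≃⋆ₐ[ℂ] G.A Z ξ n),
      (∀ n (c : G.C Z p n), (τ n c : Matrix (G.Gam p n) (G.Gam p n) G.Calkin) =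
        G.tauFormula ξ n c) ∧
      (∀ n (γ₁ γ₂ : G.Gam p n) (hs : γ₁.1.src = γ₂.1.src) (b : G.Calkin)
        (hb : b ∈ G.Cv Z ξ γ₁.1.src),
        ((τ n).symm ⟨G.unit γ₁ γ₂ b, G.unit_mem Z ξ n γ₁ γ₂ hs b hb⟩ : G.Calkin) =
          G.u γ₁.1 * star (G.u (ξ.ξ γ₁.1.src)) * b * G.u (ξ.ξ γ₁.1.src) * star (G.u γ₂.1)) ∧
      IsClosed (G.qD Z : Set G.Calkin) ∧
      IsCStarDirectLimit.{w}
        (fun n => (τ (n + 1) : G.C Z p (n + 1) →⋆ₙₐ[ℂ] G.A Z ξ (n + 1)).comp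
          ((NonUnitalStarSubalgebra.inclusion (hle n)).comp
            ((τ n).symm : G.A Z ξ n →⋆ₙₐ[ℂ] G.C Z p n)))
        (fun n => (NonUnitalStarSubalgebra.inclusion (hD n)).comp
          ((τ n).symm : G.A Z ξ n →⋆ₙₐ[ℂ] G.C Z p n)) := by
  refine ⟨DirGraph.C_le_C_succ hA, DirGraph.C_le_qD no_sinks hp hA, DirGraph.tauEquiv ξ hp hA,
    fun n c => rfl, fun n γ₁ γ₂ hs b hb => ?_, DirGraph.isClosed_qD,
    IsCStarDirectLimit.of_dense (G.C Z p) (G.qD Z) (DirGraph.isClosed_C Z) DirGraph.isClosed_qD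
      _ _ (DirGraph.qD_subset_closure hp hA) _⟩
  have h : (DirGraph.tauEquiv ξ hp hA n).symm ⟨G.unit γ₁ γ₂ b, G.unit_mem Z ξ n γ₁ γ₂ hs b hb⟩ =
      ⟨_, DirGraph.untau_mem ξ hp hA γ₁ γ₂ hs hb⟩ := by
    rw [StarAlgEquiv.symm_apply_eq]
    exact Subtype.ext (DirGraph.tauFormula_untau ξ γ₁ γ₂ hs hb).symm
  rw [h]
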